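/- Let $\{(X_{n,k}^{(1)},X_{n,k}^{(2)}),\ 1\le k\le n,\ n\ge 1\}$ be a triangular array of bivariate random vectors such that for every $n$ the $2n$ variables of row $n$ are jointly Gaussian with mean zero and unit variance, and, for $1\le k\ne l\le n$ and $i,j\in\{1,2\}$, $$\mathrm{corr}(X_{n,k}^{(1)},X_{n,k}^{(2)})=\rho_0(n),\qquad \mathrm{corr}(X_{n,k}^{(i)},X_{n,l}^{(j)})=\rho_{ij}(|k-l|,n).$$ Let $M_n^{(i)}=\max_{1\le k\le n}X_{n,k}^{(i)}$ and $u_n(s)=a_ns+b_n$ with $$a_n=\frac1{\sqrt{2\ln n}},\qquad b_n=\sqrt{2\ln n}-\frac{\ln(4\pi\ln n)}{2\sqrt{2\ln n}}.$$ For $\lambda\in(0,\infty)$ let $$H_\lambda(x,y)=\exp\Bigl(-\Phi\bigl(\lambda+\tfrac{x-y}{2\lambda}\bigr)e^{-y}-\Phi\bigl(\lambda+\tfrac{y-x}{2\lambda}\bigr)e^{-x}\Bigr),\qquad x,y\in\mathbb R,$$ where $\Phi$ is the standard Gaussian distribution function, and let $H_0(x,y)=\min(\Lambda(x),\Lambda(y))$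 and $H_\infty(x,y)=\Lambda(x)\Lambda(y)$ with $\Lambda(x)=\exp(-e^{-x})$. Suppose that $(1-\rho_0(n))\ln n\to\lambda^2$ for some $\lambda\in[0,\infty]$. Suppose further that for all $i,j\in\{1,2\}$ there are constants $\tau_{ij}\in(0,\infty)$ and $\varpi_{ij}$ such that $\delta_{ij}:=\sup_{1\le k<n,\ n\ge2}|\rho_{ij}(k,n)|<1$, $0<\varpi_{ij}<\frac{1-\delta_{ij}}{1+\delta_{ij}}$ and $$\lim_{n\to\infty}\ \max_{\lfloor n^{\varpi_{ij}}\rfloor\le k<n}|\rho_{ij}(k,n)\ln k-\tau_{ij}|=0.$$ Put $\widetilde\tau=\tau_{12}-\frac12(\tau_{11}+\tau_{22})$, and assume that $\tau_{12}\le\sqrt{\tau_{11}\tau_{22}}$ and $\lambda^2\ge-\widetilde\tau$. Let $\widetilde\lambda=\sqrt{\lambda^2+\widetilde\tau}\in[0,\infty]$ (so $\widetilde\lambda=\infty$ if $\lambda=\infty$), and let $(Z,W)$ be a bivariate Gaussian random vector with zero means, unit variances and correlation $\tau_{12}/\sqrt{\tau_{11}\tau_{22}}$. Then $$\lim_{n\to\infty}\sup_{x,y\in\mathbb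 R}\Bigl|\mathbb P\bigl(M_n^{(1)}\le u_n(x),\,M_n^{(2)}\le u_n(y)\bigr)-\mathbb E\Bigl[H_{\widetilde\lambda}\bigl(x+\tau_{11}-\sqrt{2\tau_{11}}\,Z,\;y+\tau_{22}-\sqrt{2\tau_{22}}\,W\bigr)\Bigr]\Bigr|=0.$$ -/

import Mathlib

open MeasureTheory ProbabilityTheory Filter Topology
open scoped ENNReal

namespace HuslerReiss

/-- Distribution function of the standard Gaussian law on the real line. -/
noncomputable def Phi (x : ℝ) : ℝ := cdf (gaussianReal 0 1) x

/-- The Gumbel distribution function. -/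
noncomputable def gumbel (x : ℝ) : ℝ := Real.exp (-Real.exp (-x))

/-- The bivariate Hüsler-Reiss distribution function with parameter in `[0, ∞]`. -/
noncomputable def H (lam : ℝ≥0∞) (x y : ℝ) : ℝ :=
  if lam = 0 then min (gumbel x) (gumbel y)
  else if lam = ∞ then gumbel x * gumbel y
  else Real.exp
    (-Phi (lam.toReal + (x - y) / (2 * lam.toReal)) * Real.exp (-y)
      - Phi (lam.toReal + (y - x) / (2 * lam.toReal)) * Real.exp (-x))

/-- A triangular array `X n k i` (`n ≥ 1` the row, `1 ≤ k ≤ n` the place in the row, `i : Fin 2`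
the component) of bivariate random vectors whose rows are jointly Gaussian, centred, with unit
variances; the correlation of the two components of one vector of row `n` is `ρ₀ n`, and that of
the components `i`, `j` of two different vectors of row `n` is `ρ i j |k - l| n`.
Since the variances are one, correlations are covariances. -/
structure IsGaussianArray {Ω : Type*} [MeasurableSpace Ω] (P : Measure Ω)
    (X : ℕ → ℕ → Fin 2 → Ω → ℝ) (ρ₀ : ℕ → ℝ) (ρ : Fin 2 → Fin 2 → ℕ → ℕ → ℝ) : Prop where
  gaussian : ∀ n, 1 ≤ n →
    HasGaussianLaw (fun ω => fun p : Set.Icc 1 n × Fin 2 => X n p.1 p.2 ω) P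
  mean : ∀ n k i, 1 ≤ k → k ≤ n → ∫ ω, X n k i ω ∂P = 0
  var : ∀ n k i, 1 ≤ k → k ≤ n → Var[X n k i; P] = 1
  corr_same : ∀ n k, 1 ≤ k → k ≤ n → cov[X n k 0, X n k 1; P] = ρ₀ n
  corr_diff : ∀ n k l i j, 1 ≤ k → k ≤ n → 1 ≤ l → l ≤ n → k ≠ l →
    cov[X n k i, X n l j; P] = ρ i j ((k : ℤ) - (l : ℤ)).natAbs n

/-- Strong dependence: for all `i`, `j` one has `τ i j > 0`, the supremum `δ` of `|ρ i j k n|` over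
`1 ≤ k < n` is less than one, and, for some `ϖ ∈ (0, (1 - δ) / (1 + δ))`, the maximum over
`⌊n ^ ϖ⌋ ≤ k < n` of `|ρ i j k n * log k - τ i j|` tends to zero. -/
def StrongDependence (ρ : Fin 2 → Fin 2 → ℕ → ℕ → ℝ) (τ : Fin 2 → Fin 2 → ℝ) : Prop :=
  ∀ i j, 0 < τ i j ∧
    ∃ δ ϖ : ℝ, IsLUB {r : ℝ | ∃ k n : ℕ, 1 ≤ k ∧ k < n ∧ r = |ρ i j k n|} δ ∧ δ < 1 ∧
      0 < ϖ ∧ ϖ < (1 - δ) / (1 + δ) ∧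
      Tendsto (fun n : ℕ => ⨆ k : Set.Ico ⌊(n : ℝ) ^ ϖ⌋₊ n,
        |ρ i j k n * Real.log (k : ℕ) - τ i j|) atTop (𝓝 0)

/-- Normalizing constants and the affine normalization `u_n(s) = a_n s + b_n`. -/
noncomputable def a (n : ℕ) : ℝ := 1 / √(2 * Real.log n)

noncomputable def b (n : ℕ) : ℝ :=
  √(2 * Real.log n) - 1 / (2 * √(2 * Real.log n)) * Real.log (4 * Real.pi * Real.log n)

noncomputable def u (n : ℕ) (s : ℝ) : ℝ := a n * s + b n

/-- The maximum over `1 ≤ k ≤ n` of component `i` in row `n`. -/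
noncomputable def M {Ω : Type*} (X : ℕ → ℕ → Fin 2 → Ω → ℝ) (n : ℕ) (i : Fin 2) (ω : Ω) : ℝ :=
  ⨆ k : Set.Icc 1 n, X n k i ω

/-- `τ̃ = τ₁₂ - (τ₁₁ + τ₂₂) / 2`. -/
noncomputable def tauTilde (τ : Fin 2 → Fin 2 → ℝ) : ℝ := τ 0 1 - (τ 0 0 + τ 1 1) / 2

/-- `λ̃ = √(λ² + τ̃)`, which is `∞` for `λ = ∞`. -/
noncomputable def lamTilde (lam : ℝ≥0∞) (τ : Fin 2 → Fin 2 → ℝ) : ℝ≥0∞ :=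
  if lam = ∞ then ∞ else ENNReal.ofReal √(lam.toReal ^ 2 + tauTilde τ)

/-- `(Z, W)` is a Gaussian vector with zero means, unit variances and correlation `r`. -/
structure IsStdBivariateGaussian {Ω : Type*} [MeasurableSpace Ω] (Q : Measure Ω)
    (Z W : Ω → ℝ) (r : ℝ) : Prop where
  gaussian : HasGaussianLaw (fun ω => (Z ω, W ω)) Q
  mean_fst : ∫ ω, Z ω ∂Q = 0
  mean_snd : ∫ ω, W ω ∂Q = 0
  var_fst : Var[Z; Q] = 1
  var_snd : Var[W; Q] = 1
  corr : cov[Z, W; Q] = r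

end HuslerReiss

namespace HuslerReiss

/-! Row `n` is compared with a one-factor Gaussian model. In it, component `i` of every vector is
`√(τ i i / log n)` times a common factor, distributed as `Z` for the first component and `W` for the
second, plus `√(1 - τ i i / log n)` times local noise. The noise pairs are independent across
places, with correlation `noiseCorr` inside a pair. Two different vectors of the model then have
covariances `τ i j / log n`, which is what strong dependence prescribes to leading order, and
`noiseCorr` is chosen so that the correlation inside a vector is `ρ₀ n` whenever this is possible.

Given the common factor, the model is an i.i.d. array. Dividing by the noise scale moves the level
`u n x` to `u n (x + τ - √(2τ) z + o(1))` (`tendsto_shifted_level`), and `(1 - noiseCorr) log n`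
tends to `λ² + τ̃` (`tendsto_ofReal_one_sub_noiseCorr`). The i.i.d. limit theorem thus applies
conditionally: `n` times the probability that one pair exceeds converges
(`tendsto_natCast_mul_one_sub`) to the exponent of `H` (`H_eq_exp`), and an `n`-th power turns this
into the exponential. Dominated convergence over the factor gives the mixture
(`tendsto_integral_factorModel`).

The passage from the array to the model is the normal comparison inequality
(`abs_measureReal_sub_le_of_gaussian`): two Gaussian distribution functions differ by at most a sum
over pairs of covariance differences times a bound for the joint density at the levels. Pairs at lag
below `n ^ ϖ` are few and have correlation bounded away from one. At larger lags the densities add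
up to order `log n`, while the covariance differences are `o(1 / log n)` on average
(`exists_bound_tendsto_zero`). Pairs inside a vector contribute only when the required noise
correlation leaves `[-1, 1]`, and then negligibly (`tendsto_diagonal_bound`).

The convergence so obtained is pointwise with a continuous limit; monotonicity and control at
infinity make it uniform (`eventually_abs_sub_le_of_monotone`). -/

/-! ### Gaussian integration by parts -/

lemma hasDerivAt_gaussianPDFReal (m : ℝ) (v : NNReal) (x : ℝ) :
    HasDerivAt (gaussianPDFReal m v) (-((x - m) / v) * gaussianPDFReal m v x) x := by
  unfold gaussianPDFReal
  have h1 : HasDerivAt (fun x : ℝ => -(x - m) ^ 2 / (2 * (v : ℝ))) (-((x - m) / v)) x := by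
    have := (((hasDerivAt_id x).sub_const m).pow 2).neg.div_const (2 * (v : ℝ))
    convert! this using 1
    simp
    ring
  convert! (h1.exp.const_mul (√(2 * Real.pi * v))⁻¹) using 1
  ring

/-- Stein's identity: the centred density `p` satisfies `p' = -(x / v) p`, so this is one
integration by parts. For `v = 0` the law is a point mass at `0` and both sides vanish. -/
lemma integral_id_mul_gaussianReal (v : NNReal) {G G' : ℝ → ℝ} {C : ℝ}
    (hG : ∀ x, HasDerivAt G (G' x) x) (hG' : Continuous G') (hb : ∀ x, |G x| ≤ C)
    (hb' : ∀ x, |G' x| ≤ C) :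
    ∫ x, x * G x ∂gaussianReal 0 v = v * ∫ x, G' x ∂gaussianReal 0 v := by
  by_cases hv : v = 0
  · subst hv; simp
  have hGc : Continuous G := continuous_iff_continuousAt.2 fun x => (hG x).continuousAt
  rw [integral_gaussianReal_eq_integral_smul hv, integral_gaussianReal_eq_integral_smul hv]
  have hint : Integrable (fun x : ℝ => x * gaussianPDFReal 0 v x) := by
    have h := (IsGaussian.hasGaussianLaw_id (μ := gaussianReal 0 v)).integrable
    rw [gaussianReal_of_var_ne_zero _ hv] at h
    rw [integrable_withDensity_iff_integrable_smul' (by fun_prop) (by simp [gaussianPDF])] at h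
    simpa [mul_comm] using h
  have hi1 : Integrable (fun x => G x * (x * gaussianPDFReal 0 v x)) :=
    hint.bdd_mul hGc.aestronglyMeasurable (ae_of_all _ hb)
  have hi2 : Integrable (fun x => G' x * gaussianPDFReal 0 v x) :=
    (integrable_gaussianPDFReal 0 v).bdd_mul hG'.aestronglyMeasurable (ae_of_all _ hb')
  have hi3 : Integrable (fun x => G x * gaussianPDFReal 0 v x) :=
    (integrable_gaussianPDFReal 0 v).bdd_mul hGc.aestronglyMeasurable (ae_of_all _ hb)
  have hv' : (v : ℝ) ≠ 0 := by exact_mod_cast hv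
  have key := integral_mul_deriv_eq_deriv_mul_of_integrable (u := G) (u' := G')
    (v := gaussianPDFReal 0 v) (v' := fun x => -((x - 0) / v) * gaussianPDFReal 0 v x) (fun x _ => hG x)
    (fun x _ => hasDerivAt_gaussianPDFReal 0 v x)
    (by
      convert! hi1.const_mul (-(v : ℝ)⁻¹) using 2 with x
      simp
      field_simp) hi2 hi3
  have e1 : ∫ x, gaussianPDFReal 0 v x • (x * G x)
      = -v * ∫ x, G x * (-((x - 0) / v) * gaussianPDFReal 0 v x) := by
    rw [← integral_const_mul]
    congr 1 with x
    simp
    field_simp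
  rw [e1, key]
  simp [mul_comm]

/-- Regression of `V` on `U` leaves a residual that is uncorrelated with `U`, hence independent of
it by joint Gaussianity. Fubini then reduces the claim to the one-dimensional Stein identity along
the regression direction `d`. -/
theorem integral_mul_comp_gaussian {Ω ι : Type*} [MeasurableSpace Ω] [Fintype ι] {P : Measure Ω}
    {U : Ω → ℝ} {V : Ω → ι → ℝ} (h : HasGaussianLaw (fun ω => (U ω, V ω)) P)
    (hU : ∫ ω, U ω ∂P = 0) {F : (ι → ℝ) → ℝ} {F' : (ι → ℝ) → (ι → ℝ) →L[ℝ] ℝ} {C : ℝ}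
    (hF : ∀ x, HasFDerivAt F (F' x) x) (hF' : Continuous F') (hb : ∀ x, |F x| ≤ C)
    (hb' : ∀ x, ‖F' x‖ ≤ C) :
    ∫ ω, U ω * F (V ω) ∂P = ∫ ω, F' (V ω) (fun q => cov[U, fun ω => V ω q; P]) ∂P := by
  have hP := h.isProbabilityMeasure
  set c : ι → ℝ := fun q => cov[U, fun ω => V ω q; P] with hc
  have hUg : HasGaussianLaw U P := h.fst
  have hVg : HasGaussianLaw V P := h.snd
  set v : NNReal := Var[U; P].toNNReal with hv
  have hvv : (v : ℝ) = Var[U; P] := Real.coe_toNNReal _ (variance_nonneg _ _)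
  have hlaw : P.map U = gaussianReal 0 v := by rw [hUg.map_eq_gaussianReal, hU]
  have hVq : ∀ q, MemLp (fun ω => V ω q) 2 P := fun q => (hVg.eval q).memLp_two
  -- If `v = 0`, the quotient is `0` by convention; `U` is then almost surely `0`, so `c q = 0` and
  -- the degenerate case needs no separate treatment later.
  have hcv : ∀ q, c q / v * v = c q := by
    intro q
    by_cases h0 : (v : ℝ) = 0
    · have hz : U =ᵐ[P] fun _ => 0 := by
        have := ae_eq_integral_of_variance_eq_zero hUg.memLp_two (hvv ▸ h0)
        filter_upwards [this] with ω hω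
        simpa [hU] using hω
      have : c q = 0 := by
        simp only [hc, covariance, hU]
        refine integral_eq_zero_of_ae ?_
        filter_upwards [hz] with ω hω
        simp [hω]
      simp [this]
    · field_simp
  set d : ι → ℝ := fun q => c q / v with hd
  set R : Ω → ι → ℝ := fun ω q => V ω q - d q * U ω with hR
  have hUR : HasGaussianLaw (fun ω => (U ω, R ω)) P := by
    let T : (ℝ × (ι → ℝ)) →L[ℝ] (ℝ × (ι → ℝ)) :=
      (ContinuousLinearMap.fst ℝ ℝ (ι → ℝ)).prod (ContinuousLinearMap.snd ℝ ℝ (ι → ℝ) -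
        (ContinuousLinearMap.fst ℝ ℝ (ι → ℝ)).smulRight d)
    convert! h.map_fun T using 2 with ω
    ext q <;> simp [T, R, mul_comm]
  have hind : IndepFun U R P := by
    have h1 : HasGaussianLaw (fun ω => ((fun _ : Unit => U ω), fun q => R ω q)) P := by
      let T : (ℝ × (ι → ℝ)) →L[ℝ] ((Unit → ℝ) × (ι → ℝ)) :=
        (ContinuousLinearMap.pi fun _ => ContinuousLinearMap.fst ℝ ℝ (ι → ℝ)).prod
          (ContinuousLinearMap.snd ℝ ℝ (ι → ℝ))
      exact hUR.map_fun T
    have h2 := HasGaussianLaw.indepFun_of_covariance_eval (X := fun _ : Unit => U)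
      (Y := fun q ω => R ω q) h1 (by
        intro _ q
        have : (fun ω => R ω q) = fun ω => V ω q - (fun ω => d q * U ω) ω := rfl
        rw [this, covariance_fun_sub_right hUg.memLp_two (hVq q) (hUg.memLp_two.const_mul _),
          covariance_const_mul_right, covariance_self hUg.aemeasurable, ← hvv]
        have := hcv q
        simp only [hd, this]
        simp [hc])
    exact h2.comp (φ := fun f : Unit → ℝ => f ()) (ψ := id) (measurable_pi_apply _) measurable_id
  have hVR : ∀ ω, V ω = R ω + U ω • d := by intro ω; ext q; simp [hR, mul_comm]
  have hFc : Continuous F := continuous_iff_continuousAt.2 fun x => (hF x).continuousAt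
  have hRm : AEMeasurable R P := hUR.snd.aemeasurable
  have hjoint : P.map (fun ω => (U ω, R ω)) = (P.map U).prod (P.map R) :=
    (indepFun_iff_map_prod_eq_prod_map_map hUg.aemeasurable hRm).1 hind
  have hPR : IsProbabilityMeasure (P.map R) := Measure.isProbabilityMeasure_map hRm
  have hUi : Integrable (fun x : ℝ => x) (gaussianReal 0 v) :=
    (IsGaussian.hasGaussianLaw_id (μ := gaussianReal 0 v)).integrable
  have cont2 : Continuous fun x : ℝ × (ι → ℝ) => x.2 + x.1 • d := by fun_prop
  have lhs : ∫ ω, U ω * F (V ω) ∂P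
      = ∫ r, ∫ x, x * F (r + x • d) ∂(gaussianReal 0 v) ∂(P.map R) := by
    have : ∫ ω, U ω * F (V ω) ∂P
        = ∫ x, x.1 * F (x.2 + x.1 • d) ∂(P.map (fun ω => (U ω, R ω))) := by
      rw [integral_map (hUg.aemeasurable.prodMk hRm) (by fun_prop)]
      simp_rw [hVR]
    rw [this, hjoint, hlaw, integral_prod_symm]
    have := (hUi.comp_fst (P.map R)).bdd_mul (c := C)
      ((hFc.comp cont2).aestronglyMeasurable) (ae_of_all _ fun x => hb _)
    simpa [mul_comm] using this
  have rhs : ∫ ω, F' (V ω) c ∂P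
      = ∫ r, ∫ x, F' (r + x • d) c ∂(gaussianReal 0 v) ∂(P.map R) := by
    have hcont : Continuous fun x : ℝ × (ι → ℝ) => F' (x.2 + x.1 • d) c :=
      (hF'.comp cont2).clm_apply continuous_const
    have : ∫ ω, F' (V ω) c ∂P
        = ∫ x, F' (x.2 + x.1 • d) c ∂(P.map (fun ω => (U ω, R ω))) := by
      rw [integral_map (hUg.aemeasurable.prodMk hRm) hcont.aestronglyMeasurable]
      simp_rw [hVR]
    rw [this, hjoint, hlaw, integral_prod_symm]
    exact Integrable.of_bound hcont.aestronglyMeasurable (C * ‖c‖)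
      (ae_of_all _ fun x => (F' _).le_of_opNorm_le (hb' _) _)
  rw [lhs, rhs]
  congr 1 with r
  have hC : 0 ≤ C := (abs_nonneg _).trans (hb 0)
  rw [integral_id_mul_gaussianReal v (G := fun x => F (r + x • d)) (G' := fun x => F' (r + x • d) d)
    (C := C + C * ‖d‖)]
  · rw [← integral_const_mul]
    congr 1 with x
    have : c = (v : ℝ) • d := by ext q; rw [← hcv q]; simp [hd, mul_comm]
    rw [this, map_smul, smul_eq_mul]
  · intro x
    have h1 : HasDerivAt (fun x : ℝ => r + x • d) d x := by
      simpa using ((hasDerivAt_id x).smul_const d).const_add r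
    exact (hF _).comp_hasDerivAt x h1
  · exact (hF'.comp (by fun_prop)).clm_apply continuous_const
  · intro x
    exact (hb _).trans (le_add_of_nonneg_right (by positivity))
  · intro x
    exact ((F' _).le_of_opNorm_le (hb' _) d).trans (le_add_of_nonneg_left hC)

/-! ### A bound for bivariate Gaussian densities at high levels -/

/-- Bound for the density, on `[w, ∞)²`, of a bivariate standard Gaussian law with correlation at
most `R`. -/
noncomputable def densityBound (R w : ℝ) : ℝ :=
  (2 * Real.pi * √(1 - R ^ 2))⁻¹ * Real.exp (-w ^ 2 / (1 + R))

lemma densityBound_nonneg (R w : ℝ) : 0 ≤ densityBound R w := by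
  unfold densityBound; positivity

/-- The left side is the joint density, factored as marginal times conditional. For `r ≥ 0` the
quadratic form on the quadrant is smallest at `(w, w)`, which gives the exponent `-w² / (1 + r)`,
and everything increases with `r`. For `r < 0` the normalizing factor may be large, but the
exponential more than compensates because `w ≥ 1`. Hence an upper bound on the correlation is
enough. -/
lemma gaussianPDFReal_mul_le_densityBound {r R w s t : ℝ} (hr : -1 < r) (hrR : r ≤ R) (hR0 : 0 ≤ R)
    (hR1 : R < 1) (hw : 1 ≤ w) (hs : w ≤ s) (ht : w ≤ t) :
    gaussianPDFReal 0 1 s * gaussianPDFReal (r * s) (1 - r ^ 2).toNNReal t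
      ≤ densityBound R w := by
  have hr1 : 0 < 1 - r ^ 2 := by nlinarith
  have hR2 : 0 < 1 - R ^ 2 := by nlinarith
  have hq : 0 < √(1 - r ^ 2) := Real.sqrt_pos.2 hr1
  have hQ : 0 < √(1 - R ^ 2) := Real.sqrt_pos.2 hR2
  have e : gaussianPDFReal 0 1 s * gaussianPDFReal (r * s) (1 - r ^ 2).toNNReal t
      = (2 * Real.pi)⁻¹ * ((√(1 - r ^ 2))⁻¹ *
        Real.exp (-(s ^ 2 - 2 * r * s * t + t ^ 2) / (2 * (1 - r ^ 2)))) := by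
    unfold gaussianPDFReal
    rw [Real.coe_toNNReal _ hr1.le, Real.sqrt_mul (x := 2 * Real.pi) (by positivity) (1 - r ^ 2)]
    have h1 : (√(2 * Real.pi * (1 : NNReal)))⁻¹ * (√(2 * Real.pi))⁻¹ = (2 * Real.pi)⁻¹ := by
      rw [NNReal.coe_one, mul_one, ← mul_inv, Real.mul_self_sqrt (by positivity)]
    have h2 : Real.exp (-(s ^ 2 - 2 * r * s * t + t ^ 2) / (2 * (1 - r ^ 2)))
        = Real.exp (-(s - 0) ^ 2 / (2 * (1 : NNReal)))
          * Real.exp (-(t - r * s) ^ 2 / (2 * (1 - r ^ 2))) := by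
      rw [← Real.exp_add]
      congr 1
      rw [NNReal.coe_one]
      field_simp
      ring
    rw [h2, ← h1, mul_inv (√(2 * Real.pi)) (√(1 - r ^ 2))]
    ring
  rw [e, densityBound, mul_inv (2 * Real.pi), mul_assoc (2 * Real.pi)⁻¹]
  refine mul_le_mul_of_nonneg_left ?_ (inv_nonneg.2 (by positivity))
  rcases le_or_gt 0 r with h0 | h0
  · have hrr : r ^ 2 ≤ R ^ 2 := by gcongr
    refine mul_le_mul (inv_anti₀ hQ (Real.sqrt_le_sqrt (by linarith))) ?_ (by positivity)
      (by positivity)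
    refine Real.exp_le_exp.2 ?_
    have h1 : -(s ^ 2 - 2 * r * s * t + t ^ 2) / (2 * (1 - r ^ 2)) ≤ -w ^ 2 / (1 + r) := by
      rw [div_le_div_iff₀ (by positivity) (by positivity)]
      have : 2 * (1 - r) * w ^ 2 ≤ s ^ 2 - 2 * r * s * t + t ^ 2 := by
        have hs2 : w ^ 2 ≤ s ^ 2 := by gcongr
        have ht2 : w ^ 2 ≤ t ^ 2 := by gcongr
        nlinarith [mul_nonneg h0 (sq_nonneg (s - t)),
          mul_nonneg (by linarith : 0 ≤ 1 - r) (by linarith : 0 ≤ s ^ 2 + t ^ 2 - 2 * w ^ 2)]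
      nlinarith [mul_le_mul_of_nonneg_right this (by linarith : 0 ≤ 1 + r)]
    refine h1.trans ?_
    rw [neg_div, neg_div, neg_le_neg_iff]
    gcongr
  -- The prefactor is `√x ≤ exp ((x - 1) / 2)` and the exponent is at most `-w² x`; as `w² ≥ 1` and
  -- `x ≥ 1`, their product is at most `exp (-w²)`.
  · set x := (1 - r ^ 2)⁻¹ with hx
    have hx1 : 1 ≤ x := (one_le_inv₀ hr1).2 (by nlinarith)
    have hsx : (√(1 - r ^ 2))⁻¹ ≤ Real.exp ((x - 1) / 2) := by
      rw [← Real.sqrt_inv, ← hx, Real.sqrt_le_left (Real.exp_pos _).le, ← Real.exp_nat_mul]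
      have := Real.add_one_le_exp (x - 1)
      convert! this using 1 <;> [ring; (congr 1; push_cast; ring)]
    have hex : -(s ^ 2 - 2 * r * s * t + t ^ 2) / (2 * (1 - r ^ 2)) ≤ -w ^ 2 * x := by
      have : -(s ^ 2 - 2 * r * s * t + t ^ 2) / (2 * (1 - r ^ 2))
        = -((s ^ 2 - 2 * r * s * t + t ^ 2) / 2) * x := by rw [hx]; field_simp
      rw [this]
      have hs2 : w ^ 2 ≤ s ^ 2 := by gcongr
      have ht2 : w ^ 2 ≤ t ^ 2 := by gcongr
      have hst : 0 ≤ s * t := mul_nonneg (by linarith) (by linarith)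
      gcongr
      nlinarith [mul_nonneg (by linarith : 0 ≤ -r) hst]
    have hmain : (√(1 - r ^ 2))⁻¹ *
        Real.exp (-(s ^ 2 - 2 * r * s * t + t ^ 2) / (2 * (1 - r ^ 2))) ≤ Real.exp (-w ^ 2) := by
      refine (mul_le_mul hsx (Real.exp_le_exp.2 hex) (by positivity) (by positivity)).trans ?_
      rw [← Real.exp_add, Real.exp_le_exp]
      have hw2 : 1 ≤ w ^ 2 := one_le_pow₀ hw
      nlinarith [mul_nonneg (by linarith : 0 ≤ x - 1) (by linarith : 0 ≤ w ^ 2 - 1)]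
    refine hmain.trans ?_
    have h1 : Real.exp (-w ^ 2) ≤ Real.exp (-w ^ 2 / (1 + R)) := by
      rw [Real.exp_le_exp, neg_div, neg_le_neg_iff]
      exact div_le_self (by positivity) (by linarith)
    have h2 : 1 ≤ (√(1 - R ^ 2))⁻¹ := by
      refine (one_le_inv₀ hQ).2 ?_
      rw [Real.sqrt_le_left zero_le_one]; nlinarith
    exact h1.trans (le_mul_of_one_le_left (Real.exp_pos _).le h2)

/-- Since `f` and `g` are probability densities carried by `[w, ∞)`, the expectation is an average
of the joint density over that quadrant. It is computed by writing `B` as `r A` plus an independent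
Gaussian residual. -/
theorem integral_mul_le_densityBound {Ω : Type*} [MeasurableSpace Ω] {P : Measure Ω}
    {A B : Ω → ℝ} (h : HasGaussianLaw (fun ω => (A ω, B ω)) P) (hA : ∫ ω, A ω ∂P = 0)
    (hB : ∫ ω, B ω ∂P = 0) (vA : Var[A; P] = 1) (vB : Var[B; P] = 1) {R w : ℝ}
    (hcov : cov[A, B; P] ≤ R) (hR0 : 0 ≤ R) (hR1 : R < 1) (hw : 1 ≤ w) {f g : ℝ → ℝ} {C : ℝ}
    (hf : Continuous f) (hg : Continuous g) (f0 : ∀ x, 0 ≤ f x) (g0 : ∀ x, 0 ≤ g x)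
    (fC : ∀ x, f x ≤ C) (gC : ∀ x, g x ≤ C)
    (fw : ∀ x < w, f x = 0) (gw : ∀ x < w, g x = 0) (fi : ∫ x, f x = 1) (gi : ∫ x, g x = 1) :
    ∫ ω, f (A ω) * g (B ω) ∂P ≤ densityBound R w := by
  have hP := h.isProbabilityMeasure
  have hAg : HasGaussianLaw A P := h.fst
  have hBg : HasGaussianLaw B P := h.snd
  have cAA : cov[A, A; P] = 1 := by rw [covariance_self hAg.aemeasurable, vA]
  have cBB : cov[B, B; P] = 1 := by rw [covariance_self hBg.aemeasurable, vB]
  set r := cov[A, B; P] with hr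
  set E : Ω → ℝ := fun ω => B ω - r * A ω with hE
  have hAE : HasGaussianLaw (fun ω => (A ω, E ω)) P := by
    let T : (ℝ × ℝ) →L[ℝ] (ℝ × ℝ) := (ContinuousLinearMap.fst ℝ ℝ ℝ).prod
      (ContinuousLinearMap.snd ℝ ℝ ℝ - r • ContinuousLinearMap.fst ℝ ℝ ℝ)
    exact h.map_fun T
  have hEg : HasGaussianLaw E P := hAE.snd
  have cAE : cov[A, E; P] = 0 := by
    simp only [hE]
    rw [covariance_fun_sub_right hAg.memLp_two hBg.memLp_two (hAg.memLp_two.const_mul _),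
      covariance_const_mul_right, cAA, ← hr]
    ring
  have mE : ∫ ω, E ω ∂P = 0 := by
    simp only [hE]
    rw [integral_sub hBg.integrable (hAg.integrable.const_mul _), integral_const_mul, hA, hB]
    ring
  have vE : Var[E; P] = 1 - r ^ 2 := by
    rw [← covariance_self hEg.aemeasurable]
    conv_lhs => simp only [hE]
    rw [covariance_fun_sub_fun_sub hBg.memLp_two (hAg.memLp_two.const_mul _) hBg.memLp_two
      (hAg.memLp_two.const_mul _), covariance_const_mul_right, covariance_const_mul_left,
      covariance_const_mul_left, covariance_const_mul_right, cAA, cBB, covariance_comm B A, ← hr]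
    ring
  have hrsq : 0 ≤ 1 - r ^ 2 := vE ▸ variance_nonneg _ _
  have hr1 : -1 ≤ r := by nlinarith
  have hind : IndepFun A E P := hAE.indepFun_of_covariance_eq_zero cAE
  -- At correlation `-1` there is no joint density, but `B = -A` almost surely and the two variables
  -- cannot both reach the positive level `w`.
  rcases hr1.eq_or_lt with hr1 | hr1
  · have hE0 : E =ᵐ[P] fun _ => 0 := by
      have := ae_eq_integral_of_variance_eq_zero hEg.memLp_two (by rw [vE, ← hr1]; norm_num)
      filter_upwards [this] with ω hω
      simpa [mE] using hω
    have : ∫ ω, f (A ω) * g (B ω) ∂P = 0 := by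
      refine integral_eq_zero_of_ae ?_
      filter_upwards [hE0] with ω hω
      have hBA : B ω = - A ω := by simp only [hE, ← hr1] at hω; linarith
      simp only [Pi.zero_apply]
      by_cases hAw : A ω < w
      · rw [fw _ hAw, zero_mul]
      · rw [gw (B ω) (by linarith), mul_zero]
    rw [this]; exact densityBound_nonneg _ _
  have hpos : 0 < 1 - r ^ 2 := by nlinarith
  have hv0 : (1 - r ^ 2).toNNReal ≠ 0 := by simpa using hpos
  have lA : P.map A = gaussianReal 0 1 := by rw [hAg.map_eq_gaussianReal, hA, vA]; simp
  have lE : P.map E = gaussianReal 0 (1 - r ^ 2).toNNReal := by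
    rw [hEg.map_eq_gaussianReal, mE, vE]
  have hjoint : P.map (fun ω => (A ω, E ω)) = (P.map A).prod (P.map E) :=
    (indepFun_iff_map_prod_eq_prod_map_map hAg.aemeasurable hEg.aemeasurable).1 hind
  have hcont : Continuous fun x : ℝ × ℝ => f x.1 * g (x.2 + r * x.1) := by fun_prop
  have e1 : ∫ ω, f (A ω) * g (B ω) ∂P
      = ∫ s, f s * (∫ t, gaussianPDFReal (r * s) (1 - r ^ 2).toNNReal t * g t)
        ∂(gaussianReal 0 1) := by
    have : ∫ ω, f (A ω) * g (B ω) ∂P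
        = ∫ x, f x.1 * g (x.2 + r * x.1) ∂(P.map (fun ω => (A ω, E ω))) := by
      rw [integral_map (hAg.aemeasurable.prodMk hEg.aemeasurable) hcont.aestronglyMeasurable]
      simp [hE]
    rw [this, hjoint, lA, lE, integral_prod]
    · congr 1 with s
      simp only
      rw [integral_const_mul]
      congr 1
      have hm : ∫ t, g t ∂(gaussianReal (r * s) (1 - r ^ 2).toNNReal)
          = ∫ e, g (e + r * s) ∂(gaussianReal 0 (1 - r ^ 2).toNNReal) := by
        rw [← zero_add (r * s), ← gaussianReal_map_add_const,
          integral_map (by fun_prop) hg.aestronglyMeasurable, zero_add]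
      rw [← hm, integral_gaussianReal_eq_integral_smul hv0]
      simp
    · refine Integrable.of_bound hcont.aestronglyMeasurable (C * C) (ae_of_all _ fun x => ?_)
      rw [Real.norm_of_nonneg (mul_nonneg (f0 _) (g0 _))]
      exact mul_le_mul (fC _) (gC _) (g0 _) ((f0 _).trans (fC x.1))
  rw [e1, integral_gaussianReal_eq_integral_smul one_ne_zero]
  have hfi : Integrable f := by
    by_contra hn; rw [integral_undef hn] at fi; simp at fi
  have hgi : Integrable g := by
    by_contra hn; rw [integral_undef hn] at gi; simp at gi
  have key : ∀ s, gaussianPDFReal 0 1 s • (f s * ∫ t, gaussianPDFReal (r * s)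
      (1 - r ^ 2).toNNReal t * g t) ≤ densityBound R w * f s := by
    intro s
    rcases lt_or_ge s w with hs | hs
    · simp [fw s hs]
    have : gaussianPDFReal 0 1 s * ∫ t, gaussianPDFReal (r * s) (1 - r ^ 2).toNNReal t * g t
        ≤ densityBound R w := by
      rw [← integral_const_mul]
      calc _ ≤ ∫ t, densityBound R w * g t := by
            refine integral_mono_of_nonneg (ae_of_all _ fun t => ?_) (hgi.const_mul _)
              (ae_of_all _ fun t => ?_)
            · exact mul_nonneg (gaussianPDFReal_nonneg _ _ _)
                (mul_nonneg (gaussianPDFReal_nonneg _ _ _) (g0 _))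
            · simp only
              rcases lt_or_ge t w with ht | ht
              · simp [gw t ht]
              rw [← mul_assoc]
              exact mul_le_mul_of_nonneg_right
                (gaussianPDFReal_mul_le_densityBound hr1 hcov hR0 hR1 hw hs ht) (g0 t)
        _ = densityBound R w := by rw [integral_const_mul, gi, mul_one]
    rw [smul_eq_mul, mul_left_comm, mul_comm]
    exact mul_le_mul_of_nonneg_right this (f0 s)
  calc _ ≤ ∫ s, densityBound R w * f s := by
        refine integral_mono_of_nonneg (ae_of_all _ fun s => ?_) (hfi.const_mul _) (ae_of_all _ key)
        exact mul_nonneg (gaussianPDFReal_nonneg _ _ _) (mul_nonneg (f0 _)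
          (integral_nonneg fun t => mul_nonneg (gaussianPDFReal_nonneg _ _ _) (g0 _)))
    _ = densityBound R w := by rw [integral_const_mul, fi, mul_one]

/-! ### Smooth cut-offs and derivatives of their products -/

/-- One minus the primitive of a normalized bump on `(u, u + ε)`. It lies between the indicators of
`(-∞, u]` and `(-∞, u + ε]`, and minus its derivative is a probability density carried by `[u, ∞)`,
the form which `integral_mul_le_densityBound` takes. -/
lemma exists_smooth_step (u : ℝ) {ε : ℝ} (hε : 0 < ε) :
    ∃ (g ψ ψ' : ℝ → ℝ) (C : ℝ), (∀ x, HasDerivAt g (-ψ x) x) ∧ (∀ x, HasDerivAt ψ (ψ' x) x) ∧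
      Continuous ψ' ∧ (∀ x, |ψ x| ≤ C) ∧ (∀ x, |ψ' x| ≤ C) ∧ (∀ x, 0 ≤ g x) ∧ (∀ x, g x ≤ 1) ∧
      (∀ x ≤ u, g x = 1) ∧ (∀ x, u + ε ≤ x → g x = 0) ∧ (∀ x, 0 ≤ ψ x) ∧
      (∀ x < u, ψ x = 0) ∧ ∫ x, ψ x = 1 := by
  let φ : ContDiffBump (u + ε / 2) := ⟨ε / 4, ε / 2, by positivity, by linarith⟩
  set ψ : ℝ → ℝ := φ.normed volume with hψ
  have hcd : ContDiff ℝ 1 ψ := φ.contDiff_normed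
  have hcs : HasCompactSupport ψ := φ.hasCompactSupport_normed
  have hsupp : Function.support ψ = Metric.ball (u + ε / 2) (ε / 2) := φ.support_normed_eq
  have hball : Metric.ball (u + ε / 2) (ε / 2) = Set.Ioo u (u + ε) := by
    rw [Real.ball_eq_Ioo]; congr 1 <;> ring
  rw [hball] at hsupp
  have h0 : ∀ x, 0 ≤ ψ x := φ.nonneg_normed
  have hint : ∫ x, ψ x = 1 := φ.integral_normed
  have hz : ∀ x, x ∉ Set.Ioo u (u + ε) → ψ x = 0 := by
    intro x hx
    rw [← hsupp] at hx
    simpa using hx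
  have hψc : Continuous ψ := hcd.continuous
  have hi : Integrable ψ := φ.integrable_normed
  obtain ⟨C1, hC1⟩ := hcs.exists_bound_of_continuous hψc
  have hdc : Continuous (deriv ψ) := hcd.continuous_deriv le_rfl
  obtain ⟨C2, hC2⟩ := hcs.deriv.exists_bound_of_continuous hdc
  have hle : ∀ x ≤ u, ∫ t in u..x, ψ t = 0 := by
    intro x hx
    rw [intervalIntegral.integral_symm, intervalIntegral.integral_of_le hx,
      setIntegral_eq_zero_of_forall_eq_zero (fun t ht => hz t fun h => absurd h.1 (not_lt.2 ht.2)),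
      neg_zero]
  refine ⟨fun x => 1 - ∫ t in u..x, ψ t, ψ, deriv ψ, max C1 C2, ?_, ?_, hdc, ?_, ?_, ?_, ?_, ?_, ?_,
    h0, ?_, hint⟩
  · intro x
    simpa using (intervalIntegral.integral_hasDerivAt_right (hψc.intervalIntegrable _ _)
      (hψc.stronglyMeasurableAtFilter _ _) hψc.continuousAt).const_sub 1
  · exact fun x => (hcd.differentiable one_ne_zero x).hasDerivAt
  · exact fun x => (hC1 x).trans (le_max_left _ _)
  · exact fun x => (hC2 x).trans (le_max_right _ _)
  · intro x
    rcases le_total x u with hx | hx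
    · simp [hle x hx]
    · simp only
      rw [intervalIntegral.integral_of_le hx, sub_nonneg, ← hint]
      exact setIntegral_le_integral hi (ae_of_all _ h0)
  · intro x
    rcases le_total x u with hx | hx
    · simp [hle x hx]
    · have := intervalIntegral.integral_nonneg (μ := volume) hx (fun t _ => h0 t)
      linarith
  · intro x hx
    simp [hle x hx]
  · intro x hx
    simp only
    rw [intervalIntegral.integral_eq_integral_of_support_subset, hint, sub_self]
    rw [hsupp]
    exact fun t ht => ⟨ht.1, ht.2.le.trans hx⟩
  · exact fun x hx => hz x fun h => absurd h.1 (not_lt.2 hx.le)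

lemma abs_prod_comp_le {ι : Type*} [Fintype ι] {h : ι → ℝ → ℝ} {C : ℝ} (hC : 1 ≤ C) (hb : ∀ q x, |h q x| ≤ C) (s : Finset ι)
    (v : ι → ℝ) : |∏ q ∈ s, h q (v q)| ≤ C ^ Fintype.card ι := by
  rw [Finset.abs_prod]
  calc ∏ q ∈ s, |h q (v q)| ≤ ∏ _q ∈ s, C :=
        Finset.prod_le_prod (fun _ _ => abs_nonneg _) fun q _ => hb q _
    _ = C ^ s.card := by simp
    _ ≤ C ^ Fintype.card ι := pow_le_pow_right₀ hC (Finset.card_le_univ s)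

section Product

variable {ι : Type*} [Fintype ι] [DecidableEq ι] {h h' : ι → ℝ → ℝ}

/-- The differential of `v ↦ ∏ q, h q (v q)`, where `h'` is the family of derivatives of `h`. -/
noncomputable def prodFDeriv (h h' : ι → ℝ → ℝ) (v : ι → ℝ) : (ι → ℝ) →L[ℝ] ℝ :=
  ∑ i, (∏ j ∈ Finset.univ.erase i, h j (v j)) •
    (h' i (v i) • ContinuousLinearMap.proj (R := ℝ) (φ := fun _ : ι => ℝ) i)

lemma prodFDeriv_apply (v c : ι → ℝ) :
    prodFDeriv h h' v c = ∑ i, c i * ((∏ j ∈ Finset.univ.erase i, h j (v j)) * h' i (v i)) := by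
  simp only [prodFDeriv, sum_apply, smul_apply,
    ContinuousLinearMap.proj_apply, smul_eq_mul]
  exact Finset.sum_congr rfl fun i _ => by ring

lemma hasFDerivAt_prod_comp (hh : ∀ q x, HasDerivAt (h q) (h' q x) x) (v : ι → ℝ) :
    HasFDerivAt (fun v : ι → ℝ => ∏ q, h q (v q)) (prodFDeriv h h' v) v := by
  have := HasFDerivAt.finsetProd (u := Finset.univ) (g := fun q (v : ι → ℝ) => h q (v q))
    (g' := fun q => h' q (v q) • ContinuousLinearMap.proj (R := ℝ) (φ := fun _ : ι => ℝ) q)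
    (x := v) (fun q _ => (hh q (v q)).comp_hasFDerivAt v
      (ContinuousLinearMap.proj (R := ℝ) (φ := fun _ : ι => ℝ) q).hasFDerivAt)
  exact this

lemma continuous_prodFDeriv (hc : ∀ q, Continuous (h q)) (hc' : ∀ q, Continuous (h' q)) :
    Continuous (prodFDeriv h h') := by
  unfold prodFDeriv
  fun_prop

lemma norm_prodFDeriv_le {C : ℝ} (hC : 1 ≤ C) (hb : ∀ q x, |h q x| ≤ C)
    (hb' : ∀ q x, |h' q x| ≤ C) (v : ι → ℝ) :
    ‖prodFDeriv h h' v‖ ≤ Fintype.card ι * (C ^ Fintype.card ι * C) := by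
  have hC0 : 0 ≤ C := zero_le_one.trans hC
  refine ContinuousLinearMap.opNorm_le_bound _ (by positivity) fun c => ?_
  rw [prodFDeriv_apply]
  calc _ ≤ ∑ i, ‖c i * ((∏ j ∈ Finset.univ.erase i, h j (v j)) * h' i (v i))‖ := norm_sum_le _ _
    _ ≤ ∑ _i : ι, ‖c‖ * (C ^ Fintype.card ι * C) := by
      refine Finset.sum_le_sum fun i _ => ?_
      rw [norm_mul, norm_mul]
      have h1 := abs_prod_comp_le hC hb (Finset.univ.erase i) v
      exact mul_le_mul (norm_le_pi_norm c i)
        (mul_le_mul h1 (hb' _ _) (abs_nonneg _) (by positivity)) (by positivity) (by positivity)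
    _ = _ := by simp; ring

theorem integral_mul_prod_gaussian {Ω : Type*} [MeasurableSpace Ω] {P : Measure Ω}
    {U : Ω → ℝ} {V : Ω → ι → ℝ} (hUV : HasGaussianLaw (fun ω => (U ω, V ω)) P)
    (hU : ∫ ω, U ω ∂P = 0) {C : ℝ} (hC : 1 ≤ C) (hh : ∀ q x, HasDerivAt (h q) (h' q x) x)
    (hc' : ∀ q, Continuous (h' q)) (hb : ∀ q x, |h q x| ≤ C) (hb' : ∀ q x, |h' q x| ≤ C) :
    ∫ ω, U ω * ∏ q, h q (V ω q) ∂P = ∑ q, cov[U, fun ω => V ω q; P] *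
      ∫ ω, (∏ j ∈ Finset.univ.erase q, h j (V ω j)) * h' q (V ω q) ∂P := by
  have hP := hUV.isProbabilityMeasure
  have hc : ∀ q, Continuous (h q) := fun q =>
    continuous_iff_continuousAt.2 fun x => (hh q x).continuousAt
  have hC0 : 0 ≤ C := zero_le_one.trans hC
  rw [integral_mul_comp_gaussian hUV hU
    (C := C ^ Fintype.card ι + Fintype.card ι * (C ^ Fintype.card ι * C)) (hasFDerivAt_prod_comp hh)
    (continuous_prodFDeriv hc hc')
    (fun x => (abs_prod_comp_le hC hb _ x).trans (le_add_of_nonneg_right (by positivity)))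
    (fun x => (norm_prodFDeriv_le hC hb hb' x).trans (le_add_of_nonneg_left (by positivity)))]
  simp_rw [prodFDeriv_apply]
  rw [integral_finsetSum]
  · simp_rw [integral_const_mul]
  · intro q _
    refine Integrable.const_mul ?_ _
    have hcont : Continuous fun v : ι → ℝ =>
      (∏ j ∈ Finset.univ.erase q, h j (v j)) * h' q (v q) := by fun_prop
    refine Integrable.of_bound (hcont.aestronglyMeasurable.comp_aemeasurable hUV.snd.aemeasurable)
      (C ^ Fintype.card ι * C) (ae_of_all _ fun ω => ?_)
    rw [norm_mul]
    exact mul_le_mul (abs_prod_comp_le hC hb _ _) (hb' _ _) (abs_nonneg _) (by positivity)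

end Product

/-! ### Differentiation along the interpolation of two Gaussian vectors -/

section Interpolation

variable {Ω ι : Type*} [MeasurableSpace Ω] [Fintype ι] [DecidableEq ι] {P : Measure Ω}
  {X Y : Ω → ι → ℝ} {h h' : ι → ℝ → ℝ}

/-- The trigonometric path keeps unit variances when `X` and `Y` are uncorrelated, and it is smooth
up to the endpoints. The `θ`-derivative of the integrand is bounded by a multiple of `‖X‖ + ‖Y‖`,
uniformly in `θ`, which allows differentiation under the integral. -/
lemma hasDerivAt_integral_prod_interpolation [IsProbabilityMeasure P] (hX : Integrable X P)
    (hY : Integrable Y P)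
    {C : ℝ} (hC : 1 ≤ C) (hh : ∀ q x, HasDerivAt (h q) (h' q x) x)
    (hc' : ∀ q, Continuous (h' q)) (hb : ∀ q x, |h q x| ≤ C) (hb' : ∀ q x, |h' q x| ≤ C) (θ : ℝ) :
    HasDerivAt (fun θ => ∫ ω, ∏ q, h q (Real.cos θ * X ω q + Real.sin θ * Y ω q) ∂P)
      (∑ p, ∫ ω, (-Real.sin θ * X ω p + Real.cos θ * Y ω p) *
        ((∏ j ∈ Finset.univ.erase p, h j (Real.cos θ * X ω j + Real.sin θ * Y ω j)) *
          h' p (Real.cos θ * X ω p + Real.sin θ * Y ω p)) ∂P) θ := by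
  have hC0 : 0 ≤ C := zero_le_one.trans hC
  have hc : ∀ q, Continuous (h q) := fun q =>
    continuous_iff_continuousAt.2 fun x => (hh q x).continuousAt
  have hXm : ∀ q, AEMeasurable (fun ω => X ω q) P := fun q =>
    (measurable_pi_apply q).comp_aemeasurable hX.aemeasurable
  have hYm : ∀ q, AEMeasurable (fun ω => Y ω q) P := fun q =>
    (measurable_pi_apply q).comp_aemeasurable hY.aemeasurable
  set K : ℝ := Fintype.card ι * (C ^ Fintype.card ι * C) with hK
  have hV : ∀ (θ : ℝ) (j : ι),
      AEMeasurable (fun ω => Real.cos θ * X ω j + Real.sin θ * Y ω j) P := fun θ j =>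
    ((hXm j).const_mul _).add ((hYm j).const_mul _)
  have key := hasDerivAt_integral_of_dominated_loc_of_deriv_le (μ := P)
    (F := fun θ ω => ∏ q, h q (Real.cos θ * X ω q + Real.sin θ * Y ω q))
    (F' := fun θ ω => prodFDeriv h h' (fun q => Real.cos θ * X ω q + Real.sin θ * Y ω q)
      (fun q => -Real.sin θ * X ω q + Real.cos θ * Y ω q))
    (x₀ := θ) (s := Set.univ) (bound := fun ω => K * (‖X ω‖ + ‖Y ω‖)) univ_mem
    (Eventually.of_forall fun t => by
      refine (AEMeasurable.aestronglyMeasurable ?_)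
      refine Finset.aemeasurable_fun_prod _ fun q _ => ?_
      exact (hc q).measurable.comp_aemeasurable (hV t q))
    (by
      refine Integrable.of_bound (AEMeasurable.aestronglyMeasurable ?_) (C ^ Fintype.card ι)
        (ae_of_all _ fun ω => abs_prod_comp_le hC hb _ _)
      refine Finset.aemeasurable_fun_prod _ fun q _ => ?_
      exact (hc q).measurable.comp_aemeasurable (hV θ q))
    (by
      simp_rw [prodFDeriv_apply]
      refine (Finset.aemeasurable_fun_sum _ fun q _ => ?_).aestronglyMeasurable
      refine (((hXm q).const_mul _).add ((hYm q).const_mul _)).mul (AEMeasurable.mul ?_ ?_)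
      · refine Finset.aemeasurable_fun_prod _ fun j _ => ?_
        exact (hc j).measurable.comp_aemeasurable (hV θ j)
      · exact (hc' q).measurable.comp_aemeasurable (hV θ q))
    (ae_of_all _ fun ω t _ => by
      refine ((prodFDeriv h h' _).le_of_opNorm_le (norm_prodFDeriv_le hC hb hb' _) _).trans ?_
      refine mul_le_mul_of_nonneg_left ?_ (by positivity)
      refine (pi_norm_le_iff_of_nonneg (by positivity)).2 fun q => ?_
      refine (norm_add_le _ _).trans (add_le_add ?_ ?_)
      · rw [norm_mul, norm_neg]
        exact (mul_le_of_le_one_left (norm_nonneg _) (Real.abs_sin_le_one _)).trans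
          (norm_le_pi_norm _ _)
      · rw [norm_mul]
        exact (mul_le_of_le_one_left (norm_nonneg _) (Real.abs_cos_le_one _)).trans
          (norm_le_pi_norm _ _))
    ((hX.norm.add hY.norm).const_mul K)
    (ae_of_all _ fun ω t _ => by
      have h1 : HasDerivAt (fun t : ℝ => fun q => Real.cos t * X ω q + Real.sin t * Y ω q)
          (fun q => -Real.sin t * X ω q + Real.cos t * Y ω q) t := by
        rw [hasDerivAt_pi]
        exact fun q => ((Real.hasDerivAt_cos t).mul_const _).add
          ((Real.hasDerivAt_sin t).mul_const _)
      exact (hasFDerivAt_prod_comp hh _).comp_hasDerivAt t h1)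
  convert! key.2 using 1
  simp_rw [prodFDeriv_apply]
  rw [integral_finsetSum]
  intro p _
  have hi : Integrable (fun ω => -Real.sin θ * X ω p + Real.cos θ * Y ω p) P :=
    ((hX.eval p).const_mul _).add ((hY.eval p).const_mul _)
  refine (hi.bdd_mul (c := C ^ Fintype.card ι * C) (AEMeasurable.aestronglyMeasurable ?_)
    (ae_of_all _ fun ω => ?_)).congr (ae_of_all _ fun ω => mul_comm _ _)
  · refine AEMeasurable.mul ?_ ((hc' p).measurable.comp_aemeasurable (hV θ p))
    refine Finset.aemeasurable_fun_prod _ fun j _ => ?_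
    exact (hc j).measurable.comp_aemeasurable (hV θ j)
  · rw [norm_mul]
    exact mul_le_mul (abs_prod_comp_le hC hb _ _) (hb' _ _) (abs_nonneg _) (by positivity)

end Interpolation

/-! ### The normal comparison inequality -/

lemma integral_indicator_one_of_nullMeasurable {Ω : Type*} [MeasurableSpace Ω] {P : Measure Ω}
    {s : Set Ω} (hs : NullMeasurableSet s P) : ∫ ω, s.indicator 1 ω ∂P = P.real s := by
  rw [integral_indicator₀ hs]
  simp

section Comparison

variable {ι : Type*} [Fintype ι] [DecidableEq ι]

/-- All factors with index other than `p` and `q` lie in `[0, 1]` and can be dropped; what remains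
is the expectation of `ψ p (V p) * ψ q (V q)`. -/
lemma abs_integral_prod_step_le {Ω : Type*} [MeasurableSpace Ω] {P : Measure Ω}
    {V : Ω → ι → ℝ} (hV : HasGaussianLaw V P)
    (m0 : ∀ p, ∫ ω, V ω p ∂P = 0) (v1 : ∀ p, Var[fun ω => V ω p; P] = 1) {R w : ℝ} {p q : ι}
    (hpq : q ≠ p) (hcov : cov[fun ω => V ω p, fun ω => V ω q; P] ≤ R) (hR0 : 0 ≤ R)
    (hR1 : R < 1) (hw : 1 ≤ w) {g ψ : ι → ℝ → ℝ} {C : ℝ} (hψ : ∀ i, Continuous (ψ i))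
    (ψ0 : ∀ i x, 0 ≤ ψ i x) (ψC : ∀ i x, |ψ i x| ≤ C)
    (g0 : ∀ i x, 0 ≤ g i x) (g1 : ∀ i x, g i x ≤ 1)
    (ψw : ∀ i, ∀ x < w, ψ i x = 0) (ψi : ∀ i, ∫ x, ψ i x = 1) :
    |∫ ω, (∏ j ∈ Finset.univ.erase q, (if j = p then fun x => -ψ p x else g j) (V ω j)) *
      -ψ q (V ω q) ∂P| ≤ densityBound R w := by
  have hP := hV.isProbabilityMeasure
  have hpair : HasGaussianLaw (fun ω => (V ω p, V ω q)) P :=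
    hV.map_fun ((ContinuousLinearMap.proj (R := ℝ) (φ := fun _ : ι => ℝ) p).prod
      (ContinuousLinearMap.proj (R := ℝ) (φ := fun _ : ι => ℝ) q))
  refine le_trans ?_ (integral_mul_le_densityBound hpair (m0 p) (m0 q) (v1 p) (v1 q) hcov hR0 hR1
    hw (hψ p) (hψ q) (ψ0 p) (ψ0 q) (fun x => (le_abs_self _).trans (ψC p x))
    (fun x => (le_abs_self _).trans (ψC q x)) (ψw p) (ψw q) (ψi p) (ψi q))
  refine (abs_integral_le_integral_abs).trans ?_
  refine integral_mono_of_nonneg (ae_of_all _ fun ω => abs_nonneg _) ?_ (ae_of_all _ fun ω => ?_)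
  · have hcont : Continuous fun x : ℝ × ℝ => ψ p x.1 * ψ q x.2 := by fun_prop
    refine Integrable.of_bound (hcont.aestronglyMeasurable.comp_aemeasurable hpair.aemeasurable)
      (C * C) (ae_of_all _ fun ω => ?_)
    rw [norm_mul]
    exact mul_le_mul (ψC _ _) (ψC _ _) (abs_nonneg _) ((abs_nonneg _).trans (ψC p 0))
  · simp only
    rw [abs_mul, abs_neg, abs_of_nonneg (ψ0 q _)]
    refine mul_le_mul_of_nonneg_right ?_ (ψ0 q _)
    have hmem : p ∈ Finset.univ.erase q := Finset.mem_erase.2 ⟨hpq.symm, Finset.mem_univ _⟩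
    rw [← Finset.mul_prod_erase _ _ hmem, abs_mul]
    simp only [if_true, abs_neg]
    rw [abs_of_nonneg (ψ0 p _)]
    refine mul_le_of_le_one_right (ψ0 p _) ?_
    rw [Finset.abs_prod]
    refine Finset.prod_le_one (fun _ _ => abs_nonneg _) fun j hj => ?_
    rw [if_neg (Finset.ne_of_mem_erase hj), abs_of_nonneg (g0 _ _)]
    exact g1 _ _

/-- The velocity of the path has covariance `sin θ cos θ (cY - cX)` with its position. Gaussian
integration by parts therefore writes the derivative as a sum over pairs of covariance differences
times expectations of products containing `ψ p` and `ψ q`. A pair with equal covariances contributes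
nothing, so `R` is constrained only at the others. -/
lemma abs_integral_prod_sub_le {Ω : Type*} [MeasurableSpace Ω] {P : Measure Ω}
    {X Y : Ω → ι → ℝ} (hXY : HasGaussianLaw (fun ω => (X ω, Y ω)) P)
    (mX : ∀ p, ∫ ω, X ω p ∂P = 0) (mY : ∀ p, ∫ ω, Y ω p ∂P = 0)
    {cX cY : ι → ι → ℝ}
    (hcX : ∀ p q, cov[fun ω => X ω p, fun ω => X ω q; P] = cX p q)
    (hcY : ∀ p q, cov[fun ω => Y ω p, fun ω => Y ω q; P] = cY p q)
    (hc0 : ∀ p q, cov[fun ω => X ω p, fun ω => Y ω q; P] = 0)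
    (vX : ∀ p, cX p p = 1) (vY : ∀ p, cY p p = 1)
    {w : ℝ} (hw : 1 ≤ w) {R : ι → ι → ℝ}
    (hR : ∀ p q, p ≠ q → cX p q ≠ cY p q →
      0 ≤ R p q ∧ R p q < 1 ∧ cX p q ≤ R p q ∧ cY p q ≤ R p q)
    {g ψ ψ' : ι → ℝ → ℝ} {C : ℝ} (hC : 1 ≤ C) (hg : ∀ i x, HasDerivAt (g i) (-ψ i x) x)
    (hψ : ∀ i x, HasDerivAt (ψ i) (ψ' i x) x) (hψ' : ∀ i, Continuous (ψ' i))
    (ψ0 : ∀ i x, 0 ≤ ψ i x) (ψC : ∀ i x, |ψ i x| ≤ C) (ψC' : ∀ i x, |ψ' i x| ≤ C)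
    (g0 : ∀ i x, 0 ≤ g i x) (g1 : ∀ i x, g i x ≤ 1)
    (ψw : ∀ i, ∀ x < w, ψ i x = 0) (ψi : ∀ i, ∫ x, ψ i x = 1) :
    |∫ ω, ∏ q, g q (Y ω q) ∂P - ∫ ω, ∏ q, g q (X ω q) ∂P| ≤
      ∑ p, ∑ q ∈ Finset.univ.erase p, |cX p q - cY p q| * densityBound (R p q) w := by
  have hP := hXY.isProbabilityMeasure
  have hXg : HasGaussianLaw X P := hXY.fst
  have hYg : HasGaussianLaw Y P := hXY.snd
  have lX : ∀ p, MemLp (fun ω => X ω p) 2 P := fun p => (hXg.eval p).memLp_two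
  have lY : ∀ p, MemLp (fun ω => Y ω p) 2 P := fun p => (hYg.eval p).memLp_two
  set S := ∑ p, ∑ q ∈ Finset.univ.erase p, |cX p q - cY p q| * densityBound (R p q) w with hS
  have hψc : ∀ i, Continuous (ψ i) := fun i =>
    continuous_iff_continuousAt.2 fun x => (hψ i x).continuousAt
  have gC : ∀ i x, |g i x| ≤ C := fun i x => by
    rw [abs_of_nonneg (g0 i x)]; exact (g1 i x).trans hC
  have hder := fun θ => hasDerivAt_integral_prod_interpolation (P := P) (X := X) (Y := Y)
    hXg.integrable hYg.integrable hC hg (fun q => (hψc q).neg) gC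
    (fun q x => by rw [abs_neg]; exact ψC q x) θ
  set Φ : ℝ → ℝ := fun θ => ∫ ω, ∏ q, g q (Real.cos θ * X ω q + Real.sin θ * Y ω q) ∂P with hΦ
  have e0 : Φ 0 = ∫ ω, ∏ q, g q (X ω q) ∂P := by simp [hΦ]
  have e1 : Φ (Real.pi / 2) = ∫ ω, ∏ q, g q (Y ω q) ∂P := by simp [hΦ]
  have bound : ∀ θ, |∑ p, ∫ ω, (-Real.sin θ * X ω p + Real.cos θ * Y ω p) *
        ((∏ j ∈ Finset.univ.erase p, g j (Real.cos θ * X ω j + Real.sin θ * Y ω j)) *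
          -ψ p (Real.cos θ * X ω p + Real.sin θ * Y ω p)) ∂P| ≤ S / 2 := by
    intro θ
    set V : Ω → ι → ℝ := fun ω q => Real.cos θ * X ω q + Real.sin θ * Y ω q with hV
    have hsc : Real.sin θ ^ 2 + Real.cos θ ^ 2 = 1 := Real.sin_sq_add_cos_sq θ
    have hsc2 : |Real.sin θ * Real.cos θ| ≤ 1 / 2 := by
      rw [abs_le]; constructor <;>
      nlinarith [sq_nonneg (Real.sin θ + Real.cos θ), sq_nonneg (Real.sin θ - Real.cos θ)]
    have hVg : HasGaussianLaw V P := hXY.map_fun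
      (Real.cos θ • ContinuousLinearMap.fst ℝ (ι → ℝ) (ι → ℝ) +
        Real.sin θ • ContinuousLinearMap.snd ℝ (ι → ℝ) (ι → ℝ))
    have mV : ∀ p, ∫ ω, V ω p ∂P = 0 := by
      intro p
      simp only [hV]
      rw [integral_add (((hXg.eval p).integrable).const_mul _)
        (((hYg.eval p).integrable).const_mul _), integral_const_mul, integral_const_mul, mX, mY]
      simp
    have cov2 : ∀ (a b c d : ℝ) (p q : ι), cov[fun ω => a * X ω p + b * Y ω p,
        fun ω => c * X ω q + d * Y ω q; P] = a * c * cX p q + b * d * cY p q := by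
      intro a b c d p q
      have h1 : (fun ω => a * X ω p + b * Y ω p)
        = (fun ω => a * X ω p) + (fun ω => b * Y ω p) := rfl
      have h2 : (fun ω => c * X ω q + d * Y ω q)
        = (fun ω => c * X ω q) + (fun ω => d * Y ω q) := rfl
      have l1 := (lX p).const_mul a
      have l2 := (lY p).const_mul b
      have l3 := (lX q).const_mul c
      have l4 := (lY q).const_mul d
      rw [h1, h2, covariance_add_left l1 l2 (l3.add l4), covariance_add_right l1 l3 l4,
        covariance_add_right l2 l3 l4]
      simp only [covariance_const_mul_left, covariance_const_mul_right, hcX, hcY, hc0,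
        covariance_comm (fun ω => Y ω p) (fun ω => X ω q)]
      ring
    have vV : ∀ p, Var[fun ω => V ω p; P] = 1 := by
      intro p
      rw [← covariance_self (hVg.eval p).aemeasurable]
      refine (cov2 _ _ _ _ p p).trans ?_
      rw [vX, vY]
      linarith
    have step : ∀ p, ∫ ω, (-Real.sin θ * X ω p + Real.cos θ * Y ω p) *
        ((∏ j ∈ Finset.univ.erase p, g j (V ω j)) * -ψ p (V ω p)) ∂P
        = ∑ q, Real.sin θ * Real.cos θ * (cY p q - cX p q) *
          ∫ ω, (∏ j ∈ Finset.univ.erase q, (if j = p then fun x => -ψ p x else g j) (V ω j)) *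
            (if q = p then fun x => -ψ' p x else fun x => -ψ q x) (V ω q) ∂P := by
      intro p
      have hUV : HasGaussianLaw
          (fun ω => (-Real.sin θ * X ω p + Real.cos θ * Y ω p, V ω)) P := by
        let T : ((ι → ℝ) × (ι → ℝ)) →L[ℝ] (ℝ × (ι → ℝ)) :=
          ((-Real.sin θ) • (ContinuousLinearMap.proj (R := ℝ) (φ := fun _ : ι => ℝ) p).comp
            (ContinuousLinearMap.fst ℝ (ι → ℝ) (ι → ℝ)) +
           Real.cos θ • (ContinuousLinearMap.proj (R := ℝ) (φ := fun _ : ι => ℝ) p).comp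
            (ContinuousLinearMap.snd ℝ (ι → ℝ) (ι → ℝ))).prod
          (Real.cos θ • ContinuousLinearMap.fst ℝ (ι → ℝ) (ι → ℝ) +
            Real.sin θ • ContinuousLinearMap.snd ℝ (ι → ℝ) (ι → ℝ))
        exact hXY.map_fun T
      have hU0 : ∫ ω, (-Real.sin θ * X ω p + Real.cos θ * Y ω p) ∂P = 0 := by
        rw [integral_add (((hXg.eval p).integrable).const_mul _)
          (((hYg.eval p).integrable).const_mul _), integral_const_mul, integral_const_mul, mX, mY]
        simp
      -- Putting `-ψ p` in place of `g p` turns the integrand into a full product over all indices,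
      -- to which integration by parts applies.
      have := integral_mul_prod_gaussian hUV hU0 hC
        (h := fun j => if j = p then fun x => -ψ p x else g j)
        (h' := fun j => if j = p then fun x => -ψ' p x else fun x => -ψ j x)
        (by
          intro q x
          by_cases hq : q = p
          · simp only [hq, if_true]; exact (hψ p x).neg
          · simp only [if_neg hq]; exact hg q x)
        (by
          intro q
          by_cases hq : q = p
          · simp only [hq, if_true]; exact (hψ' p).neg
          · simp only [if_neg hq]; exact (hψc q).neg)
        (by
          intro q x
          by_cases hq : q = p
          · simp only [hq, if_true, abs_neg]; exact ψC p x
          · simp only [if_neg hq]; exact gC q x)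
        (by
          intro q x
          by_cases hq : q = p
          · simp only [hq, if_true, abs_neg]; exact ψC' p x
          · simp only [if_neg hq, abs_neg]; exact ψC q x)
      calc _ = ∫ ω, (-Real.sin θ * X ω p + Real.cos θ * Y ω p) *
            ∏ q, (if q = p then fun x => -ψ p x else g q) (V ω q) ∂P := by
            congr 1 with ω
            congr 1
            rw [← Finset.mul_prod_erase _ _ (Finset.mem_univ p), if_pos rfl, mul_comm]
            congr 1
            refine Finset.prod_congr rfl fun j hj => ?_
            rw [if_neg (Finset.ne_of_mem_erase hj)]
        _ = _ := by
            rw [this]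
            refine Finset.sum_congr rfl fun q _ => ?_
            congr 1
            refine (cov2 _ _ _ _ p q).trans ?_
            ring
    rw [Finset.sum_congr rfl fun p _ => step p, hS, Finset.sum_div]
    refine (Finset.abs_sum_le_sum_abs _ _).trans (Finset.sum_le_sum fun p _ => ?_)
    -- The diagonal term carries the factor `cY p p - cX p p = 0`, so the second derivative `ψ'`,
    -- which is not controlled as `ε → 0`, disappears.
    rw [← Finset.add_sum_erase _ _ (Finset.mem_univ p), vX, vY, sub_self, mul_zero, zero_mul,
      zero_add, Finset.sum_div]
    refine (Finset.abs_sum_le_sum_abs _ _).trans (Finset.sum_le_sum fun q hq => ?_)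
    have hqp : q ≠ p := Finset.ne_of_mem_erase hq
    by_cases hc : cX p q = cY p q
    · simp [hc]
    obtain ⟨h0, h1, h2, h3⟩ := hR p q hqp.symm hc
    have hcov : cov[fun ω => V ω p, fun ω => V ω q; P] ≤ R p q := by
      refine (cov2 _ _ _ _ p q).trans_le ?_
      nlinarith [mul_le_mul_of_nonneg_left h2 (sq_nonneg (Real.cos θ)),
        mul_le_mul_of_nonneg_left h3 (sq_nonneg (Real.sin θ))]
    have hb := abs_integral_prod_step_le hVg mV vV hqp hcov h0 h1 hw hψc ψ0 ψC g0 g1 ψw ψi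
    rw [if_neg hqp, abs_mul, abs_mul, abs_sub_comm]
    calc _ ≤ 1 / 2 * |cX p q - cY p q| * densityBound (R p q) w := by
          gcongr
      _ = _ := by ring
  have hmv := Convex.norm_image_sub_le_of_norm_hasDerivWithin_le (s := Set.univ) (f := Φ)
    (x := 0) (y := Real.pi / 2) (fun θ _ => (hder θ).hasDerivWithinAt) (fun θ _ => bound θ)
    convex_univ (Set.mem_univ _) (Set.mem_univ _)
  rw [e0, e1] at hmv
  refine hmv.trans ?_
  have hS0 : 0 ≤ S := Finset.sum_nonneg fun p _ => Finset.sum_nonneg fun q _ =>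
    mul_nonneg (abs_nonneg _) (densityBound_nonneg _ _)
  -- The path has length `π / 2` and the derivative is at most `S / 2`; the product is at most `S`
  -- since `π ≤ 4`.
  rw [sub_zero, Real.norm_of_nonneg (by positivity)]
  nlinarith [Real.pi_le_four, Real.pi_pos]

/-- On the product space the two vectors become independent, hence jointly Gaussian and
uncorrelated. The smooth cut-offs dominate the indicators at `u` and are dominated by those at `u +
ε`; the error does not depend on `ε`, and `ε → 0` is continuity from above. -/
lemma measureReal_le_add_of_gaussian {Ω Ω' : Type*} [MeasurableSpace Ω] [MeasurableSpace Ω']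
    {P : Measure Ω} {Q : Measure Ω'} {X : Ω → ι → ℝ} {Y : Ω' → ι → ℝ}
    (hX : HasGaussianLaw X P) (hY : HasGaussianLaw Y Q)
    (mX : ∀ p, ∫ ω, X ω p ∂P = 0) (mY : ∀ p, ∫ ω, Y ω p ∂Q = 0) {cX cY : ι → ι → ℝ}
    (hcX : ∀ p q, cov[fun ω => X ω p, fun ω => X ω q; P] = cX p q)
    (hcY : ∀ p q, cov[fun ω => Y ω p, fun ω => Y ω q; Q] = cY p q)
    (vX : ∀ p, cX p p = 1) (vY : ∀ p, cY p p = 1)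
    {w : ℝ} (hw : 1 ≤ w) {u : ι → ℝ} (hu : ∀ p, w ≤ u p) {R : ι → ι → ℝ}
    (hR : ∀ p q, p ≠ q → cX p q ≠ cY p q →
      0 ≤ R p q ∧ R p q < 1 ∧ cX p q ≤ R p q ∧ cY p q ≤ R p q) :
    P.real {ω | ∀ p, X ω p ≤ u p} ≤ Q.real {ω | ∀ p, Y ω p ≤ u p} +
      ∑ p, ∑ q ∈ Finset.univ.erase p, |cX p q - cY p q| * densityBound (R p q) w := by
  have hP := hX.isProbabilityMeasure
  have hQ := hY.isProbabilityMeasure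
  set S := ∑ p, ∑ q ∈ Finset.univ.erase p, |cX p q - cY p q| * densityBound (R p q) w with hS
  have hfst : Measure.map Prod.fst (P.prod Q) = P := by simp
  have hsnd : Measure.map Prod.snd (P.prod Q) = Q := by simp
  have hX' : HasGaussianLaw (fun z : Ω × Ω' => X z.1) (P.prod Q) := by
    constructor
    have : Measure.map (fun z : Ω × Ω' => X z.1) (P.prod Q) = P.map X := by
      conv_rhs => rw [← hfst]
      rw [AEMeasurable.map_map_of_aemeasurable (by rw [hfst]; exact hX.aemeasurable) (by fun_prop)]
      rfl
    rw [this]; exact hX.isGaussian_map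
  have hY' : HasGaussianLaw (fun z : Ω × Ω' => Y z.2) (P.prod Q) := by
    constructor
    have : Measure.map (fun z : Ω × Ω' => Y z.2) (P.prod Q) = Q.map Y := by
      conv_rhs => rw [← hsnd]
      rw [AEMeasurable.map_map_of_aemeasurable (by rw [hsnd]; exact hY.aemeasurable) (by fun_prop)]
      rfl
    rw [this]; exact hY.isGaussian_map
  have hind : IndepFun (fun z : Ω × Ω' => X z.1) (fun z : Ω × Ω' => Y z.2) (P.prod Q) :=
    indepFun_prod₀ hX.aemeasurable hY.aemeasurable
  have hXY := hind.hasGaussianLaw hX' hY'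
  have iX : ∀ f : (ι → ℝ) → ℝ, Continuous f →
      ∫ z, f (X z.1) ∂(P.prod Q) = ∫ ω, f (X ω) ∂P := by
    intro f _
    simpa using integral_fun_fst (μ := P) (ν := Q) (fun ω => f (X ω))
  have iY : ∀ f : (ι → ℝ) → ℝ, Continuous f →
      ∫ z, f (Y z.2) ∂(P.prod Q) = ∫ ω, f (Y ω) ∂Q := by
    intro f _
    simpa using integral_fun_snd (μ := P) (ν := Q) (fun ω => f (Y ω))
  have cX' : ∀ p q, cov[fun z : Ω × Ω' => X z.1 p, fun z : Ω × Ω' => X z.1 q; P.prod Q]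
      = cX p q := by
    intro p q
    rw [← hcX p q]
    simp only [covariance]
    rw [iX (fun v => v p) (by fun_prop), iX (fun v => v q) (by fun_prop)]
    exact iX (fun v => (v p - _) * (v q - _)) (by fun_prop)
  have cY' : ∀ p q, cov[fun z : Ω × Ω' => Y z.2 p, fun z : Ω × Ω' => Y z.2 q; P.prod Q]
      = cY p q := by
    intro p q
    rw [← hcY p q]
    simp only [covariance]
    rw [iY (fun v => v p) (by fun_prop), iY (fun v => v q) (by fun_prop)]
    exact iY (fun v => (v p - _) * (v q - _)) (by fun_prop)
  have c0 : ∀ p q, cov[fun z : Ω × Ω' => X z.1 p, fun z : Ω × Ω' => Y z.2 q; P.prod Q] = 0 := by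
    intro p q
    exact (hind.comp (measurable_pi_apply p) (measurable_pi_apply q)).covariance_eq_zero
      (hX'.eval p).memLp_two (hY'.eval q).memLp_two
  have main : ∀ ε > 0, P.real {ω | ∀ p, X ω p ≤ u p} ≤
      Q.real {ω | ∀ p, Y ω p ≤ u p + ε} + S := by
    intro ε hε
    choose g ψ ψ' C hg hψ hψ' ψC ψC' g0 g1 gle gge ψ0 ψu ψi using
      fun p => exists_smooth_step (u p) hε
    obtain ⟨D, hD⟩ : ∃ D : ℝ, ∀ p, C p ≤ D := by
      obtain ⟨D, hD⟩ := (Set.finite_range C).bddAbove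
      exact ⟨D, fun p => hD ⟨p, rfl⟩⟩
    have key := abs_integral_prod_sub_le hXY (fun p => (iX (fun v => v p) (by fun_prop)).trans (mX p))
      (fun p => (iY (fun v => v p) (by fun_prop)).trans (mY p)) cX' cY' c0 vX vY hw hR
      (le_max_left 1 D) hg hψ hψ' ψ0
      (fun i x => (ψC i x).trans ((hD i).trans (le_max_right _ _)))
      (fun i x => (ψC' i x).trans ((hD i).trans (le_max_right _ _))) g0 g1
      (fun i x hx => ψu i x (hx.trans_le (hu i))) ψi
    have hgc : ∀ i, Continuous (g i) := fun i =>
      continuous_iff_continuousAt.2 fun x => (hg i x).continuousAt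
    have hfc : Continuous fun v : ι → ℝ => ∏ q, g q (v q) := by fun_prop
    rw [iX _ hfc, iY _ hfc] at key
    have fle : ∀ v : ι → ℝ, ∏ q, g q (v q) ≤ 1 := fun v =>
      Finset.prod_le_one (fun q _ => g0 q _) fun q _ => g1 q _
    have f0 : ∀ v : ι → ℝ, 0 ≤ ∏ q, g q (v q) := fun v => Finset.prod_nonneg fun q _ => g0 q _
    have mS : ∀ t : ι → ℝ, MeasurableSet {v : ι → ℝ | ∀ p, v p ≤ t p} := by
      intro t
      simp only [Set.ofPred_forall]
      exact MeasurableSet.iInter fun p => measurableSet_le (measurable_pi_apply p) measurable_const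
    have up : P.real {ω | ∀ p, X ω p ≤ u p} ≤ ∫ ω, ∏ q, g q (X ω q) ∂P := by
      have hm : NullMeasurableSet {ω | ∀ p, X ω p ≤ u p} P :=
        hX.aemeasurable.nullMeasurableSet_preimage (mS u)
      rw [← integral_indicator_one_of_nullMeasurable hm]
      refine integral_mono_of_nonneg (ae_of_all _ fun ω => Set.indicator_nonneg
        (fun _ _ => zero_le_one) _) ?_ (ae_of_all _ fun ω => ?_)
      · exact Integrable.of_bound (hfc.aestronglyMeasurable.comp_aemeasurable hX.aemeasurable) 1
          (ae_of_all _ fun ω => by rw [Real.norm_of_nonneg (f0 _)]; exact fle _)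
      · by_cases h : ∀ p, X ω p ≤ u p
        · rw [Set.indicator_of_mem (by exact h)]
          exact (Finset.prod_eq_one fun q _ => gle q _ (h q)).ge
        · rw [Set.indicator_of_notMem (by exact h)]
          exact f0 _
    have down : ∫ ω, ∏ q, g q (Y ω q) ∂Q ≤ Q.real {ω | ∀ p, Y ω p ≤ u p + ε} := by
      have hm : NullMeasurableSet {ω | ∀ p, Y ω p ≤ u p + ε} Q :=
        hY.aemeasurable.nullMeasurableSet_preimage (mS fun p => u p + ε)
      rw [← integral_indicator_one_of_nullMeasurable hm]
      refine integral_mono_of_nonneg (ae_of_all _ fun ω => f0 _)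
        ((integrable_const (1 : ℝ)).indicator₀ hm) (ae_of_all _ fun ω => ?_)
      by_cases h : ∀ p, Y ω p ≤ u p + ε
      · rw [Set.indicator_of_mem (by exact h)]
        exact fle _
      · rw [Set.indicator_of_notMem (by exact h)]
        push Not at h
        obtain ⟨p, hp⟩ := h
        exact (Finset.prod_eq_zero (Finset.mem_univ p) (gge p _ hp.le)).le
    have := (abs_le.1 key).1
    linarith
  have hlim : Tendsto (fun m : ℕ => Q.real {ω | ∀ p, Y ω p ≤ u p + 1 / ((m : ℝ) + 1)}) atTop
      (𝓝 (Q.real {ω | ∀ p, Y ω p ≤ u p})) := by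
    have hInter : {ω | ∀ p, Y ω p ≤ u p} = ⋂ m : ℕ, {ω | ∀ p, Y ω p ≤ u p + 1 / ((m : ℝ) + 1)} := by
      ext ω
      simp only [Set.mem_ofPred_eq, Set.mem_iInter]
      constructor
      · intro h m p
        have : (0 : ℝ) < 1 / ((m : ℝ) + 1) := by positivity
        linarith [h p]
      · intro h p
        have h1 : Tendsto (fun m : ℕ => u p + 1 / ((m : ℝ) + 1)) atTop (𝓝 (u p + 0)) :=
          tendsto_one_div_add_atTop_nhds_zero_nat.const_add _
        rw [add_zero] at h1
        exact ge_of_tendsto' h1 fun m => h m p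
    rw [hInter]
    refine (ENNReal.tendsto_toReal (measure_ne_top _ _)).comp
      (tendsto_measure_iInter_atTop (fun m => ?_) ?_ ⟨0, measure_ne_top _ _⟩)
    · refine hY.aemeasurable.nullMeasurableSet_preimage
        (s := {v : ι → ℝ | ∀ p, v p ≤ u p + 1 / ((m : ℝ) + 1)}) ?_
      simp only [Set.ofPred_forall]
      exact MeasurableSet.iInter fun p => measurableSet_le (measurable_pi_apply p) measurable_const
    · intro m k hmk ω h p
      refine (h p).trans ?_
      have : (m : ℝ) ≤ k := by exact_mod_cast hmk
      gcongr
  exact ge_of_tendsto' (hlim.add_const S) fun m => main _ (by positivity)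

/-- **Normal comparison inequality.** -/
theorem abs_measureReal_sub_le_of_gaussian {Ω Ω' : Type*} [MeasurableSpace Ω] [MeasurableSpace Ω']
    {P : Measure Ω} {Q : Measure Ω'} {X : Ω → ι → ℝ} {Y : Ω' → ι → ℝ}
    (hX : HasGaussianLaw X P) (hY : HasGaussianLaw Y Q)
    (mX : ∀ p, ∫ ω, X ω p ∂P = 0) (mY : ∀ p, ∫ ω, Y ω p ∂Q = 0) {cX cY : ι → ι → ℝ}
    (hcX : ∀ p q, cov[fun ω => X ω p, fun ω => X ω q; P] = cX p q)
    (hcY : ∀ p q, cov[fun ω => Y ω p, fun ω => Y ω q; Q] = cY p q)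
    (vX : ∀ p, cX p p = 1) (vY : ∀ p, cY p p = 1)
    {w : ℝ} (hw : 1 ≤ w) {u : ι → ℝ} (hu : ∀ p, w ≤ u p) {R : ι → ι → ℝ}
    (hR : ∀ p q, p ≠ q → cX p q ≠ cY p q →
      0 ≤ R p q ∧ R p q < 1 ∧ cX p q ≤ R p q ∧ cY p q ≤ R p q) :
    |P.real {ω | ∀ p, X ω p ≤ u p} - Q.real {ω | ∀ p, Y ω p ≤ u p}| ≤
      ∑ p, ∑ q ∈ Finset.univ.erase p, |cX p q - cY p q| * densityBound (R p q) w := by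
  have h1 := measureReal_le_add_of_gaussian hX hY mX mY hcX hcY vX vY hw hu hR
  have h2 := measureReal_le_add_of_gaussian hY hX mY mX hcY hcX vY vX hw hu (R := R)
    fun p q hpq hne => by
      obtain ⟨a, b, c, d⟩ := hR p q hpq hne.symm
      exact ⟨a, b, d, c⟩
  simp_rw [abs_sub_comm (cY _ _) (cX _ _)] at h2
  rw [abs_le]
  constructor <;> linarith

end Comparison

/-! ### Normalizing constants and Gumbel asymptotics -/

/-- The density of `n` times the standard Gaussian law in the normalized coordinate `t`, where
`s = u n t`. -/
noncomputable def rescaledDensity (n : ℕ) (t : ℝ) : ℝ := n * a n * gaussianPDFReal 0 1 (u n t)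

lemma tendsto_log_natCast : Tendsto (fun n : ℕ => Real.log n) atTop atTop :=
  Real.tendsto_log_atTop.comp tendsto_natCast_atTop_atTop

lemma log_natCast_pos {n : ℕ} (hn : 2 ≤ n) : 0 < Real.log n :=
  Real.log_pos (by exact_mod_cast hn)

lemma a_pos {n : ℕ} (hn : 2 ≤ n) : 0 < a n := by
  have := log_natCast_pos hn
  unfold a; positivity

lemma a_sq_mul {n : ℕ} (hn : 2 ≤ n) : a n ^ 2 * (2 * Real.log n) = 1 := by
  have := log_natCast_pos hn
  rw [a, div_pow, Real.sq_sqrt (by positivity)]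
  field_simp

lemma a_mul_b {n : ℕ} (hn : 2 ≤ n) :
    a n * b n = 1 - Real.log (4 * Real.pi * Real.log n) / (4 * Real.log n) := by
  have hL := log_natCast_pos hn
  have hs : √(2 * Real.log n) ^ 2 = 2 * Real.log n := Real.sq_sqrt (by positivity)
  have hs0 : √(2 * Real.log n) ≠ 0 := by positivity
  rw [a, b]
  field_simp
  rw [hs]
  field_simp
  ring

/-- With `L = log n` and `ℓ = log (4πL)` one has `b² = 2L - ℓ + ℓ² / (8L)`. The term `2L` cancels
the factor `n`, the term `ℓ` cancels `a` and the Gaussian normalization, and only the vanishing `ℓ²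
/ L` is left over. -/
lemma rescaledDensity_eq {n : ℕ} (hn : 2 ≤ n) (t : ℝ) :
    rescaledDensity n t = Real.exp (-(Real.log (4 * Real.pi * Real.log n) ^ 2 / (16 * Real.log n))
      - a n * b n * t - a n ^ 2 * t ^ 2 / 2) := by
  have hL := log_natCast_pos hn
  set L := Real.log n with hLdef
  set ℓ := Real.log (4 * Real.pi * L) with hℓ
  have hn0 : (0 : ℝ) < n := by positivity
  have hab := a_mul_b hn
  rw [← hLdef, ← hℓ] at hab
  have ha2 := a_sq_mul hn
  rw [← hLdef] at ha2
  have ha0 := a_pos hn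
  have hb2 : b n ^ 2 = 2 * L - ℓ + ℓ ^ 2 / (8 * L) := by
    have h1 : b n ^ 2 = (a n * b n) ^ 2 * (2 * L) := by
      linear_combination (-(b n ^ 2)) * ha2
    rw [h1, hab]
    field_simp
    ring
  have he : Real.exp (-(u n t - 0) ^ 2 / (2 * ((1 : NNReal) : ℝ)))
      = Real.exp (-L) * Real.exp (ℓ / 2) *
        Real.exp (-(ℓ ^ 2 / (16 * L)) - a n * b n * t - a n ^ 2 * t ^ 2 / 2) := by
    rw [← Real.exp_add, ← Real.exp_add]
    congr 1
    rw [NNReal.coe_one, u]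
    have : (a n * t + b n - 0) ^ 2 = a n ^ 2 * t ^ 2 + 2 * (a n * b n) * t + b n ^ 2 := by ring
    rw [this, hb2]
    field_simp
    ring
  have h1 : Real.exp (-L) = (n : ℝ)⁻¹ := by rw [Real.exp_neg, hLdef, Real.exp_log hn0]
  have h2 : Real.exp (ℓ / 2) = √(4 * Real.pi * L) := by
    rw [Real.exp_half, hℓ, Real.exp_log (by positivity)]
  have h3 : √(4 * Real.pi * L) = √(2 * Real.pi) * √(2 * L) := by
    rw [← Real.sqrt_mul (by positivity)]; congr 1; ring
  rw [rescaledDensity, gaussianPDFReal, he, h1, h2, h3, NNReal.coe_one, mul_one, a, ← hLdef]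
  have hs0 : √(2 * L) ≠ 0 := by positivity
  have hs1 : √(2 * Real.pi) ≠ 0 := by positivity
  field_simp

lemma tendsto_log_pow_div_log (k : ℕ) :
    Tendsto (fun n : ℕ => Real.log (4 * Real.pi * Real.log n) ^ k / Real.log n) atTop (𝓝 0) := by
  have h := Real.isLittleO_pow_log_id_atTop (n := k)
  have h1 : Tendsto (fun x : ℝ => Real.log x ^ k / x) atTop (𝓝 0) := h.tendsto_div_nhds_zero
  have h2 : Tendsto (fun n : ℕ => 4 * Real.pi * Real.log n) atTop atTop :=
    tendsto_log_natCast.const_mul_atTop (by positivity)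
  have h3 := (h1.comp h2).const_mul (4 * Real.pi)
  rw [mul_zero] at h3
  refine h3.congr fun n => ?_
  simp only [Function.comp]
  have := Real.pi_pos.ne'
  field_simp

lemma tendsto_a : Tendsto a atTop (𝓝 0) := by
  unfold a
  refine Tendsto.div_atTop tendsto_const_nhds ?_
  exact Real.tendsto_sqrt_atTop.comp (tendsto_log_natCast.const_mul_atTop two_pos)

lemma tendsto_a_mul_b : Tendsto (fun n => a n * b n) atTop (𝓝 1) := by
  have h := ((tendsto_log_pow_div_log 1).div_const 4).const_sub 1
  rw [zero_div, sub_zero] at h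
  refine h.congr' ?_
  filter_upwards [eventually_ge_atTop 2] with n hn
  rw [a_mul_b hn, pow_one, div_div, mul_comm (Real.log n)]

lemma tendsto_rescaledDensity {t : ℕ → ℝ} {t₀ : ℝ} (ht : Tendsto t atTop (𝓝 t₀)) :
    Tendsto (fun n => rescaledDensity n (t n)) atTop (𝓝 (Real.exp (-t₀))) := by
  have h1 := ((tendsto_log_pow_div_log 2).div_const 16).neg
  have h2 := tendsto_a_mul_b.mul ht
  have h3 := ((tendsto_a.pow 2).mul (ht.pow 2)).div_const 2
  have h := ((h1.sub h2).sub h3)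
  have e : (-((0 : ℝ) / 16) - 1 * t₀ - 0 ^ 2 * t₀ ^ 2 / 2) = -t₀ := by ring
  rw [e] at h
  refine ((Real.continuous_exp.tendsto _).comp h).congr' ?_
  filter_upwards [eventually_ge_atTop 2] with n hn
  rw [rescaledDensity_eq hn]
  simp only [Function.comp]
  congr 1
  rw [div_div, mul_comm (16 : ℝ)]

lemma rescaledDensity_nonneg (n : ℕ) (t : ℝ) : 0 ≤ rescaledDensity n t := by
  unfold rescaledDensity a
  have := gaussianPDFReal_nonneg 0 1 (u n t)
  positivity

/-- Since `a b → 1`, the exponent is eventually below `-t / 2` for `t ≥ 0` and below `-3t / 2` for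
`t ≤ 0`. The sum of the two exponentials is integrable on every half-line `[c, ∞)`, also for
negative `c`. -/
lemma eventually_rescaledDensity_le :
    ∀ᶠ n in atTop, ∀ t, rescaledDensity n t ≤ Real.exp (-(1 / 2) * t) + Real.exp (-(3 / 2) * t) := by
  have h1 : ∀ᶠ n in atTop, 1 / 2 < a n * b n := tendsto_a_mul_b.eventually_const_lt (by norm_num)
  have h2 : ∀ᶠ n in atTop, a n * b n < 3 / 2 := tendsto_a_mul_b.eventually_lt_const (by norm_num)
  filter_upwards [eventually_ge_atTop 2, h1, h2] with n hn h1 h2 t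
  have hL := log_natCast_pos hn
  rw [rescaledDensity_eq hn]
  have hA : 0 ≤ Real.log (4 * Real.pi * Real.log n) ^ 2 / (16 * Real.log n) := by positivity
  have hB : 0 ≤ a n ^ 2 * t ^ 2 / 2 := by positivity
  rcases le_total 0 t with ht | ht
  · refine le_trans ?_ (le_add_of_nonneg_right (Real.exp_pos _).le)
    refine Real.exp_le_exp.2 ?_
    nlinarith
  · refine le_trans ?_ (le_add_of_nonneg_left (Real.exp_pos _).le)
    refine Real.exp_le_exp.2 ?_
    nlinarith

/-- `n e^{-u_n(s)²/2} = O(√log n)`. -/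
lemma exists_natCast_mul_exp_le (s : ℝ) :
    ∃ C : ℝ, 0 < C ∧ ∀ᶠ n : ℕ in atTop,
      n * Real.exp (-(u n s) ^ 2 / 2) ≤ C * √(Real.log n) := by
  have h := (tendsto_rescaledDensity (tendsto_const_nhds (x := s))).eventually_lt_const
    (lt_add_one (Real.exp (-s)))
  refine ⟨(Real.exp (-s) + 1) * √(4 * Real.pi), by positivity, ?_⟩
  filter_upwards [h, eventually_ge_atTop 2] with n h hn
  have hL := log_natCast_pos hn
  have h3 : √(4 * Real.pi * Real.log n) = √(2 * Real.pi) * √(2 * Real.log n) := by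
    rw [← Real.sqrt_mul (by positivity)]; congr 1; ring
  have e : n * Real.exp (-(u n s) ^ 2 / 2)
      = rescaledDensity n s * √(4 * Real.pi * Real.log n) := by
    rw [h3, rescaledDensity, gaussianPDFReal, a, NNReal.coe_one, mul_one, sub_zero, mul_one]
    have hs0 : √(2 * Real.log n) ≠ 0 := by positivity
    have hs1 : √(2 * Real.pi) ≠ 0 := by positivity
    field_simp
  rw [e, mul_assoc (Real.exp (-s) + 1), ← Real.sqrt_mul (by positivity)]
  exact mul_le_mul_of_nonneg_right h.le (Real.sqrt_nonneg _)

lemma tendsto_u_sq_div_log (s : ℝ) :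
    Tendsto (fun n : ℕ => (u n s) ^ 2 / Real.log n) atTop (𝓝 2) := by
  have h : Tendsto (fun n : ℕ => 2 * (a n ^ 2 * s + a n * b n) ^ 2) atTop (𝓝 2) := by
    have := ((((tendsto_a.pow 2).mul_const s).add tendsto_a_mul_b).pow 2).const_mul 2
    convert! this using 2
    norm_num
  refine h.congr' ?_
  filter_upwards [eventually_ge_atTop 2] with n hn
  have hL := log_natCast_pos hn
  have ha2 := a_sq_mul hn
  rw [eq_div_iff hL.ne', u]
  linear_combination ((a n * s + b n) ^ 2) * ha2

lemma tendsto_u_atTop (s : ℝ) : Tendsto (fun n : ℕ => u n s) atTop atTop := by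
  have h1 : Tendsto (fun n : ℕ => a n ^ 2 * s + a n * b n) atTop (𝓝 1) := by
    have := ((tendsto_a.pow 2).mul_const s).add tendsto_a_mul_b
    convert! this using 2
    norm_num
  have h2 : Tendsto (fun n : ℕ => √(2 * Real.log n)) atTop atTop :=
    Real.tendsto_sqrt_atTop.comp (tendsto_log_natCast.const_mul_atTop two_pos)
  refine (h1.pos_mul_atTop one_pos h2).congr' ?_
  filter_upwards [eventually_ge_atTop 2] with n hn
  have hL := log_natCast_pos hn
  have hs0 : √(2 * Real.log n) ≠ 0 := by positivity
  rw [u, a]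
  field_simp

lemma u_mono (n : ℕ) : Monotone (u n) := by
  intro x y h
  have : 0 ≤ a n := by unfold a; positivity
  unfold u
  gcongr

lemma continuous_u (n : ℕ) : Continuous (u n) := by unfold u; fun_prop

lemma integrable_rescaledDensity {n : ℕ} (hn : 2 ≤ n) : Integrable (rescaledDensity n) := by
  have h := (((integrable_gaussianPDFReal 0 1).comp_add_right (b n)).comp_mul_left'
    (a_pos hn).ne').const_mul (n * a n)
  exact h

/-! ### Exceedance intensities of a Gaussian pair -/

lemma natCast_mul_measureReal_eq {n : ℕ} (hn : 2 ≤ n) {A : Set (ℝ × ℝ)} (hA : MeasurableSet A) :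
    n * ((gaussianReal 0 1).prod (gaussianReal 0 1)).real A
      = ∫ p : ℝ × ℝ, A.indicator 1 (u n p.1, p.2) * rescaledDensity n p.1
          ∂(volume.prod (gaussianReal 0 1)) := by
  have hind : Measurable (A.indicator (1 : ℝ × ℝ → ℝ)) := measurable_one.indicator hA
  have hle : ∀ p, ‖A.indicator (1 : ℝ × ℝ → ℝ) p‖ ≤ 1 := fun p => by
    by_cases h : p ∈ A <;> simp [h]
  have hu : Measurable (fun p : ℝ × ℝ => (u n p.1, p.2)) :=
    ((continuous_u n).measurable.comp measurable_fst).prodMk measurable_snd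
  have hint : Integrable (fun p : ℝ × ℝ => A.indicator 1 (u n p.1, p.2) * rescaledDensity n p.1)
      (volume.prod (gaussianReal 0 1)) :=
    ((integrable_rescaledDensity hn).comp_fst _).bdd_mul
      (hind.comp hu).aestronglyMeasurable (ae_of_all _ fun p => hle _)
  rw [integral_prod _ hint, ← integral_indicator_one hA, integral_prod _
    (Integrable.of_bound hind.aestronglyMeasurable 1 (ae_of_all _ hle)),
    integral_gaussianReal_eq_integral_smul one_ne_zero]
  simp_rw [integral_mul_const]
  set k : ℝ → ℝ := fun s => ∫ y, A.indicator (1 : ℝ × ℝ → ℝ) (s, y) ∂(gaussianReal 0 1) with hk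
  have h1 : ∫ t, (gaussianPDFReal 0 1 (a n * t + b n) * k (a n * t + b n))
      = (a n)⁻¹ * ∫ s, gaussianPDFReal 0 1 s * k s := by
    have e1 := Measure.integral_comp_mul_left
      (fun s => gaussianPDFReal 0 1 (s + b n) * k (s + b n)) (a n)
    have e2 := integral_add_right_eq_self (μ := (volume : Measure ℝ))
      (fun s => gaussianPDFReal 0 1 s * k s) (b n)
    rw [e1, e2, abs_of_pos (inv_pos.2 (a_pos hn)), smul_eq_mul]
  have h2 : ∀ t, k (u n t) * rescaledDensity n t
      = n * a n * (gaussianPDFReal 0 1 (a n * t + b n) * k (a n * t + b n)) := by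
    intro t
    simp only [rescaledDensity, u]; ring
  simp only [smul_eq_mul]
  calc _ = n * a n * ((a n)⁻¹ * ∫ s, gaussianPDFReal 0 1 s * k s) := by
        have := (a_pos hn).ne'
        field_simp
        rfl
    _ = _ := by
        rw [← h1, ← integral_const_mul]
        exact integral_congr_ae (ae_of_all _ fun t => (h2 t).symm)

lemma integrable_indicator_exp {c k : ℝ} (hk : 0 < k) :
    Integrable (fun p : ℝ × ℝ => (Set.Ici c).indicator (fun t => Real.exp (-k * t)) p.1)
      (volume.prod (gaussianReal 0 1)) := by
  have h : Integrable ((Set.Ici c).indicator (fun t => Real.exp (-k * t))) := by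
    rw [integrable_indicator_iff measurableSet_Ici, integrableOn_Ici_iff_integrableOn_Ioi]
    exact exp_neg_integrableOn_Ioi c hk
  exact h.comp_fst _

/-- In the coordinate `t` with `s = u n t`, the first Gaussian multiplied by `n` becomes the measure
`exp (-t) dt` in the limit, while the second stays unchanged. The lower bound `c` on the first
coordinate confines the integrals to a half-line where the density bound dominates. -/
lemma tendsto_natCast_mul_measureReal {A : ℕ → Set (ℝ × ℝ)} (hA : ∀ n, MeasurableSet (A n))
    {B : Set (ℝ × ℝ)} {c : ℝ} (hc : ∀ᶠ n in atTop, ∀ p : ℝ × ℝ, (u n p.1, p.2) ∈ A n → c ≤ p.1)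
    (hAB : ∀ᵐ p ∂(volume.prod (gaussianReal 0 1)),
      ∀ᶠ n in atTop, ((u n p.1, p.2) ∈ A n ↔ p ∈ B)) :
    Tendsto (fun n : ℕ => n * ((gaussianReal 0 1).prod (gaussianReal 0 1)).real (A n)) atTop
      (𝓝 (∫ p, B.indicator (fun p => Real.exp (-p.1)) p ∂(volume.prod (gaussianReal 0 1)))) := by
  have key : Tendsto (fun n : ℕ => ∫ p : ℝ × ℝ,
      (A n).indicator 1 (u n p.1, p.2) * rescaledDensity n p.1 ∂(volume.prod (gaussianReal 0 1)))
      atTop (𝓝 (∫ p, B.indicator (fun p => Real.exp (-p.1)) p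
        ∂(volume.prod (gaussianReal 0 1)))) := by
    refine tendsto_integral_filter_of_dominated_convergence
      (fun p : ℝ × ℝ => (Set.Ici c).indicator (fun t => Real.exp (-(1 / 2) * t)) p.1 +
        (Set.Ici c).indicator (fun t => Real.exp (-(3 / 2) * t)) p.1) ?_ ?_ ?_ ?_
    · refine Eventually.of_forall fun n => Measurable.aestronglyMeasurable ?_
      have hu : Measurable (fun p : ℝ × ℝ => (u n p.1, p.2)) :=
        ((continuous_u n).measurable.comp measurable_fst).prodMk measurable_snd
      have hd : Measurable (rescaledDensity n) :=
        ((measurable_gaussianPDFReal 0 1).comp (continuous_u n).measurable).const_mul _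
      exact ((measurable_one.indicator (hA n)).comp hu).mul (hd.comp measurable_fst)
    · filter_upwards [hc, eventually_rescaledDensity_le] with n hn hd
      refine ae_of_all _ fun p => ?_
      by_cases hp : (u n p.1, p.2) ∈ A n
      · have hcp : p.1 ∈ Set.Ici c := hn p hp
        simp only [Set.indicator_of_mem hp, Set.indicator_of_mem hcp, Pi.one_apply, one_mul]
        rw [Real.norm_of_nonneg (rescaledDensity_nonneg _ _)]
        exact hd p.1
      · simp only [Set.indicator_of_notMem hp, zero_mul, norm_zero]
        exact add_nonneg (Set.indicator_nonneg (fun _ _ => (Real.exp_pos _).le) _)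
          (Set.indicator_nonneg (fun _ _ => (Real.exp_pos _).le) _)
    · exact (integrable_indicator_exp (by norm_num)).add (integrable_indicator_exp (by norm_num))
    · filter_upwards [hAB] with p hp
      have hlim := tendsto_rescaledDensity (tendsto_const_nhds (x := p.1))
      by_cases hB : p ∈ B
      · rw [Set.indicator_of_mem hB]
        refine hlim.congr' ?_
        filter_upwards [hp] with n hn
        rw [Set.indicator_of_mem (hn.2 hB), Pi.one_apply, one_mul]
      · rw [Set.indicator_of_notMem hB]
        refine tendsto_const_nhds.congr' ?_
        filter_upwards [hp] with n hn
        rw [Set.indicator_of_notMem (fun h => hB (hn.1 h)), zero_mul]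
  refine key.congr' ?_
  filter_upwards [eventually_ge_atTop 2] with n hn
  exact (natCast_mul_measureReal_eq hn (hA n)).symm

/-- The region of the points `(t, s)` which carries the limit of the exceedances of the second
component for which the first component does not exceed. -/
def exceedRegion (lam : ℝ≥0∞) (x y : ℝ) : Set (ℝ × ℝ) :=
  {p | y < p.1 ∧ (lam = ∞ ∨ p.1 + 2 * lam.toReal * p.2 ≤ x + 2 * lam.toReal ^ 2)}

/-- The limiting intensity of `exceedRegion`. -/
noncomputable def exceedMass (lam : ℝ≥0∞) (x y : ℝ) : ℝ :=
  ∫ p, (exceedRegion lam x y).indicator (fun p => Real.exp (-p.1)) p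
    ∂(volume.prod (gaussianReal 0 1))

lemma integral_indicator_Ioi_exp (x : ℝ) :
    ∫ p : ℝ × ℝ, {p : ℝ × ℝ | x < p.1}.indicator (fun p => Real.exp (-p.1)) p
      ∂(volume.prod (gaussianReal 0 1)) = Real.exp (-x) := by
  have e : ({p : ℝ × ℝ | x < p.1}.indicator fun p : ℝ × ℝ => Real.exp (-p.1))
      = fun p : ℝ × ℝ => (Set.Ioi x).indicator (fun t => Real.exp (-t)) p.1 := by
    ext p
    by_cases h : x < p.1
    · rw [Set.indicator_of_mem (by exact h), Set.indicator_of_mem (by exact h)]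
    · rw [Set.indicator_of_notMem (by exact h), Set.indicator_of_notMem (by exact h)]
  rw [e]
  have := integral_fun_fst (μ := (volume : Measure ℝ)) (ν := gaussianReal 0 1)
    ((Set.Ioi x).indicator (fun t => Real.exp (-t)))
  rw [this, integral_indicator measurableSet_Ioi, integral_exp_neg_Ioi]
  simp

lemma ae_fst_ne (x : ℝ) : ∀ᵐ p : ℝ × ℝ ∂(volume.prod (gaussianReal 0 1)), p.1 ≠ x := by
  have h : ∀ᵐ t : ℝ, t ≠ x := by simp [ae_iff]
  exact Measure.quasiMeasurePreserving_fst.ae h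

lemma ae_fst_add_ne (c d : ℝ) :
    ∀ᵐ p : ℝ × ℝ ∂(volume.prod (gaussianReal 0 1)), p.1 + c * p.2 ≠ d := by
  rw [ae_iff]
  have hm : MeasurableSet {p : ℝ × ℝ | ¬ (p.1 + c * p.2 ≠ d)} := by
    simp only [not_not]
    exact measurableSet_eq_fun (by fun_prop) (by fun_prop)
  rw [Measure.prod_apply_symm hm]
  refine lintegral_eq_zero_of_ae_eq_zero (ae_of_all _ fun s => ?_)
  have : (fun t : ℝ => (t, s)) ⁻¹' {p : ℝ × ℝ | ¬ (p.1 + c * p.2 ≠ d)} = {d - c * s} := by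
    ext t
    simp [eq_sub_iff_add_eq]
  simp only [this, Pi.zero_apply, measure_singleton]

lemma tendsto_tail {x : ℕ → ℝ} {x₀ : ℝ} (hx : Tendsto x atTop (𝓝 x₀)) :
    Tendsto (fun n : ℕ => n * ((gaussianReal 0 1).prod (gaussianReal 0 1)).real
      {z : ℝ × ℝ | u n (x n) < z.1}) atTop (𝓝 (Real.exp (-x₀))) := by
  rw [← integral_indicator_Ioi_exp x₀]
  have hlt : ∀ n, 2 ≤ n → ∀ s t, (u n s < u n t ↔ s < t) := by
    intro n hn s t
    have := a_pos hn
    simp [u, this]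
  refine tendsto_natCast_mul_measureReal (c := x₀ - 1)
    (fun n => measurableSet_lt measurable_const measurable_fst) ?_ ?_
  · filter_upwards [eventually_ge_atTop 2, hx.eventually_const_lt (sub_one_lt x₀)] with n hn h p hp
    exact (h.trans ((hlt n hn _ _).1 hp)).le
  · filter_upwards [ae_fst_ne x₀] with p hp
    rcases lt_or_gt_of_ne hp with h | h
    · filter_upwards [eventually_ge_atTop 2, hx.eventually_const_lt h] with n hn hxn
      refine iff_of_false (fun h1 => ?_) (not_lt.2 h.le)
      exact lt_asymm hxn ((hlt n hn _ _).1 h1)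
    · filter_upwards [eventually_ge_atTop 2, hx.eventually_lt_const h] with n hn hxn
      exact iff_of_true ((hlt n hn _ _).2 hxn) h

lemma map_linear_combination_gaussian {r : ℝ} (hr : |r| ≤ 1) :
    ((gaussianReal 0 1).prod (gaussianReal 0 1)).map (fun z => r * z.1 + √(1 - r ^ 2) * z.2)
      = gaussianReal 0 1 := by
  set μ := (gaussianReal 0 1).prod (gaussianReal 0 1)
  have h1 : HasLaw (fun z : ℝ × ℝ => z.1) (gaussianReal 0 1) μ :=
    ⟨by fun_prop, by simp [μ]⟩
  have h2 : HasLaw (fun z : ℝ × ℝ => z.2) (gaussianReal 0 1) μ :=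
    ⟨by fun_prop, by simp [μ]⟩
  have hind : IndepFun (fun z : ℝ × ℝ => r * z.1) (fun z : ℝ × ℝ => √(1 - r ^ 2) * z.2) μ :=
    indepFun_prod (X := fun x : ℝ => r * x) (Y := fun x : ℝ => √(1 - r ^ 2) * x)
      (by fun_prop) (by fun_prop)
  have h3 := gaussianReal_add_gaussianReal_of_indepFun hind (gaussianReal_const_mul h1 r).map_eq
    (gaussianReal_const_mul h2 (√(1 - r ^ 2))).map_eq
  have hr2 : r ^ 2 ≤ 1 := by rw [← sq_abs]; exact pow_le_one₀ (abs_nonneg _) hr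
  convert! h3 using 2
  · simp
  · ext
    simp
    rw [Real.sq_sqrt (by linarith)]
    ring

/-- Everything scales with `a n` because `1 - r² = a² · 2 (1 + r) (1 - r) log n`. If `(1 - r) log n
→ λ²` with `λ` finite, the bracket tends to `x + 2λ² - t - 2λs`, the inequality behind
`exceedRegion`. -/
lemma u_sub_eq {n : ℕ} (hn : 2 ≤ n) {r : ℝ} (hr : |r| ≤ 1) (x t s : ℝ) :
    u n x - (r * u n t + √(1 - r ^ 2) * s) = a n * (x + 2 * ((1 - r) * Real.log n) * (a n * b n)
      - r * t - √(2 * (1 + r) * ((1 - r) * Real.log n)) * s) := by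
  have hL := log_natCast_pos hn
  have ha := a_pos hn
  have ha2 := a_sq_mul hn
  have h1 := (abs_le.1 hr).1
  have h2 := (abs_le.1 hr).2
  have hs : √(1 - r ^ 2) = a n * √(2 * (1 + r) * ((1 - r) * Real.log n)) := by
    have : 1 - r ^ 2 = a n ^ 2 * (2 * (1 + r) * ((1 - r) * Real.log n)) := by
      linear_combination (-(1 - r ^ 2)) * ha2
    rw [this, Real.sqrt_mul (by positivity), Real.sqrt_sq ha.le]
  rw [hs, u, u]
  linear_combination (-(1 - r) * b n) * ha2

lemma tendsto_real_of_tendsto_ofReal {f : ℕ → ℝ} (hf : ∀ᶠ n in atTop, 0 ≤ f n) {c : ℝ≥0∞}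
    (hc : c ≠ ∞) (h : Tendsto (fun n => ENNReal.ofReal (f n)) atTop (𝓝 c)) :
    Tendsto f atTop (𝓝 c.toReal) := by
  refine ((ENNReal.tendsto_toReal hc).comp h).congr' ?_
  filter_upwards [hf] with n hn
  exact ENNReal.toReal_ofReal hn

lemma tendsto_atTop_of_tendsto_ofReal {f : ℕ → ℝ}
    (h : Tendsto (fun n => ENNReal.ofReal (f n)) atTop (𝓝 ∞)) : Tendsto f atTop atTop := by
  rw [ENNReal.tendsto_nhds_top_iff_nnreal] at h
  rw [tendsto_atTop]
  intro M
  filter_upwards [h M.toNNReal] with n hn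
  by_contra! hlt
  have : ENNReal.ofReal (f n) ≤ M.toNNReal := ENNReal.ofReal_le_ofReal hlt.le
  exact absurd hn (not_lt.2 this)

/-- Rescaled slack of the first component at the point `p`, whose first coordinate is the
normalized value of the second component. -/
noncomputable def slack (r x : ℕ → ℝ) (p : ℝ × ℝ) (n : ℕ) : ℝ :=
  x n + 2 * ((1 - r n) * Real.log n) * (a n * b n)
    - r n * p.1 - √(2 * (1 + r n) * ((1 - r n) * Real.log n)) * p.2

/-- For finite `λ` one has `r → 1` and the slack converges; its limit is nonzero off a null line, so
its sign settles. For `λ = ∞` the term linear in `k = (1 - r) log n` beats the one of order `√k`,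
and the slack is eventually nonnegative. -/
lemma ae_eventually_slack_nonneg_iff {r : ℕ → ℝ} (hr : ∀ n, |r n| ≤ 1) {lam : ℝ≥0∞}
    (hlam : Tendsto (fun n : ℕ => ENNReal.ofReal ((1 - r n) * Real.log n)) atTop (𝓝 (lam ^ 2)))
    {x : ℕ → ℝ} {x₀ : ℝ} (hx : Tendsto x atTop (𝓝 x₀)) :
    ∀ᵐ p ∂(volume.prod (gaussianReal 0 1)), ∀ᶠ n in atTop, (0 ≤ slack r x p n ↔
      (lam = ∞ ∨ p.1 + 2 * lam.toReal * p.2 ≤ x₀ + 2 * lam.toReal ^ 2)) := by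
  have hk0 : ∀ n : ℕ, 0 ≤ (1 - r n) * Real.log n := fun n =>
    mul_nonneg (by linarith [(abs_le.1 (hr n)).2]) (Real.log_natCast_nonneg n)
  unfold slack
  by_cases htop : lam = ∞
  · refine ae_of_all _ fun p => ?_
    have hk : Tendsto (fun n : ℕ => (1 - r n) * Real.log n) atTop atTop :=
      tendsto_atTop_of_tendsto_ofReal (by simpa [htop] using hlam)
    have hab : ∀ᶠ n in atTop, 1 / 2 < a n * b n :=
      tendsto_a_mul_b.eventually_const_lt (by norm_num)
    have hxb : ∀ᶠ n in atTop, x₀ - 1 < x n := hx.eventually_const_lt (sub_one_lt x₀)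
    have hsq : Tendsto (fun n : ℕ => √((1 - r n) * Real.log n)) atTop atTop :=
      Real.tendsto_sqrt_atTop.comp hk
    -- The first threshold gives `k - 2 √k |p.2| ≥ √k`, and the second makes this `√k` outweigh
    -- `|p.1|` and `x₀ - 1`.
    filter_upwards [hab, hxb, hsq.eventually_ge_atTop (2 * |p.2| + 1),
      hsq.eventually_ge_atTop (|p.1| + 1 - x₀)] with n h1 h2 h3 h4
    refine iff_of_true ?_ (Or.inl htop)
    have hr1 := (abs_le.1 (hr n)).1
    have hr2 := (abs_le.1 (hr n)).2
    have hk1 := hk0 n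
    generalize (1 - r n) * Real.log n = k at h3 h4 hk1 ⊢
    have e1 : √k ^ 2 = k := Real.sq_sqrt hk1
    have e2 : √(2 * (1 + r n) * k) ≤ 2 * √k := by
      have : 2 * √k = √(4 * k) := by
        rw [Real.sqrt_mul (by norm_num : (0 : ℝ) ≤ 4), show (4 : ℝ) = 2 ^ 2 by norm_num,
          Real.sqrt_sq (by norm_num)]
      rw [this]
      exact Real.sqrt_le_sqrt (by
        refine mul_le_mul_of_nonneg_right ?_ hk1
        linarith)
    have e3 : √(2 * (1 + r n) * k) * p.2 ≤ 2 * √k * |p.2| :=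
      (mul_le_mul_of_nonneg_left (le_abs_self _) (Real.sqrt_nonneg _)).trans
        (mul_le_mul_of_nonneg_right e2 (abs_nonneg _))
    have e4 : r n * p.1 ≤ |p.1| := by
      refine (le_abs_self _).trans ?_
      rw [abs_mul]
      exact mul_le_of_le_one_left (abs_nonneg _) (hr n)
    have e5 : k ≤ 2 * k * (a n * b n) := by nlinarith
    have e6 : √k ≤ √k * (√k - 2 * |p.2|) :=
      le_mul_of_one_le_right (Real.sqrt_nonneg _) (by linarith)
    have e7 : √k * (√k - 2 * |p.2|) = k - 2 * √k * |p.2| := by rw [mul_sub, ← sq, e1]; ring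
    linarith
  · have hk := tendsto_real_of_tendsto_ofReal (Eventually.of_forall hk0)
      (ENNReal.pow_ne_top htop) hlam
    rw [ENNReal.toReal_pow] at hk
    have hr1 : Tendsto r atTop (𝓝 1) := by
      have h0 := (hk.div_atTop tendsto_log_natCast).const_sub 1
      rw [sub_zero] at h0
      refine h0.congr' ?_
      filter_upwards [eventually_ge_atTop 2] with n hn
      have := (log_natCast_pos hn).ne'
      field_simp
      ring
    filter_upwards [ae_fst_add_ne (2 * lam.toReal) (x₀ + 2 * lam.toReal ^ 2)] with p hp
    have hlim : Tendsto (fun n => x n + 2 * ((1 - r n) * Real.log n) * (a n * b n)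
        - r n * p.1 - √(2 * (1 + r n) * ((1 - r n) * Real.log n)) * p.2) atTop (𝓝 (x₀ + 2 * lam.toReal ^ 2 * 1 - 1 * p.1 -
        √(2 * (1 + 1) * lam.toReal ^ 2) * p.2)) := by
      refine ((hx.add ((hk.const_mul 2).mul tendsto_a_mul_b)).sub (hr1.mul_const _)).sub
        (Tendsto.mul_const _ ?_)
      exact (Real.continuous_sqrt.tendsto _).comp (((hr1.const_add 1).const_mul 2).mul hk)
    have hsq : √(2 * (1 + 1) * lam.toReal ^ 2) = 2 * lam.toReal := by
      rw [show 2 * (1 + 1) * lam.toReal ^ 2 = (2 * lam.toReal) ^ 2 by ring,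
        Real.sqrt_sq (by positivity)]
    rw [hsq] at hlim
    rcases lt_or_gt_of_ne hp with h | h
    · filter_upwards [hlim.eventually_const_lt (u := 0) (by linarith)] with n hn
      exact iff_of_true hn.le (Or.inr h.le)
    · filter_upwards [hlim.eventually_lt_const (u := 0) (by linarith)] with n hn
      exact iff_of_false (not_le.2 hn) (by rintro (h1 | h1) <;> [exact htop h1; linarith])

lemma tendsto_exceed {r : ℕ → ℝ} (hr : ∀ n, |r n| ≤ 1) {lam : ℝ≥0∞}
    (hlam : Tendsto (fun n : ℕ => ENNReal.ofReal ((1 - r n) * Real.log n)) atTop (𝓝 (lam ^ 2)))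
    {x y : ℕ → ℝ} {x₀ y₀ : ℝ} (hx : Tendsto x atTop (𝓝 x₀)) (hy : Tendsto y atTop (𝓝 y₀)) :
    Tendsto (fun n : ℕ => n * ((gaussianReal 0 1).prod (gaussianReal 0 1)).real
      {z : ℝ × ℝ | u n (y n) < z.1 ∧ r n * z.1 + √(1 - r n ^ 2) * z.2 ≤ u n (x n)}) atTop
      (𝓝 (exceedMass lam x₀ y₀)) := by
  have hlt : ∀ n, 2 ≤ n → ∀ s t, (u n s < u n t ↔ s < t) := by
    intro n hn s t
    have := a_pos hn
    simp [u, this]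
  have hle : ∀ n, 2 ≤ n → ∀ p : ℝ × ℝ,
      (r n * u n p.1 + √(1 - r n ^ 2) * p.2 ≤ u n (x n) ↔ 0 ≤ slack r x p n) := by
    intro n hn p
    rw [← sub_nonneg, u_sub_eq hn (hr n), mul_nonneg_iff_of_pos_left (a_pos hn), slack]
  have hA : ∀ n, MeasurableSet {z : ℝ × ℝ | u n (y n) < z.1 ∧
      r n * z.1 + √(1 - r n ^ 2) * z.2 ≤ u n (x n)} := fun n =>
    (measurableSet_lt measurable_const measurable_fst).inter
      (measurableSet_le (f := fun z : ℝ × ℝ => r n * z.1 + √(1 - r n ^ 2) * z.2) (by fun_prop)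
        measurable_const)
  refine tendsto_natCast_mul_measureReal (c := y₀ - 1) (B := exceedRegion lam x₀ y₀) hA ?_ ?_
  · filter_upwards [eventually_ge_atTop 2, hy.eventually_const_lt (sub_one_lt y₀)] with n hn h p hp
    exact (h.trans ((hlt n hn _ _).1 hp.1)).le
  have hd' := ae_eventually_slack_nonneg_iff hr hlam hx
  filter_upwards [hd', ae_fst_ne y₀] with p hdp hp
  have hyp : ∀ᶠ n in atTop, (y n < p.1 ↔ y₀ < p.1) := by
    rcases lt_or_gt_of_ne hp with h | h
    · filter_upwards [hy.eventually_const_lt h] with n hn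
      exact iff_of_false hn.not_gt h.not_gt
    · filter_upwards [hy.eventually_lt_const h] with n hn
      exact iff_of_true hn h
  filter_upwards [eventually_ge_atTop 2, hdp, hyp] with n hn h1 h2
  exact and_congr ((hlt n hn _ _).trans h2) ((hle n hn p).trans h1)

/-- The limiting intensity of the points at which at least one component exceeds. -/
theorem tendsto_natCast_mul_one_sub {r : ℕ → ℝ} (hr : ∀ n, |r n| ≤ 1) {lam : ℝ≥0∞}
    (hlam : Tendsto (fun n : ℕ => ENNReal.ofReal ((1 - r n) * Real.log n)) atTop (𝓝 (lam ^ 2)))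
    {x y : ℕ → ℝ} {x₀ y₀ : ℝ} (hx : Tendsto x atTop (𝓝 x₀)) (hy : Tendsto y atTop (𝓝 y₀)) :
    Tendsto (fun n : ℕ => n * (1 - ((gaussianReal 0 1).prod (gaussianReal 0 1)).real
      {z : ℝ × ℝ | r n * z.1 + √(1 - r n ^ 2) * z.2 ≤ u n (x n) ∧ z.1 ≤ u n (y n)})) atTop
      (𝓝 (Real.exp (-x₀) + exceedMass lam x₀ y₀)) := by
  refine ((tendsto_tail hx).add (tendsto_exceed hr hlam hx hy)).congr fun n => ?_
  rw [← mul_add]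
  congr 1
  set μ := (gaussianReal 0 1).prod (gaussianReal 0 1) with hμ
  have m1 : Measurable fun z : ℝ × ℝ => r n * z.1 + √(1 - r n ^ 2) * z.2 := by fun_prop
  -- The first component is itself standard Gaussian, so its tail equals that of a coordinate. The
  -- complement of the event then splits into "the first exceeds" and "the second exceeds but the
  -- first does not".
  have e1 : μ.real {z : ℝ × ℝ | u n (x n) < z.1}
      = μ.real {z : ℝ × ℝ | u n (x n) < r n * z.1 + √(1 - r n ^ 2) * z.2} := by
    have h1 : μ.map (fun z : ℝ × ℝ => z.1) = gaussianReal 0 1 := by simp [hμ]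
    have h2 := map_linear_combination_gaussian (hr n)
    have h3 : μ.real {z : ℝ × ℝ | u n (x n) < z.1}
        = (μ.map (fun z : ℝ × ℝ => z.1)).real (Set.Ioi (u n (x n))) := by
      rw [map_measureReal_apply (by fun_prop) measurableSet_Ioi]; rfl
    rw [h3, h1, ← h2, map_measureReal_apply m1 measurableSet_Ioi]
    rfl
  have hS : MeasurableSet
      {z : ℝ × ℝ | r n * z.1 + √(1 - r n ^ 2) * z.2 ≤ u n (x n) ∧ z.1 ≤ u n (y n)} :=
    (measurableSet_le m1 measurable_const).inter (measurableSet_le measurable_fst measurable_const)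
  rw [e1, ← probReal_compl_eq_one_sub hS, ← measureReal_union]
  · congr 1
    ext z
    simp only [Set.mem_union, Set.mem_ofPred_eq, Set.mem_compl_iff, not_and_or, not_le]
    constructor
    · rintro (h | h)
      · exact Or.inl h
      · exact Or.inr h.1
    · rintro (h | h)
      · exact Or.inl h
      · rcases lt_or_ge (u n (x n)) (r n * z.1 + √(1 - r n ^ 2) * z.2) with h' | h'
        · exact Or.inl h'
        · exact Or.inr ⟨h, h'⟩
  · rw [Set.disjoint_left]
    intro z h1 h2
    exact absurd h2.2 (not_le.2 h1)
  · exact (measurableSet_lt measurable_const measurable_fst).inter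
      (measurableSet_le m1 measurable_const)

/-! ### Identification with the Hüsler-Reiss distribution -/

lemma Phi_eq_integral (x : ℝ) : Phi x = ∫ t in Set.Iic x, gaussianPDFReal 0 1 t := by
  rw [Phi, cdf_eq_real, measureReal_def, gaussianReal_apply_eq_integral _ one_ne_zero,
    ENNReal.toReal_ofReal]
  exact integral_nonneg fun t => gaussianPDFReal_nonneg _ _ _

lemma hasDerivAt_Phi (x : ℝ) : HasDerivAt Phi (gaussianPDFReal 0 1 x) x := by
  have hi := integrable_gaussianPDFReal 0 1
  have hc : Continuous (gaussianPDFReal 0 1) :=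
    continuous_iff_continuousAt.2 fun x => (hasDerivAt_gaussianPDFReal 0 1 x).continuousAt
  have e : Phi = fun x => Phi 0 + ∫ t in (0 : ℝ)..x, gaussianPDFReal 0 1 t := by
    ext x
    rw [← intervalIntegral.integral_Iic_sub_Iic hi.integrableOn hi.integrableOn, Phi_eq_integral,
      Phi_eq_integral]
    ring
  rw [e]
  exact (intervalIntegral.integral_hasDerivAt_right (hc.intervalIntegrable _ _)
    (hc.stronglyMeasurableAtFilter _ _) hc.continuousAt).const_add _

lemma continuous_Phi : Continuous Phi :=
  continuous_iff_continuousAt.2 fun x => (hasDerivAt_Phi x).continuousAt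

lemma Phi_nonneg (x : ℝ) : 0 ≤ Phi x := cdf_nonneg _ x

lemma Phi_le_one (x : ℝ) : Phi x ≤ 1 := cdf_le_one _ x

/-- The Hüsler-Reiss exponent, as a function of `t` in place of `y`, is minus a primitive of the
integrand: the two density terms in its derivative cancel, by completing the square. It tends to
`exp (-x)` at infinity. -/
lemma integral_exp_neg_mul_Phi {k : ℝ} (hk : 0 < k) (x y : ℝ) :
    ∫ t in Set.Ioi y, Real.exp (-t) * Phi (k + (x - t) / (2 * k))
      = Phi (k + (x - y) / (2 * k)) * Real.exp (-y) + Phi (k + (y - x) / (2 * k)) * Real.exp (-x)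
        - Real.exp (-x) := by
  set f : ℝ → ℝ := fun t => Phi (k + (x - t) / (2 * k)) * Real.exp (-t) +
    Phi (k + (t - x) / (2 * k)) * Real.exp (-x) with hf
  have hder : ∀ t, HasDerivAt f (-(Real.exp (-t) * Phi (k + (x - t) / (2 * k)))) t := by
    intro t
    have h1 : HasDerivAt (fun t => k + (x - t) / (2 * k)) (-1 / (2 * k)) t :=
      (((hasDerivAt_id t).const_sub x).div_const (2 * k)).const_add k
    have h2 : HasDerivAt (fun t => k + (t - x) / (2 * k)) (1 / (2 * k)) t :=
      (((hasDerivAt_id t).sub_const x).div_const (2 * k)).const_add k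
    have h3 := (hasDerivAt_Phi _).comp t h1
    have h4 := (hasDerivAt_Phi _).comp t h2
    have h5 : HasDerivAt (fun t : ℝ => Real.exp (-t)) (-Real.exp (-t)) t := by
      simpa using (hasDerivAt_neg t).exp
    have h6 := (h3.mul h5).add (h4.mul_const (Real.exp (-x)))
    have hcancel : gaussianPDFReal 0 1 (k + (x - t) / (2 * k)) * Real.exp (-t)
        = gaussianPDFReal 0 1 (k + (t - x) / (2 * k)) * Real.exp (-x) := by
      simp only [gaussianPDFReal, mul_assoc (√_)⁻¹, ← Real.exp_add]
      congr 2
      rw [NNReal.coe_one]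
      field_simp
      ring
    convert! h6 using 1
    simp only [Function.comp]
    linear_combination (1 / (2 * k)) * hcancel
  have hlim : Tendsto f atTop (𝓝 (Real.exp (-x))) := by
    have hA : Tendsto (fun t => Phi (k + (x - t) / (2 * k)) * Real.exp (-t)) atTop (𝓝 0) := by
      refine squeeze_zero (fun t => mul_nonneg (Phi_nonneg _) (Real.exp_pos _).le)
        (fun t => mul_le_of_le_one_left (Real.exp_pos _).le (Phi_le_one _))
        Real.tendsto_exp_neg_atTop_nhds_zero
    have hB : Tendsto (fun t => k + (t - x) / (2 * k)) atTop atTop :=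
      tendsto_atTop_add_const_left _ _
        ((tendsto_atTop_add_const_right _ (-x) tendsto_id).atTop_div_const (by positivity))
    have hC : Tendsto (fun t => Phi (k + (t - x) / (2 * k)) * Real.exp (-x)) atTop
        (𝓝 (1 * Real.exp (-x))) := ((tendsto_cdf_atTop _).comp hB).mul_const _
    have := hA.add hC
    rwa [zero_add, one_mul] at this
  have key := integral_Ioi_of_hasDerivAt_of_nonpos' (g := f) (a := y)
    (g' := fun t => -(Real.exp (-t) * Phi (k + (x - t) / (2 * k)))) (fun t _ => hder t)
    (fun t _ => neg_nonpos.2 (mul_nonneg (Real.exp_pos _).le (Phi_nonneg _))) hlim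
  rw [integral_neg] at key
  simp only [hf] at key
  linarith

lemma measurableSet_exceedRegion (lam : ℝ≥0∞) (x y : ℝ) :
    MeasurableSet (exceedRegion lam x y) := by
  refine (measurableSet_lt measurable_const measurable_fst).inter ?_
  by_cases h : lam = ∞
  · have : {p : ℝ × ℝ | lam = ∞ ∨ p.1 + 2 * lam.toReal * p.2 ≤ x + 2 * lam.toReal ^ 2}
        = Set.univ := by ext p; simp [h]
    change MeasurableSet {p : ℝ × ℝ | lam = ∞ ∨ _}
    rw [this]
    exact MeasurableSet.univ
  · simp only [h, false_or]
    exact measurableSet_le (by fun_prop) measurable_const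

lemma integrable_exceedRegion (lam : ℝ≥0∞) (x y : ℝ) :
    Integrable ((exceedRegion lam x y).indicator (fun p => Real.exp (-p.1)))
      (volume.prod (gaussianReal 0 1)) := by
  refine (integrable_indicator_exp (c := y) one_pos).mono
    (Measurable.aestronglyMeasurable ?_) (ae_of_all _ fun p => ?_)
  · exact Measurable.indicator (by fun_prop) (measurableSet_exceedRegion lam x y)
  · by_cases h : p ∈ exceedRegion lam x y
    · have h1 : p.1 ∈ Set.Ici y := le_of_lt h.1
      rw [Set.indicator_of_mem h, Set.indicator_of_mem h1]
      simp
    · rw [Set.indicator_of_notMem h, norm_zero]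
      exact norm_nonneg _

lemma exceedMass_nonneg (lam : ℝ≥0∞) (x y : ℝ) : 0 ≤ exceedMass lam x y :=
  integral_nonneg fun _ => Set.indicator_nonneg (fun _ _ => (Real.exp_pos _).le) _

lemma exceedMass_top (x y : ℝ) : exceedMass ∞ x y = Real.exp (-y) := by
  rw [← integral_indicator_Ioi_exp y]
  simp [exceedMass, exceedRegion]

lemma exceedMass_le (lam : ℝ≥0∞) (x y : ℝ) : exceedMass lam x y ≤ Real.exp (-y) := by
  rw [← exceedMass_top x y]
  refine integral_mono (integrable_exceedRegion _ _ _) (integrable_exceedRegion _ _ _) fun p => ?_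
  refine Set.indicator_le_indicator_of_subset ?_ (fun _ => (Real.exp_pos _).le) p
  exact fun p hp => ⟨hp.1, Or.inl rfl⟩

lemma exceedMass_zero (x y : ℝ) :
    Real.exp (-x) + exceedMass 0 x y = max (Real.exp (-x)) (Real.exp (-y)) := by
  have e : (exceedRegion 0 x y).indicator (fun p => Real.exp (-p.1))
      = fun p : ℝ × ℝ => (Set.Ioc y x).indicator (fun t => Real.exp (-t)) p.1 := by
    ext p
    by_cases h : p.1 ∈ Set.Ioc y x
    · rw [Set.indicator_of_mem h, Set.indicator_of_mem]
      exact ⟨h.1, Or.inr (by simpa using h.2)⟩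
    · rw [Set.indicator_of_notMem h, Set.indicator_of_notMem]
      rintro ⟨h1, h2⟩
      exact h ⟨h1, by simpa using h2⟩
  have h1 := integral_fun_fst (μ := (volume : Measure ℝ)) (ν := gaussianReal 0 1)
    ((Set.Ioc y x).indicator (fun t => Real.exp (-t)))
  rw [exceedMass, e, h1, integral_indicator measurableSet_Ioc]
  rcases le_total y x with hxy | hxy
  · rw [← intervalIntegral.integral_of_le hxy, max_eq_right (by gcongr)]
    have : ∀ t, HasDerivAt (fun t : ℝ => -Real.exp (-t)) (Real.exp (-t)) t := fun t => by
      simpa using! ((hasDerivAt_neg t).exp).neg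
    rw [intervalIntegral.integral_eq_sub_of_hasDerivAt (fun t _ => this t)
      ((by fun_prop : Continuous fun t : ℝ => Real.exp (-t)).intervalIntegrable _ _)]
    simp
  · rw [Set.Ioc_eq_empty (not_lt.2 hxy), max_eq_left (by gcongr)]
    simp

/-- At fixed `t > y` the region is a half-line in the Gaussian coordinate, of mass `Phi (k + (x - t)
/ (2k))`; integration over `t` remains. -/
lemma exceedMass_of_pos {lam : ℝ≥0∞} (h0 : lam ≠ 0) (ht : lam ≠ ∞) (x y : ℝ) :
    Real.exp (-x) + exceedMass lam x y
      = Phi (lam.toReal + (x - y) / (2 * lam.toReal)) * Real.exp (-y)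
        + Phi (lam.toReal + (y - x) / (2 * lam.toReal)) * Real.exp (-x) := by
  have hk : 0 < lam.toReal := ENNReal.toReal_pos h0 ht
  set k := lam.toReal with hkdef
  have key : exceedMass lam x y
      = ∫ t in Set.Ioi y, Real.exp (-t) * Phi (k + (x - t) / (2 * k)) := by
    rw [exceedMass, integral_prod _ (integrable_exceedRegion _ _ _),
      ← integral_indicator measurableSet_Ioi]
    congr 1 with t
    by_cases hy : y < t
    · rw [Set.indicator_of_mem (by exact hy)]
      have e : ∀ s, (exceedRegion lam x y).indicator (fun p : ℝ × ℝ => Real.exp (-p.1)) (t, s)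
          = Real.exp (-t) * (Set.Iic (k + (x - t) / (2 * k))).indicator 1 s := by
        intro s
        have hiff : ((t, s) ∈ exceedRegion lam x y) ↔ s ∈ Set.Iic (k + (x - t) / (2 * k)) := by
          have : k + (x - t) / (2 * k) = (x + 2 * k ^ 2 - t) / (2 * k) := by field_simp; ring
          rw [Set.mem_Iic, this, le_div_iff₀ (by positivity)]
          constructor
          · rintro ⟨_, h | h⟩
            · exact absurd h ht
            · simp only [← hkdef] at h; linarith
          · intro h
            exact ⟨hy, Or.inr (by simp only [← hkdef]; linarith)⟩
        by_cases hs : s ∈ Set.Iic (k + (x - t) / (2 * k))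
        · rw [Set.indicator_of_mem hs, Set.indicator_of_mem (hiff.2 hs)]; simp
        · rw [Set.indicator_of_notMem hs, Set.indicator_of_notMem (fun h => hs (hiff.1 h))]; simp
      simp_rw [e]
      rw [integral_const_mul, integral_indicator_one measurableSet_Iic, Phi, cdf_eq_real]
    · rw [Set.indicator_of_notMem (by exact hy)]
      refine integral_eq_zero_of_ae (ae_of_all _ fun s => ?_)
      exact Set.indicator_of_notMem (fun h => hy h.1) _
  rw [key, integral_exp_neg_mul_Phi hk]
  ring

/-- A single formula covering `0`, `∞` and the values between, so that limits and bounds need no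
case distinction on the parameter. -/
theorem H_eq_exp (lam : ℝ≥0∞) (x y : ℝ) :
    H lam x y = Real.exp (-(Real.exp (-x) + exceedMass lam x y)) := by
  unfold H
  split_ifs with h0 ht
  · rw [h0, exceedMass_zero]
    unfold gumbel
    rcases le_total (Real.exp (-x)) (Real.exp (-y)) with h | h
    · rw [max_eq_right h, min_eq_right (by gcongr)]
    · rw [max_eq_left h, min_eq_left (by gcongr)]
  · rw [ht, exceedMass_top, gumbel, gumbel, ← Real.exp_add]
    congr 1; ring
  · rw [exceedMass_of_pos h0 ht]
    congr 1; ring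

lemma H_comm (lam : ℝ≥0∞) (x y : ℝ) : H lam x y = H lam y x := by
  unfold H
  rw [min_comm, mul_comm (gumbel x)]
  split_ifs <;> [rfl; rfl; (congr 1; ring)]

lemma H_nonneg (lam : ℝ≥0∞) (x y : ℝ) : 0 ≤ H lam x y := by
  rw [H_eq_exp]; exact (Real.exp_pos _).le

lemma H_le_gumbel_left (lam : ℝ≥0∞) (x y : ℝ) : H lam x y ≤ gumbel x := by
  rw [H_eq_exp, gumbel]
  have := exceedMass_nonneg lam x y
  exact Real.exp_le_exp.2 (by linarith)

lemma gumbel_mul_gumbel_le_H (lam : ℝ≥0∞) (x y : ℝ) : gumbel x * gumbel y ≤ H lam x y := by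
  rw [H_eq_exp, gumbel, gumbel, ← Real.exp_add]
  have := exceedMass_le lam x y
  exact Real.exp_le_exp.2 (by linarith)

lemma gumbel_le_one (x : ℝ) : gumbel x ≤ 1 := by
  rw [gumbel, Real.exp_le_one_iff]
  exact neg_nonpos.2 (Real.exp_pos _).le

lemma H_le_one (lam : ℝ≥0∞) (x y : ℝ) : H lam x y ≤ 1 :=
  (H_le_gumbel_left lam x y).trans (gumbel_le_one x)

lemma continuous_gumbel : Continuous gumbel := by unfold gumbel; fun_prop

lemma continuous_H (lam : ℝ≥0∞) : Continuous fun p : ℝ × ℝ => H lam p.1 p.2 := by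
  have h1 := continuous_gumbel
  have h2 := continuous_Phi
  unfold H
  split_ifs <;> fun_prop

/-! ### From pointwise to uniform convergence -/

/-- Bivariate Pólya theorem: pointwise convergence of bivariate distribution functions to a
continuous one is uniform. -/
theorem eventually_abs_sub_le_of_monotone {F : ℕ → ℝ → ℝ → ℝ} {G : ℝ → ℝ → ℝ}
    (hmono : ∀ n x x' y y', x ≤ x' → y ≤ y' → F n x y ≤ F n x' y')
    (h0 : ∀ n x y, 0 ≤ F n x y)
    (hclamp : ∀ᶠ n in atTop, ∀ K x y, F n x y ≤ F n (min x K) (min y K) + (1 - F n K K))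
    (hlim : ∀ x y, Tendsto (fun n => F n x y) atTop (𝓝 (G x y)))
    (hG : Continuous fun p : ℝ × ℝ => G p.1 p.2)
    (h1 : Tendsto (fun K => G K K) atTop (𝓝 1))
    (h2 : Tendsto (fun K => G (-K) K) atTop (𝓝 0)) (h3 : Tendsto (fun K => G K (-K)) atTop (𝓝 0))
    {ε : ℝ} (hε : 0 < ε) :
    ∀ᶠ n in atTop, ∀ x y, |F n x y - G x y| ≤ ε := by
  have hGmono : ∀ x x' y y', x ≤ x' → y ≤ y' → G x y ≤ G x' y' := fun x x' y y' hx hy =>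
    le_of_tendsto_of_tendsto' (hlim _ _) (hlim _ _) fun n => hmono n _ _ _ _ hx hy
  have hG0 : ∀ x y, 0 ≤ G x y := fun x y => ge_of_tendsto' (hlim x y) fun n => h0 n x y
  have hGclamp : ∀ K x y, G x y ≤ G (min x K) (min y K) + (1 - G K K) := fun K x y =>
    le_of_tendsto_of_tendsto (hlim _ _) ((hlim _ _).add ((hlim K K).const_sub 1))
      (hclamp.mono fun n h => h K x y)
  obtain ⟨K, hK0, hK1, hK2, hK3⟩ : ∃ K : ℝ, 0 < K ∧ 1 - ε / 4 < G K K ∧ G (-K) K < ε / 4 ∧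
      G K (-K) < ε / 4 :=
    ((eventually_gt_atTop 0).and ((h1.eventually_const_lt (by linarith)).and
      ((h2.eventually_lt_const (by linarith)).and
        (h3.eventually_lt_const (by linarith))))).exists
  -- Near `p`, monotonicity traps `F n` and `G` between their values at two opposite corners of a
  -- small square; convergence is needed only there, and `G` varies little by continuity.
  have hloc : TendstoLocallyUniformlyOn (fun n (p : ℝ × ℝ) => F n p.1 p.2)
      (fun p => G p.1 p.2) atTop (Set.Icc (-K) K ×ˢ Set.Icc (-K) K) := by
    rw [Metric.tendstoLocallyUniformlyOn_iff]
    intro e he p _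
    obtain ⟨η, hη, hη'⟩ := Metric.continuousAt_iff.1 (hG.continuousAt (x := p)) (e / 4) (by linarith)
    have hp1 : |G (p.1 + η / 2) (p.2 + η / 2) - G p.1 p.2| < e / 4 := by
      have := @hη' (p.1 + η / 2, p.2 + η / 2) (by
        rw [Prod.dist_eq, max_lt_iff]
        simp [abs_of_pos hη, hη])
      simpa [Real.dist_eq] using this
    have hp2 : |G (p.1 - η / 2) (p.2 - η / 2) - G p.1 p.2| < e / 4 := by
      have := @hη' (p.1 - η / 2, p.2 - η / 2) (by
        rw [Prod.dist_eq, max_lt_iff]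
        simp [abs_of_pos hη, hη])
      simpa [Real.dist_eq] using this
    refine ⟨Metric.ball p (η / 2), mem_nhdsWithin_of_mem_nhds (Metric.ball_mem_nhds _ (by linarith)),
      ?_⟩
    have ev1 := Metric.tendsto_nhds.1 (hlim (p.1 + η / 2) (p.2 + η / 2)) (e / 4) (by linarith)
    have ev2 := Metric.tendsto_nhds.1 (hlim (p.1 - η / 2) (p.2 - η / 2)) (e / 4) (by linarith)
    filter_upwards [ev1, ev2] with n e1 e2 q hq
    rw [Metric.mem_ball, Prod.dist_eq, max_lt_iff, Real.dist_eq, Real.dist_eq, abs_lt, abs_lt] at hq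
    rw [Real.dist_eq, abs_lt] at e1 e2
    rw [abs_lt] at hp1 hp2
    have m1 := hmono n q.1 (p.1 + η / 2) q.2 (p.2 + η / 2) (by linarith) (by linarith)
    have m2 := hmono n (p.1 - η / 2) q.1 (p.2 - η / 2) q.2 (by linarith) (by linarith)
    have m3 := hGmono q.1 (p.1 + η / 2) q.2 (p.2 + η / 2) (by linarith) (by linarith)
    have m4 := hGmono (p.1 - η / 2) q.1 (p.2 - η / 2) q.2 (by linarith) (by linarith)
    rw [Real.dist_eq, abs_lt]
    constructor <;> linarith
  have hunif := (tendstoLocallyUniformlyOn_iff_tendstoUniformlyOn_of_compact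
    (isCompact_Icc.prod isCompact_Icc)).1 hloc
  have ev0 := Metric.tendstoUniformlyOn_iff.1 hunif (ε / 4) (by linarith)
  have ev1 := (hlim K K).eventually_const_lt hK1
  have ev2 := (hlim (-K) K).eventually_lt_const hK2
  have ev3 := (hlim K (-K)).eventually_lt_const hK3
  filter_upwards [hclamp, ev0, ev1, ev2, ev3] with n hcl e0 e1 e2 e3 x y
  have c1 := hcl K x y
  have c2 := hGclamp K x y
  have c3 := hmono n (min x K) x (min y K) y (min_le_left _ _) (min_le_left _ _)
  have c4 := hGmono (min x K) x (min y K) y (min_le_left _ _) (min_le_left _ _)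
  -- Upper clamping at `K` has been paid for by `hclamp`. If a clamped coordinate lies below `-K`,
  -- both functions lie in `[0, ε / 4]`; otherwise the point is in the compact square.
  have core : |F n (min x K) (min y K) - G (min x K) (min y K)| ≤ ε / 4 := by
    have p1 := h0 n (min x K) (min y K)
    have p2 := hG0 (min x K) (min y K)
    rcases lt_or_ge (min x K) (-K) with hx | hx
    · have q1 := hmono n (min x K) (-K) (min y K) K hx.le (min_le_right _ _)
      have q2 := hGmono (min x K) (-K) (min y K) K hx.le (min_le_right _ _)
      rw [abs_le]; constructor <;> linarith
    rcases lt_or_ge (min y K) (-K) with hy | hy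
    · have q1 := hmono n (min x K) K (min y K) (-K) (min_le_right _ _) hy.le
      have q2 := hGmono (min x K) K (min y K) (-K) (min_le_right _ _) hy.le
      rw [abs_le]; constructor <;> linarith
    have := e0 (min x K, min y K) ⟨⟨hx, min_le_right _ _⟩, ⟨hy, min_le_right _ _⟩⟩
    rw [dist_comm, Real.dist_eq] at this
    exact this.le
  rw [abs_le] at core ⊢
  constructor <;> linarith [core.1, core.2]

/-! ### The mixed limit: continuity and behaviour at infinity -/

/-- The mixed limit distribution function. -/
noncomputable def mixedH {Ω : Type*} [MeasurableSpace Ω] (Q : Measure Ω) (Z W : Ω → ℝ)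
    (lam : ℝ≥0∞) (τ : Fin 2 → Fin 2 → ℝ) (x y : ℝ) : ℝ :=
  ∫ ω, H lam (x + τ 0 0 - √(2 * τ 0 0) * Z ω) (y + τ 1 1 - √(2 * τ 1 1) * W ω) ∂Q

section MixedH

variable {Ω : Type*} [MeasurableSpace Ω] {Q : Measure Ω} {Z W : Ω → ℝ}

lemma aestronglyMeasurable_H (hZ : AEMeasurable Z Q) (hW : AEMeasurable W Q) (lam : ℝ≥0∞)
    (τ : Fin 2 → Fin 2 → ℝ) (x y : ℝ) : AEStronglyMeasurable
    (fun ω => H lam (x + τ 0 0 - √(2 * τ 0 0) * Z ω) (y + τ 1 1 - √(2 * τ 1 1) * W ω)) Q := by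
  have h : AEMeasurable (fun ω => (x + τ 0 0 - √(2 * τ 0 0) * Z ω,
      y + τ 1 1 - √(2 * τ 1 1) * W ω)) Q := by fun_prop
  exact ((continuous_H lam).measurable.comp_aemeasurable h).aestronglyMeasurable

/-- For a fixed outcome the mixture only translates the arguments of `H`, so a limit of `H` along
all translates passes to the mixture by bounded convergence. -/
lemma tendsto_mixedH [IsProbabilityMeasure Q] (hZ : AEMeasurable Z Q) (hW : AEMeasurable W Q) (lam : ℝ≥0∞)
    (τ : Fin 2 → Fin 2 → ℝ)
    {l : Filter ℝ} [l.IsCountablyGenerated] {x y : ℝ → ℝ} {c : ℝ}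
    (h : ∀ s t : ℝ, Tendsto (fun K => H lam (x K + s) (y K + t)) l (𝓝 c)) :
    Tendsto (fun K => mixedH Q Z W lam τ (x K) (y K)) l (𝓝 c) := by
  have : c = ∫ _ : Ω, c ∂Q := by simp
  rw [this]
  refine tendsto_integral_filter_of_dominated_convergence (fun _ => 1)
    (Eventually.of_forall fun K => aestronglyMeasurable_H hZ hW lam τ _ _)
    (Eventually.of_forall fun K => ae_of_all _ fun ω => ?_) (integrable_const _)
    (ae_of_all _ fun ω => ?_)
  · rw [Real.norm_of_nonneg (H_nonneg _ _ _)]; exact H_le_one _ _ _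
  · simpa [add_sub_assoc] using h (τ 0 0 - √(2 * τ 0 0) * Z ω) (τ 1 1 - √(2 * τ 1 1) * W ω)

lemma continuous_mixedH [IsProbabilityMeasure Q] (hZ : AEMeasurable Z Q) (hW : AEMeasurable W Q) (lam : ℝ≥0∞)
    (τ : Fin 2 → Fin 2 → ℝ) :
    Continuous fun p : ℝ × ℝ => mixedH Q Z W lam τ p.1 p.2 := by
  unfold mixedH
  refine continuous_of_dominated (bound := fun _ => 1)
    (fun p => aestronglyMeasurable_H hZ hW lam τ _ _) (fun p => ae_of_all _ fun ω => ?_)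
    (integrable_const _) (ae_of_all _ fun ω => ?_)
  · rw [Real.norm_of_nonneg (H_nonneg _ _ _)]; exact H_le_one _ _ _
  · exact (continuous_H lam).comp (f := fun p : ℝ × ℝ => (p.1 + τ 0 0 - √(2 * τ 0 0) * Z ω,
      p.2 + τ 1 1 - √(2 * τ 1 1) * W ω)) (by fun_prop)

end MixedH

lemma tendsto_gumbel_atTop : Tendsto gumbel atTop (𝓝 1) := by
  have h : Tendsto (fun x : ℝ => Real.exp (-Real.exp (-x))) atTop (𝓝 (Real.exp (-0))) :=
    (Real.continuous_exp.tendsto _).comp Real.tendsto_exp_neg_atTop_nhds_zero.neg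
  simpa [gumbel] using! h

lemma tendsto_gumbel_atBot : Tendsto gumbel atBot (𝓝 0) := by
  have h : Tendsto (fun x : ℝ => Real.exp (-x)) atBot atTop :=
    Real.tendsto_exp_atTop.comp tendsto_neg_atBot_atTop
  exact Real.tendsto_exp_neg_atTop_nhds_zero.comp h

lemma tendsto_H_atTop (lam : ℝ≥0∞) (s t : ℝ) :
    Tendsto (fun K => H lam (K + s) (K + t)) atTop (𝓝 1) := by
  have h1 := tendsto_gumbel_atTop.comp (tendsto_atTop_add_const_right atTop s tendsto_id)
  have h2 := tendsto_gumbel_atTop.comp (tendsto_atTop_add_const_right atTop t tendsto_id)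
  have h3 := h1.mul h2
  rw [one_mul] at h3
  exact tendsto_of_tendsto_of_tendsto_of_le_of_le h3 tendsto_const_nhds
    (fun K => gumbel_mul_gumbel_le_H _ _ _) fun K => H_le_one _ _ _

lemma tendsto_H_left (lam : ℝ≥0∞) (s t : ℝ) :
    Tendsto (fun K => H lam (-K + s) (K + t)) atTop (𝓝 0) := by
  have h1 := tendsto_gumbel_atBot.comp
    (tendsto_atBot_add_const_right atTop s tendsto_neg_atTop_atBot)
  exact squeeze_zero (fun K => H_nonneg _ _ _) (fun K => H_le_gumbel_left _ _ _) h1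

lemma tendsto_H_right (lam : ℝ≥0∞) (s t : ℝ) :
    Tendsto (fun K => H lam (K + s) (-K + t)) atTop (𝓝 0) := by
  simp_rw [H_comm lam (_ + s)]
  exact tendsto_H_left lam t s

/-! ### The one-factor comparison model -/

lemma covariance_prod {α β : Type*} [MeasurableSpace α] [MeasurableSpace β] {μ : Measure α}
    {ν : Measure β} [IsProbabilityMeasure μ] [IsProbabilityMeasure ν] {f f' : α → ℝ} {g g' : β → ℝ}
    (hf : MemLp f 2 μ) (hf' : MemLp f' 2 μ) (hg : MemLp g 2 ν) (hg' : MemLp g' 2 ν) :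
    cov[fun z : α × β => f z.1 + g z.2, fun z : α × β => f' z.1 + g' z.2; μ.prod ν]
      = cov[f, f'; μ] + cov[g, g'; ν] := by
  have hF : MemLp (fun z : α × β => f z.1) 2 (μ.prod ν) := hf.comp_fst ν
  have hF' : MemLp (fun z : α × β => f' z.1) 2 (μ.prod ν) := hf'.comp_fst ν
  have hG : MemLp (fun z : α × β => g z.2) 2 (μ.prod ν) := hg.comp_snd μ
  have hG' : MemLp (fun z : α × β => g' z.2) 2 (μ.prod ν) := hg'.comp_snd μ
  have h1 : (fun z : α × β => f z.1 + g z.2) = (fun z => f z.1) + fun z => g z.2 := rfl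
  have h2 : (fun z : α × β => f' z.1 + g' z.2) = (fun z => f' z.1) + fun z => g' z.2 := rfl
  have hm1 : Measure.map Prod.fst (μ.prod ν) = μ := by simp
  have hm2 : Measure.map Prod.snd (μ.prod ν) = ν := by simp
  have e1 : cov[fun z : α × β => f z.1, fun z => f' z.1; μ.prod ν] = cov[f, f'; μ] := by
    conv_rhs => rw [← hm1]
    rw [covariance_map_fun (by rw [hm1]; exact hf.1) (by rw [hm1]; exact hf'.1)
      measurable_fst.aemeasurable]
  have e2 : cov[fun z : α × β => g z.2, fun z => g' z.2; μ.prod ν] = cov[g, g'; ν] := by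
    conv_rhs => rw [← hm2]
    rw [covariance_map_fun (by rw [hm2]; exact hg.1) (by rw [hm2]; exact hg'.1)
      measurable_snd.aemeasurable]
  have e3 : cov[fun z : α × β => f z.1, fun z => g' z.2; μ.prod ν] = 0 :=
    (indepFun_prod₀ hf.1.aemeasurable hg'.1.aemeasurable).covariance_eq_zero hF hG'
  have e4 : cov[fun z : α × β => g z.2, fun z => f' z.1; μ.prod ν] = 0 := by
    rw [covariance_comm]
    exact (indepFun_prod₀ hf'.1.aemeasurable hg.1.aemeasurable).covariance_eq_zero hF' hG
  rw [h1, h2, covariance_add_left hF hG (hF'.add hG'), covariance_add_right hF hF' hG',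
    covariance_add_right hG hF' hG', e1, e2, e3, e4]
  ring

section Model

variable {K : Type*} [Fintype K]

/-- The contribution of the common factor `z`, with weights `α i`. -/
noncomputable def commonPart (α : Fin 2 → ℝ) (z : ℝ × ℝ) : Fin 2 → ℝ :=
  ![√(α 0) * z.1, √(α 1) * z.2]

/-- The contribution of the local noise `e`, with correlation `r`. -/
noncomputable def noisePart (α : Fin 2 → ℝ) (r : ℝ) (e : ℝ × ℝ) : Fin 2 → ℝ :=
  ![√(1 - α 0) * (r * e.1 + √(1 - r ^ 2) * e.2), √(1 - α 1) * e.1]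

/-- The one-factor model: a common factor plus local noise. -/
noncomputable def factorModel (α : Fin 2 → ℝ) (r : ℝ) (z e : ℝ × ℝ) (i : Fin 2) : ℝ :=
  commonPart α z i + noisePart α r e i

/-- The law of the common factor and of the independent local noises. -/
noncomputable def factorLaw (K : Type*) [Fintype K] (ν : Measure (ℝ × ℝ)) :
    Measure ((ℝ × ℝ) × (K → ℝ × ℝ)) :=
  ν.prod (Measure.pi fun _ => (gaussianReal 0 1).prod (gaussianReal 0 1))

variable {ν : Measure (ℝ × ℝ)} {α : Fin 2 → ℝ} {r : ℝ}

lemma isGaussian_factorLaw [IsGaussian ν] : IsGaussian (factorLaw K ν) := by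
  have hpi : HasGaussianLaw (fun e : K → ℝ × ℝ => fun k => e k)
      (Measure.pi fun _ : K => (gaussianReal 0 1).prod (gaussianReal 0 1)) := by
    refine iIndepFun.hasGaussianLaw (X := fun (k : K) (e : K → ℝ × ℝ) => e k) (fun k => ⟨?_⟩)
      (iIndepFun_pi (X := fun _ x => x) fun k => aemeasurable_id)
    rw [(measurePreserving_eval _ k).map_eq]
    infer_instance
  have : IsGaussian (Measure.pi fun _ : K => (gaussianReal 0 1).prod (gaussianReal 0 1)) := by
    simpa using hpi.isGaussian_map
  unfold factorLaw
  infer_instance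

lemma hasGaussianLaw_factorModel [IsGaussian ν] :
    HasGaussianLaw (fun (z : (ℝ × ℝ) × (K → ℝ × ℝ)) (p : K × Fin 2) =>
      factorModel α r z.1 (z.2 p.1) p.2) (factorLaw K ν) := by
  have := isGaussian_factorLaw (K := K) (ν := ν)
  let T : ((ℝ × ℝ) × (K → ℝ × ℝ)) →ₗ[ℝ] (K × Fin 2 → ℝ) :=
    { toFun := fun z p => factorModel α r z.1 (z.2 p.1) p.2
      map_add' := by
        intro z z'
        ext ⟨k, i⟩
        fin_cases i <;> simp [factorModel, commonPart, noisePart] <;> ring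
      map_smul' := by
        intro c z
        ext ⟨k, i⟩
        fin_cases i <;> simp [factorModel, commonPart, noisePart] <;> ring }
  exact (IsGaussian.hasGaussianLaw_id (μ := factorLaw K ν)).map_fun (LinearMap.toContinuousLinearMap T)

lemma integral_factorLaw [IsProbabilityMeasure ν] {f g : ℝ × ℝ → ℝ} (hf : Integrable f ν)
    (hg : Integrable g ((gaussianReal 0 1).prod (gaussianReal 0 1))) (k : K) :
    ∫ z, (f z.1 + g (z.2 k)) ∂(factorLaw K ν)
      = ∫ z, f z ∂ν + ∫ e, g e ∂((gaussianReal 0 1).prod (gaussianReal 0 1)) := by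
  have hk := measurePreserving_eval
    (fun _ : K => (gaussianReal 0 1).prod (gaussianReal 0 1)) k
  have hg' : Integrable (fun e : K → ℝ × ℝ => g (e k))
      (Measure.pi fun _ : K => (gaussianReal 0 1).prod (gaussianReal 0 1)) :=
    hk.integrable_comp_of_integrable hg
  have e1 : ∫ e : K → ℝ × ℝ, g (e k)
      ∂(Measure.pi fun _ : K => (gaussianReal 0 1).prod (gaussianReal 0 1))
      = ∫ e, g e ∂((gaussianReal 0 1).prod (gaussianReal 0 1)) := by
    conv_rhs => rw [← hk.map_eq]
    rw [integral_map hk.measurable.aemeasurable (by rw [hk.map_eq]; exact hg.1)]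
  unfold factorLaw
  rw [integral_add (hf.comp_fst _) (hg'.comp_snd _), integral_fun_fst, integral_fun_snd
    (f := fun e : K → ℝ × ℝ => g (e k)), e1]
  simp

/-- The noises at different places are independent of each other and of the factor, so across places
only the common part is correlated. -/
lemma covariance_factorLaw [IsProbabilityMeasure ν] [DecidableEq K] {f f' g g' : ℝ × ℝ → ℝ}
    (hf : MemLp f 2 ν) (hf' : MemLp f' 2 ν)
    (hg : MemLp g 2 ((gaussianReal 0 1).prod (gaussianReal 0 1)))
    (hg' : MemLp g' 2 ((gaussianReal 0 1).prod (gaussianReal 0 1))) (k l : K) :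
    cov[fun z => f z.1 + g (z.2 k), fun z => f' z.1 + g' (z.2 l); factorLaw K ν]
      = cov[f, f'; ν] +
        if k = l then cov[g, g'; (gaussianReal 0 1).prod (gaussianReal 0 1)] else 0 := by
  have hk : ∀ k : K, MeasurePreserving (fun e : K → ℝ × ℝ => e k) (Measure.pi fun _ : K =>
      (gaussianReal 0 1).prod (gaussianReal 0 1)) ((gaussianReal 0 1).prod (gaussianReal 0 1)) :=
    fun k => measurePreserving_eval
      (fun _ : K => (gaussianReal 0 1).prod (gaussianReal 0 1)) k
  have hgk := hg.comp_measurePreserving (hk k)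
  have hgl := hg'.comp_measurePreserving (hk l)
  rw [factorLaw, covariance_prod hf hf' (g := fun e : K → ℝ × ℝ => g (e k))
    (g' := fun e : K → ℝ × ℝ => g' (e l)) hgk hgl]
  congr 1
  split_ifs with h
  · subst h
    conv_rhs => rw [← (hk k).map_eq]
    rw [covariance_map_fun (by rw [(hk k).map_eq]; exact hg.1)
      (by rw [(hk k).map_eq]; exact hg'.1) (hk k).measurable.aemeasurable]
  · have hi := (iIndepFun_pi (μ := fun _ : K => (gaussianReal 0 1).prod (gaussianReal 0 1))
      (X := fun _ x => x) (fun k => aemeasurable_id)).indepFun h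
    have hi2 : IndepFun (fun e : K → ℝ × ℝ => g (e k)) (fun e : K → ℝ × ℝ => g' (e l))
        (Measure.pi fun _ : K => (gaussianReal 0 1).prod (gaussianReal 0 1)) :=
      hi.comp₀ (φ := g) (ψ := g') (hk k).measurable.aemeasurable (hk l).measurable.aemeasurable
        (by rw [(hk k).map_eq]; exact hg.1.aemeasurable)
        (by rw [(hk l).map_eq]; exact hg'.1.aemeasurable)
    exact hi2.covariance_eq_zero hgk hgl

lemma memLp_commonPart [IsGaussian ν] (i : Fin 2) : MemLp (fun z => commonPart α z i) 2 ν := by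
  have h := IsGaussian.hasGaussianLaw_id (μ := ν)
  have h1 : MemLp (fun z : ℝ × ℝ => z.1) 2 ν := (HasGaussianLaw.fst (Y := fun z => z.2) h).memLp_two
  have h2 : MemLp (fun z : ℝ × ℝ => z.2) 2 ν := (HasGaussianLaw.snd (X := fun z => z.1) h).memLp_two
  fin_cases i
  · exact h1.const_mul _
  · exact h2.const_mul _

lemma memLp_fst_gaussian :
    MemLp (fun z : ℝ × ℝ => z.1) 2 ((gaussianReal 0 1).prod (gaussianReal 0 1)) :=
  (HasGaussianLaw.fst (Y := fun z => z.2) IsGaussian.hasGaussianLaw_id).memLp_two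

lemma memLp_snd_gaussian :
    MemLp (fun z : ℝ × ℝ => z.2) 2 ((gaussianReal 0 1).prod (gaussianReal 0 1)) :=
  (HasGaussianLaw.snd (X := fun z => z.1) IsGaussian.hasGaussianLaw_id).memLp_two

lemma memLp_noisePart (i : Fin 2) :
    MemLp (fun e => noisePart α r e i) 2 ((gaussianReal 0 1).prod (gaussianReal 0 1)) := by
  fin_cases i
  · exact ((memLp_fst_gaussian.const_mul _).add (memLp_snd_gaussian.const_mul _)).const_mul _
  · exact memLp_fst_gaussian.const_mul _

lemma integral_noisePart (i : Fin 2) :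
    ∫ e, noisePart α r e i ∂((gaussianReal 0 1).prod (gaussianReal 0 1)) = 0 := by
  have h1 : ∫ e : ℝ × ℝ, e.1 ∂((gaussianReal 0 1).prod (gaussianReal 0 1)) = 0 := by
    rw [integral_fun_fst (fun x : ℝ => x)]; simp
  have h2 : ∫ e : ℝ × ℝ, e.2 ∂((gaussianReal 0 1).prod (gaussianReal 0 1)) = 0 := by
    rw [integral_fun_snd (fun x : ℝ => x)]; simp
  have i1 := memLp_fst_gaussian.integrable one_le_two
  have i2 := memLp_snd_gaussian.integrable one_le_two
  fin_cases i
  · change ∫ e : ℝ × ℝ, √(1 - α 0) * (r * e.1 + √(1 - r ^ 2) * e.2) ∂_ = 0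
    rw [integral_const_mul, integral_add (i1.const_mul _) (i2.const_mul _), integral_const_mul,
      integral_const_mul, h1, h2]
    simp
  · change ∫ e : ℝ × ℝ, √(1 - α 1) * e.1 ∂_ = 0
    rw [integral_const_mul, h1, mul_zero]

lemma covariance_gaussian_linear (p q p' q' : ℝ) :
    cov[fun e : ℝ × ℝ => p * e.1 + q * e.2, fun e : ℝ × ℝ => p' * e.1 + q' * e.2;
      (gaussianReal 0 1).prod (gaussianReal 0 1)] = p * p' + q * q' := by
  have hid : MemLp (fun x : ℝ => x) 2 (gaussianReal 0 1) :=
    (IsGaussian.hasGaussianLaw_id (μ := gaussianReal 0 1)).memLp_two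
  have hc : cov[fun x : ℝ => x, fun x : ℝ => x; gaussianReal 0 1] = 1 := by
    rw [covariance_self measurable_id'.aemeasurable]; simp
  rw [covariance_prod (f := fun x => p * x) (g := fun x => q * x) (f' := fun x => p' * x)
    (g' := fun x => q' * x) (hid.const_mul _) (hid.const_mul _) (hid.const_mul _)
    (hid.const_mul _)]
  have key : ∀ c c' : ℝ, cov[fun x : ℝ => c * x, fun x : ℝ => c' * x; gaussianReal 0 1] = c * c' := by
    intro c c'
    rw [covariance_const_mul_left (X := fun x : ℝ => x),
      covariance_const_mul_right (Y := fun x : ℝ => x), hc, mul_one]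
  rw [key, key]

/-- Covariances of the local noise. -/
lemma covariance_noisePart (h0 : α 0 ≤ 1) (h1 : α 1 ≤ 1) (hr : |r| ≤ 1) (i j : Fin 2) :
    cov[fun e => noisePart α r e i, fun e => noisePart α r e j;
      (gaussianReal 0 1).prod (gaussianReal 0 1)]
      = if i = j then 1 - α i else √(1 - α 0) * √(1 - α 1) * r := by
  have e0 : (fun e => noisePart α r e 0)
      = fun e : ℝ × ℝ => (√(1 - α 0) * r) * e.1 + (√(1 - α 0) * √(1 - r ^ 2)) * e.2 := by
    ext e; simp [noisePart]; ring
  have e1 : (fun e => noisePart α r e 1) = fun e : ℝ × ℝ => √(1 - α 1) * e.1 + 0 * e.2 := by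
    ext e; simp [noisePart]
  have hr2 : r ^ 2 ≤ 1 := by rw [← sq_abs]; exact pow_le_one₀ (abs_nonneg _) hr
  have s0 : √(1 - α 0) ^ 2 = 1 - α 0 := Real.sq_sqrt (by linarith)
  have s1 : √(1 - α 1) ^ 2 = 1 - α 1 := Real.sq_sqrt (by linarith)
  have s2 : √(1 - r ^ 2) ^ 2 = 1 - r ^ 2 := Real.sq_sqrt (by linarith)
  fin_cases i <;> fin_cases j <;>
    simp only [Fin.zero_eta, Fin.mk_one, Fin.isValue, e0, e1, covariance_gaussian_linear, if_true]
  · linear_combination s0 + √(1 - α 0) ^ 2 * s2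
  · simp; ring
  · simp; ring
  · linear_combination s1

/-- Covariances of the common part. -/
lemma covariance_commonPart [IsProbabilityMeasure ν] {c : ℝ} (v0 : Var[fun z : ℝ × ℝ => z.1; ν] = 1)
    (v1 : Var[fun z : ℝ × ℝ => z.2; ν] = 1)
    (hc : cov[fun z : ℝ × ℝ => z.1, fun z : ℝ × ℝ => z.2; ν] = c)
    (h0 : 0 ≤ α 0) (h1 : 0 ≤ α 1) (i j : Fin 2) :
    cov[fun z => commonPart α z i, fun z => commonPart α z j; ν]
      = if i = j then α i else √(α 0) * √(α 1) * c := by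
  have e0 : (fun z => commonPart α z 0) = fun z : ℝ × ℝ => √(α 0) * z.1 := rfl
  have e1 : (fun z => commonPart α z 1) = fun z : ℝ × ℝ => √(α 1) * z.2 := rfl
  have s0 : √(α 0) ^ 2 = α 0 := Real.sq_sqrt h0
  have s1 : √(α 1) ^ 2 = α 1 := Real.sq_sqrt h1
  have c0 : cov[fun z : ℝ × ℝ => z.1, fun z : ℝ × ℝ => z.1; ν] = 1 := by
    rw [covariance_self measurable_fst.aemeasurable, v0]
  have c1 : cov[fun z : ℝ × ℝ => z.2, fun z : ℝ × ℝ => z.2; ν] = 1 := by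
    rw [covariance_self measurable_snd.aemeasurable, v1]
  have hc' : cov[fun z : ℝ × ℝ => z.2, fun z : ℝ × ℝ => z.1; ν] = c := by
    rw [covariance_comm, hc]
  fin_cases i <;> fin_cases j <;>
    simp only [Fin.zero_eta, Fin.mk_one, e0, e1, covariance_const_mul_left,
      covariance_const_mul_right, c0, c1, hc, hc', if_true]
  · linear_combination s0
  · simp; ring
  · simp; ring
  · linear_combination s1

theorem covariance_factorModel [IsGaussian ν] [DecidableEq K] {c : ℝ}
    (v0 : Var[fun z : ℝ × ℝ => z.1; ν] = 1) (v1 : Var[fun z : ℝ × ℝ => z.2; ν] = 1)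
    (hc : cov[fun z : ℝ × ℝ => z.1, fun z : ℝ × ℝ => z.2; ν] = c)
    (h0 : 0 ≤ α 0) (h1 : 0 ≤ α 1) (h0' : α 0 ≤ 1) (h1' : α 1 ≤ 1) (hr : |r| ≤ 1)
    (k l : K) (i j : Fin 2) :
    cov[fun z => factorModel α r z.1 (z.2 k) i, fun z => factorModel α r z.1 (z.2 l) j;
      factorLaw K ν]
      = (if i = j then α i else √(α 0) * √(α 1) * c) +
        if k = l then (if i = j then 1 - α i else √(1 - α 0) * √(1 - α 1) * r) else 0 := by
  rw [← covariance_noisePart h0' h1' hr, ← covariance_commonPart v0 v1 hc h0 h1]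
  exact covariance_factorLaw (memLp_commonPart i) (memLp_commonPart j) (memLp_noisePart i)
    (memLp_noisePart j) k l

theorem integral_factorModel [IsGaussian ν] (m0 : ∫ z, z.1 ∂ν = 0) (m1 : ∫ z, z.2 ∂ν = 0)
    (k : K) (i : Fin 2) :
    ∫ z, factorModel α r z.1 (z.2 k) i ∂(factorLaw K ν) = 0 := by
  have := integral_factorLaw (ν := ν) ((memLp_commonPart (α := α) i).integrable one_le_two)
    ((memLp_noisePart (α := α) (r := r) i).integrable one_le_two) k
  refine this.trans ?_
  rw [integral_noisePart, add_zero]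
  fin_cases i
  · exact (integral_const_mul _ _).trans (by rw [m0, mul_zero])
  · exact (integral_const_mul _ _).trans (by rw [m1, mul_zero])

/-- Distribution function of the one-factor model, conditionally on the common factor. -/
theorem measureReal_factorModel_le [IsProbabilityMeasure ν] (v : Fin 2 → ℝ) :
    (factorLaw K ν).real {z | ∀ p : K × Fin 2, factorModel α r z.1 (z.2 p.1) p.2 ≤ v p.2}
      = ∫ z, ((gaussianReal 0 1).prod (gaussianReal 0 1)).real
          {e | factorModel α r z e 0 ≤ v 0 ∧ factorModel α r z e 1 ≤ v 1} ^ Fintype.card K ∂ν := by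
  have hm : ∀ (p : K × Fin 2), Measurable fun z : (ℝ × ℝ) × (K → ℝ × ℝ) =>
      factorModel α r z.1 (z.2 p.1) p.2 := by
    rintro ⟨k, i⟩
    fin_cases i <;> simp only [factorModel, commonPart, noisePart] <;> simp <;> fun_prop
  have hS : MeasurableSet {z : (ℝ × ℝ) × (K → ℝ × ℝ) |
      ∀ p : K × Fin 2, factorModel α r z.1 (z.2 p.1) p.2 ≤ v p.2} := by
    simp only [Set.ofPred_forall]
    exact MeasurableSet.iInter fun p => measurableSet_le (hm p) measurable_const
  rw [← integral_indicator_one hS, factorLaw, integral_prod]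
  · congr 1 with z
    have hsec : ∀ e : K → ℝ × ℝ, Set.indicator {z : (ℝ × ℝ) × (K → ℝ × ℝ) |
        ∀ p : K × Fin 2, factorModel α r z.1 (z.2 p.1) p.2 ≤ v p.2} (1 : (ℝ × ℝ) × (K → ℝ × ℝ) → ℝ) (z, e)
        = (Set.univ.pi fun _ : K =>
          {e | factorModel α r z e 0 ≤ v 0 ∧ factorModel α r z e 1 ≤ v 1}).indicator 1 e := by
      intro e
      have hiff : (∀ p : K × Fin 2, factorModel α r z (e p.1) p.2 ≤ v p.2) ↔
          e ∈ Set.univ.pi fun _ : K =>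
            {e | factorModel α r z e 0 ≤ v 0 ∧ factorModel α r z e 1 ≤ v 1} := by
        constructor
        · exact fun h k _ => ⟨h (k, 0), h (k, 1)⟩
        · rintro h ⟨k, i⟩
          fin_cases i
          · exact (h k (Set.mem_univ _)).1
          · exact (h k (Set.mem_univ _)).2
      by_cases h : ∀ p : K × Fin 2, factorModel α r z (e p.1) p.2 ≤ v p.2
      · rw [Set.indicator_of_mem (by exact h), Set.indicator_of_mem (hiff.1 h)]; rfl
      · rw [Set.indicator_of_notMem (by exact h),
          Set.indicator_of_notMem fun h' => h (hiff.2 h')]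
    have hm' : ∀ i, Measurable fun e : ℝ × ℝ => factorModel α r z e i := by
      intro i
      fin_cases i <;> simp only [factorModel, commonPart, noisePart] <;> simp <;> fun_prop
    simp_rw [hsec]
    rw [integral_indicator_one, measureReal_def, Measure.pi_pi]
    · simp [measureReal_def]
    · refine MeasurableSet.univ_pi fun _ => ?_
      exact (measurableSet_le (hm' 0) measurable_const).inter
        (measurableSet_le (hm' 1) measurable_const)
  · refine Integrable.of_bound (measurable_one.indicator hS).aestronglyMeasurable 1
      (ae_of_all _ fun z => ?_)
    exact (norm_indicator_le_norm_self _ _).trans (by simp)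

end Model

/-! ### The limit law of the model -/

lemma tendsto_div_log (c : ℝ) : Tendsto (fun n : ℕ => c / Real.log n) atTop (𝓝 0) :=
  tendsto_const_nhds.div_atTop tendsto_log_natCast

lemma tendsto_sqrt_one_sub_div_log (c : ℝ) :
    Tendsto (fun n : ℕ => √(1 - c / Real.log n)) atTop (𝓝 1) := by
  have h := (Real.continuous_sqrt.tendsto _).comp ((tendsto_div_log c).const_sub 1)
  simpa using! h

/-- Source of the shift in the mixture. With `q = √(1 - c / log n)`, the factor contributes `√(c /
log n) z / a = √(2c) z`. Dividing `b` by `q` adds `2 a b · log n (1 - q) / q`, which tends to `c`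
because `log n (1 - q) = c / (1 + q)`. -/
lemma tendsto_shifted_level (c x z : ℝ) :
    Tendsto (fun n : ℕ => ((u n x - √(c / Real.log n) * z) / √(1 - c / Real.log n) - b n) / a n)
      atTop (𝓝 (x + c - √(2 * c) * z)) := by
  have hq := tendsto_sqrt_one_sub_div_log c
  have h1 : Tendsto (fun n : ℕ => x / √(1 - c / Real.log n) - √(2 * c) * z / √(1 - c / Real.log n)
      + 2 * (a n * b n) * (c / (√(1 - c / Real.log n) * (1 + √(1 - c / Real.log n))))) atTop
      (𝓝 (x / 1 - √(2 * c) * z / 1 + 2 * 1 * (c / (1 * (1 + 1))))) := by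
    refine ((tendsto_const_nhds.div hq one_ne_zero).sub
      (tendsto_const_nhds.div hq one_ne_zero)).add
      ((tendsto_a_mul_b.const_mul 2).mul ?_)
    exact tendsto_const_nhds.div (hq.mul (hq.const_add 1)) (by norm_num)
  have e : x / 1 - √(2 * c) * z / 1 + 2 * 1 * (c / (1 * (1 + 1))) = x + c - √(2 * c) * z := by ring
  rw [e] at h1
  refine h1.congr' ?_
  filter_upwards [eventually_ge_atTop 2, tendsto_log_natCast.eventually_gt_atTop c] with n hn hLc
  have hL := log_natCast_pos hn
  have ha := a_pos hn
  have ha2 := a_sq_mul hn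
  have hpos : 0 < 1 - c / Real.log n := by rw [sub_pos, div_lt_one hL]; exact hLc
  set q := √(1 - c / Real.log n) with hqdef
  have hq0 : 0 < q := Real.sqrt_pos.2 hpos
  have hq2 : Real.log n * (1 - q ^ 2) = c := by
    rw [hqdef, Real.sq_sqrt hpos.le]; field_simp; ring
  have hs : √(c / Real.log n) = a n * √(2 * c) := by
    have : c / Real.log n = a n ^ 2 * (2 * c) := by
      rw [div_eq_iff hL.ne']
      linear_combination (-c) * ha2
    rw [this, Real.sqrt_mul (by positivity), Real.sqrt_sq ha.le]
  have h2 : c / (q * (1 + q)) = Real.log n * (1 - q) / q := by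
    rw [div_eq_div_iff (by positivity) hq0.ne', ← hq2]; ring
  rw [hs, h2, u]
  field_simp
  linear_combination (b n * (1 - q)) * ha2

lemma add_mul_le_iff {q s x t : ℝ} (hq : 0 < q) (n : ℕ) (hn : 2 ≤ n) (e : ℝ) :
    s * t + q * e ≤ x ↔ e ≤ u n (((x - s * t) / q - b n) / a n) := by
  have ha := (a_pos hn).ne'
  have : u n (((x - s * t) / q - b n) / a n) = (x - s * t) / q := by
    rw [u]; field_simp; ring
  rw [this, le_div_iff₀ hq]
  constructor <;> intro h <;> linarith

/-- For fixed `z` the integrand is the `n`-th power of a probability `1 - κ n`, where `n κ n` tends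
to the exponent of `H` at the shifted levels; hence `(1 - κ n)^n` tends to `H`. The bound `1`
dominates in `z`. -/
theorem tendsto_integral_factorModel {ν : Measure (ℝ × ℝ)} [IsProbabilityMeasure ν]
    (c : Fin 2 → ℝ) {r : ℕ → ℝ} (hr : ∀ n, |r n| ≤ 1) {lam : ℝ≥0∞}
    (hlam : Tendsto (fun n : ℕ => ENNReal.ofReal ((1 - r n) * Real.log n)) atTop (𝓝 (lam ^ 2)))
    (x y : ℝ) :
    Tendsto (fun n : ℕ => ∫ z, ((gaussianReal 0 1).prod (gaussianReal 0 1)).real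
        {e | factorModel (fun i => c i / Real.log n) (r n) z e 0 ≤ u n x ∧
          factorModel (fun i => c i / Real.log n) (r n) z e 1 ≤ u n y} ^ n ∂ν) atTop
      (𝓝 (∫ z, H lam (x + c 0 - √(2 * c 0) * z.1) (y + c 1 - √(2 * c 1) * z.2) ∂ν)) := by
  refine tendsto_integral_filter_of_dominated_convergence (fun _ => 1) ?_ ?_ (integrable_const _) ?_
  · refine Eventually.of_forall fun n => Measurable.aestronglyMeasurable (Measurable.pow_const ?_ n)
    have hm : ∀ i : Fin 2, Measurable fun p : (ℝ × ℝ) × (ℝ × ℝ) =>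
        factorModel (fun i => c i / Real.log n) (r n) p.1 p.2 i := by
      intro i
      fin_cases i <;> simp only [factorModel, commonPart, noisePart] <;> simp <;> fun_prop
    have hS : MeasurableSet {p : (ℝ × ℝ) × (ℝ × ℝ) |
        factorModel (fun i => c i / Real.log n) (r n) p.1 p.2 0 ≤ u n x ∧
          factorModel (fun i => c i / Real.log n) (r n) p.1 p.2 1 ≤ u n y} :=
      (measurableSet_le (hm 0) measurable_const).inter (measurableSet_le (hm 1) measurable_const)
    exact (measurable_measure_prodMk_left hS).ennreal_toReal
  · refine Eventually.of_forall fun n => ae_of_all _ fun z => ?_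
    rw [Real.norm_of_nonneg (by positivity)]
    exact pow_le_one₀ measureReal_nonneg measureReal_le_one
  · refine ae_of_all _ fun z => ?_
    have hx := tendsto_shifted_level (c 0) x z.1
    have hy := tendsto_shifted_level (c 1) y z.2
    have key := tendsto_natCast_mul_one_sub hr hlam hx hy
    rw [H_eq_exp]
    set G : ℕ → ℝ := fun n => ((gaussianReal 0 1).prod (gaussianReal 0 1)).real
        {e | factorModel (fun i => c i / Real.log n) (r n) z e 0 ≤ u n x ∧
          factorModel (fun i => c i / Real.log n) (r n) z e 1 ≤ u n y} with hG
    have hT : Tendsto (fun n : ℕ => n * (G n - 1)) atTop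
        (𝓝 (-(Real.exp (-(x + c 0 - √(2 * c 0) * z.1)) +
          exceedMass lam (x + c 0 - √(2 * c 0) * z.1) (y + c 1 - √(2 * c 1) * z.2)))) := by
      refine key.neg.congr' ?_
      filter_upwards [eventually_ge_atTop 2, tendsto_log_natCast.eventually_gt_atTop (c 0),
        tendsto_log_natCast.eventually_gt_atTop (c 1)] with n hn h0 h1
      have hL := log_natCast_pos hn
      have q0 : 0 < √(1 - c 0 / Real.log n) :=
        Real.sqrt_pos.2 (by rw [sub_pos, div_lt_one hL]; exact h0)
      have q1 : 0 < √(1 - c 1 / Real.log n) :=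
        Real.sqrt_pos.2 (by rw [sub_pos, div_lt_one hL]; exact h1)
      have hset : {e | factorModel (fun i => c i / Real.log n) (r n) z e 0 ≤ u n x ∧
          factorModel (fun i => c i / Real.log n) (r n) z e 1 ≤ u n y}
          = {e : ℝ × ℝ | r n * e.1 + √(1 - r n ^ 2) * e.2 ≤
              u n (((u n x - √(c 0 / Real.log n) * z.1) / √(1 - c 0 / Real.log n) - b n) / a n) ∧
            e.1 ≤ u n (((u n y - √(c 1 / Real.log n) * z.2) / √(1 - c 1 / Real.log n) - b n)
              / a n)} := by
        ext e
        exact and_congr (add_mul_le_iff q0 n hn _) (add_mul_le_iff q1 n hn _)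
      simp only [hG, hset]
      ring
    refine (Real.tendsto_one_add_pow_exp_of_tendsto hT).congr fun n => ?_
    rw [add_sub_cancel]

/-! ### Comparison error from pairs of different vectors -/

/-- The sum equals `log (n ^ n / n!)`, and `n ^ n / n!` is one term of the series of `exp n`. Thus
replacing `log m` by `log n` costs `O(1)` on average over lags. -/
lemma sum_log_sub_log_le {n : ℕ} (hn : 2 ≤ n) :
    ∑ m ∈ Finset.Ico 1 n, (Real.log n - Real.log m) ≤ n := by
  have hn0 : (0 : ℝ) < n := by positivity
  have h1 : ∑ m ∈ Finset.Ico 1 n, (Real.log n - Real.log m)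
      = ∑ m ∈ Finset.Ico 1 (n + 1), (Real.log n - Real.log m) := by
    rw [Finset.sum_Ico_succ_top (by omega), sub_self, add_zero]
  have h2 : ∀ k : ℕ, ∑ m ∈ Finset.Ico 1 (k + 1), Real.log m = Real.log (k.factorial : ℝ) := by
    intro k
    induction k with
    | zero => simp
    | succ k ih =>
      rw [Finset.sum_Ico_succ_top (by omega), ih, Nat.factorial_succ, Nat.cast_mul,
        Real.log_mul (by positivity) (by positivity)]
      ring
  rw [h1, Finset.sum_sub_distrib, h2]
  have h3 := Real.pow_div_factorial_le_exp (n : ℝ) hn0.le n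
  have h4 := Real.log_le_log (by positivity) h3
  rw [Real.log_exp, Real.log_div (by positivity) (by positivity), Real.log_pow] at h4
  simpa using h4

lemma sum_Ico_ite_le {n M : ℕ} {A : ℝ} (hA : 0 ≤ A) :
    ∑ m ∈ Finset.Ico 1 n, (if m < M then A else 0) ≤ M * A := by
  rw [← Finset.sum_filter, Finset.sum_const, nsmul_eq_mul]
  refine mul_le_mul_of_nonneg_right ?_ hA
  have : Finset.filter (fun m => m < M) (Finset.Ico 1 n) ⊆ Finset.range M := by
    intro m hm
    rw [Finset.mem_filter] at hm
    exact Finset.mem_range.2 hm.2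
  have := Finset.card_le_card this
  rw [Finset.card_range] at this
  exact_mod_cast this

/-- Halving the exponent absorbs the loss of one in the floor: once `n ^ (ϖ / 2) ≥ 2`, one has `n ^
ϖ - 1 ≥ n ^ (ϖ / 2)`. -/
lemma eventually_log_ge {ϖ : ℝ} (hϖ : 0 < ϖ) :
    ∀ᶠ n : ℕ in atTop, ∀ m : ℕ, ⌊(n : ℝ) ^ ϖ⌋₊ ≤ m → ϖ / 2 * Real.log n ≤ Real.log m := by
  have h1 : Tendsto (fun n : ℕ => (n : ℝ) ^ (ϖ / 2)) atTop atTop :=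
    (tendsto_rpow_atTop (by positivity)).comp tendsto_natCast_atTop_atTop
  filter_upwards [h1.eventually_ge_atTop 2, eventually_ge_atTop 2] with n hn hn2 m hm
  have hn0 : (0 : ℝ) < n := by positivity
  rw [← Real.log_rpow hn0]
  refine Real.log_le_log (by positivity) ?_
  have h2 : (n : ℝ) ^ ϖ = (n : ℝ) ^ (ϖ / 2) * (n : ℝ) ^ (ϖ / 2) := by
    rw [← Real.rpow_add hn0, add_halves]
  have h3 := Nat.lt_floor_add_one ((n : ℝ) ^ ϖ)
  have h4 : ((⌊(n : ℝ) ^ ϖ⌋₊ : ℕ) : ℝ) ≤ m := by exact_mod_cast hm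
  nlinarith

/-- As `u² ~ 2 log n`, the expression is `n` to a power tending to `1 + ϖ - 2 / (1 + δ) < 0`, up to
a constant. It accounts for the `n ^ (1 + ϖ)` pairs at small lag. -/
lemma tendsto_near_bound {δ ϖ : ℝ} (hδ0 : 0 ≤ δ) (hδ : 1 + ϖ < 2 / (1 + δ)) (s C : ℝ) :
    Tendsto (fun n : ℕ => (n : ℝ) ^ ϖ * (n * (C * densityBound δ (u n s)))) atTop (𝓝 0) := by
  have h1 : Tendsto (fun n : ℕ => 1 + ϖ - (u n s) ^ 2 / Real.log n / (1 + δ)) atTop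
      (𝓝 (1 + ϖ - 2 / (1 + δ))) :=
    ((tendsto_u_sq_div_log s).div_const _).const_sub _
  have h2 := (h1.neg_mul_atTop (by linarith) tendsto_log_natCast)
  have h3 := (Real.tendsto_exp_atBot.comp h2).const_mul (C * (2 * Real.pi * √(1 - δ ^ 2))⁻¹)
  rw [mul_zero] at h3
  refine h3.congr' ?_
  filter_upwards [eventually_ge_atTop 2] with n hn
  have hL := log_natCast_pos hn
  have hn0 : (0 : ℝ) < n := by positivity
  simp only [Function.comp]
  have e : (1 + ϖ - (u n s) ^ 2 / Real.log n / (1 + δ)) * Real.log n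
      = Real.log n + Real.log n * ϖ + -(u n s) ^ 2 / (1 + δ) := by
    field_simp
    ring
  rw [e, Real.exp_add, Real.exp_add, Real.exp_log hn0, ← Real.rpow_def_of_pos hn0, densityBound]
  ring

/-- A correlation `R = C / log n` changes the exponent `-u²` by at most `u² R ≤ 3C`, so the density
stays of order `exp (-u²) = O(log n / n²)`, as under independence. -/
lemma eventually_far_densityBound_le {C : ℝ} (hC : 0 ≤ C) (s : ℝ) :
    ∃ B : ℝ, 0 < B ∧ ∀ᶠ n : ℕ in atTop, 0 < Real.log n ∧ C / Real.log n < 1 ∧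
      n * densityBound (C / Real.log n) (u n s) ≤ B * (Real.log n / n) := by
  obtain ⟨D, hD, hev⟩ := exists_natCast_mul_exp_le s
  refine ⟨D ^ 2 * Real.exp (3 * C), by positivity, ?_⟩
  have h3 := (tendsto_u_sq_div_log s).eventually_lt_const (by norm_num : (2 : ℝ) < 3)
  have h4 := (tendsto_div_log C).eventually_lt_const (by norm_num : (0 : ℝ) < 1 / 2)
  filter_upwards [hev, h3, h4, eventually_ge_atTop 2] with n h1 h3 h4 hn
  have hL := log_natCast_pos hn
  have hn0 : (0 : ℝ) < n := by positivity
  refine ⟨hL, by linarith, ?_⟩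
  set R := C / Real.log n with hR
  have hR0 : 0 ≤ R := by positivity
  set w := u n s with hw
  have hpre : (2 * Real.pi * √(1 - R ^ 2))⁻¹ ≤ 1 := by
    refine inv_le_one_of_one_le₀ ?_
    have : 1 / 2 ≤ √(1 - R ^ 2) := by
      refine Real.le_sqrt_of_sq_le ?_
      nlinarith
    nlinarith [Real.pi_gt_three]
  have hexp : Real.exp (-w ^ 2 / (1 + R)) ≤ Real.exp (-w ^ 2 / 2) ^ 2 * Real.exp (3 * C) := by
    rw [← Real.exp_nat_mul, ← Real.exp_add, Real.exp_le_exp, div_le_iff₀ (by positivity)]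
    have h5 : w ^ 2 * R ≤ 3 * C := by
      rw [div_lt_iff₀ hL] at h3
      have : R * Real.log n = C := by rw [hR]; field_simp
      nlinarith
    push_cast
    nlinarith [mul_nonneg (sq_nonneg w) (mul_nonneg hR0 hR0), mul_nonneg hC hR0,
      mul_le_mul_of_nonneg_right h5 hR0]
  calc n * densityBound R w ≤ n * (1 * (Real.exp (-w ^ 2 / 2) ^ 2 * Real.exp (3 * C))) := by
        unfold densityBound
        gcongr
    _ = (n * Real.exp (-w ^ 2 / 2)) ^ 2 * Real.exp (3 * C) / n := by field_simp
    _ ≤ (D * √(Real.log n)) ^ 2 * Real.exp (3 * C) / n := by gcongr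
    _ = _ := by rw [mul_pow, Real.sq_sqrt hL.le]; ring

/-- The contribution of the pairs of different vectors to the comparison inequality. -/
theorem exists_bound_tendsto_zero {ρ : ℕ → ℕ → ℝ} {τ δ ϖ : ℝ} (hτ : 0 < τ)
    (hδ : IsLUB {r : ℝ | ∃ k n : ℕ, 1 ≤ k ∧ k < n ∧ r = |ρ k n|} δ) (hϖ : 0 < ϖ)
    (hϖδ : ϖ < (1 - δ) / (1 + δ))
    (hlim : Tendsto (fun n : ℕ => ⨆ k : Set.Ico ⌊(n : ℝ) ^ ϖ⌋₊ n,
        |ρ k n * Real.log (k : ℕ) - τ|) atTop (𝓝 0)) (s : ℝ) :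
    ∃ R : ℕ → ℕ → ℝ,
      (∀ᶠ n : ℕ in atTop, ∀ m, 1 ≤ m → m < n →
        0 ≤ R m n ∧ R m n < 1 ∧ ρ m n ≤ R m n ∧ τ / Real.log n ≤ R m n) ∧
      Tendsto (fun n : ℕ => ∑ m ∈ Finset.Ico 1 n,
        n * (|ρ m n - τ / Real.log n| * densityBound (R m n) (u n s))) atTop (𝓝 0) := by
  have hρδ : ∀ k n, 1 ≤ k → k < n → |ρ k n| ≤ δ := fun k n h1 h2 => hδ.1 ⟨k, n, h1, h2, rfl⟩
  have hδ0 : 0 ≤ δ := (abs_nonneg _).trans (hρδ 1 2 le_rfl one_lt_two)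
  have hδϖ : δ < 2 / (1 + ϖ) - 1 := by
    rw [lt_div_iff₀ (by positivity)] at hϖδ
    rw [lt_sub_iff_add_lt, lt_div_iff₀ (by positivity)]
    nlinarith
  -- The room above `δ` makes `δ'` positive, so that it eventually bounds `τ / log n` too, while `1
  -- + ϖ < 2 / (1 + δ')` still holds.
  obtain ⟨δ', hδ1, hδ2⟩ := exists_between hδϖ
  have hδ0' : 0 ≤ δ' := hδ0.trans hδ1.le
  have hδ3 : δ' < 1 := by
    have : 2 / (1 + ϖ) < 2 := by rw [div_lt_iff₀ (by positivity)]; nlinarith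
    linarith
  have hδ4 : 1 + ϖ < 2 / (1 + δ') := by
    rw [lt_sub_iff_add_lt, lt_div_iff₀ (by positivity)] at hδ2
    rw [lt_div_iff₀ (by positivity)]
    nlinarith
  have hϖ1 : ϖ < 1 := by
    refine hϖδ.trans_le ?_
    rw [div_le_one (by positivity)]; linarith
  -- At large lags `ρ log m ≤ τ + 1` eventually and `log m ≥ (ϖ / 2) log n`, whence `ρ ≤ C / log n`.
  set C := 2 * (τ + 1) / ϖ with hC
  have hC0 : 0 < C := by positivity
  have hCτ : τ ≤ C := by rw [hC, le_div_iff₀ hϖ]; nlinarith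
  obtain ⟨B, hB0, hB⟩ := eventually_far_densityBound_le hC0.le s
  set ε : ℕ → ℝ := fun n => ⨆ k : Set.Ico ⌊(n : ℝ) ^ ϖ⌋₊ n, |ρ k n * Real.log (k : ℕ) - τ| with hε
  have hε_le : ∀ n m : ℕ, ⌊(n : ℝ) ^ ϖ⌋₊ ≤ m → m < n → |ρ m n * Real.log m - τ| ≤ ε n := by
    intro n m h1 h2
    exact le_ciSup (f := fun k : Set.Ico ⌊(n : ℝ) ^ ϖ⌋₊ n => |ρ k n * Real.log (k : ℕ) - τ|)
      (Set.finite_range _).bddAbove ⟨m, h1, h2⟩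
  have hε0 : ∀ n, 0 ≤ ε n := fun n => Real.iSup_nonneg fun _ => abs_nonneg _
  have hR : ∀ᶠ n : ℕ in atTop, ∀ m, ⌊(n : ℝ) ^ ϖ⌋₊ ≤ m → m < n →
      ρ m n ≤ C / Real.log n ∧ |ρ m n * Real.log n - τ| ≤
        2 / ϖ * (ε n + τ * (Real.log n - Real.log m) / Real.log n) := by
    filter_upwards [eventually_log_ge hϖ, hlim.eventually_lt_const one_pos,
      eventually_ge_atTop 2] with n h1 h2 hn m hm hmn
    have hL := log_natCast_pos hn
    have h3 := h1 m hm
    have h4 : 0 < Real.log m := lt_of_lt_of_le (by positivity) h3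
    have hm0 : (0 : ℝ) < m := by
      rcases Nat.eq_zero_or_pos m with h | h
      · simp [h] at h4
      · exact_mod_cast h
    have h5 := hε_le n m hm hmn
    have h6 := abs_le.1 (h5.trans h2.le)
    have h7 : Real.log m ≤ Real.log n :=
      Real.log_le_log hm0 (by exact_mod_cast hmn.le)
    have hq : Real.log n / Real.log m ≤ 2 / ϖ := by
      rw [div_le_div_iff₀ h4 hϖ]; linarith
    constructor
    · have h8 : ρ m n ≤ (τ + 1) / Real.log m := by
        rw [le_div_iff₀ h4]; linarith [h6.2]
      refine h8.trans ?_
      rw [div_le_div_iff₀ h4 hL, hC]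
      have : (τ + 1) * Real.log n ≤ (τ + 1) * (2 / ϖ * Real.log m) := by
        refine mul_le_mul_of_nonneg_left ?_ (by positivity)
        rwa [div_le_iff₀ h4] at hq
      calc _ ≤ _ := this
        _ = _ := by ring
    -- The first error is uniformly small by hypothesis. The second, from exchanging `log m` and
    -- `log n`, is not uniformly small, but its average over `m` is `O(1 / log n)` by
    -- `sum_log_sub_log_le`.
    · have e : ρ m n * Real.log n - τ = Real.log n / Real.log m * ((ρ m n * Real.log m - τ) +
          τ * (Real.log n - Real.log m) / Real.log n) := by
        field_simp
        ring
      rw [e, abs_mul, abs_of_nonneg (by positivity : 0 ≤ Real.log n / Real.log m)]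
      have hnn : 0 ≤ τ * (Real.log n - Real.log m) / Real.log n :=
        div_nonneg (mul_nonneg hτ.le (by linarith)) hL.le
      refine mul_le_mul hq ((abs_add_le _ _).trans ?_) (abs_nonneg _) (by positivity)
      rw [abs_of_nonneg hnn]
      linarith
  have hτL := (tendsto_div_log τ).eventually_lt_const (u := min δ' 1)
    (lt_min (hδ0.trans_lt hδ1) one_pos)
  refine ⟨fun m n => if m < ⌊(n : ℝ) ^ ϖ⌋₊ then δ' else C / Real.log n, ?_, ?_⟩
  · filter_upwards [hR, hB, hτL] with n hR hB hτL m hm hmn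
    split_ifs with h
    · exact ⟨hδ0', hδ3, (le_abs_self _).trans ((hρδ m n hm hmn).trans hδ1.le),
        hτL.le.trans (min_le_left _ _)⟩
    · refine ⟨div_nonneg hC0.le hB.1.le, hB.2.1, (hR m (not_lt.1 h) hmn).1, ?_⟩
      exact div_le_div_of_nonneg_right hCτ hB.1.le
  · have hlim2 : Tendsto (fun n : ℕ => (n : ℝ) ^ ϖ * (n * (2 * densityBound δ' (u n s)))
        + B * (2 / ϖ) * (ε n + τ / Real.log n)) atTop (𝓝 0) := by
      have := (tendsto_near_bound hδ0' hδ4 s 2).add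
        ((hlim.add (tendsto_div_log τ)).const_mul (B * (2 / ϖ)))
      simpa using this
    refine squeeze_zero' (Eventually.of_forall fun n => Finset.sum_nonneg fun m _ => ?_) ?_ hlim2
    · exact mul_nonneg (Nat.cast_nonneg _) (mul_nonneg (abs_nonneg _) (densityBound_nonneg _ _))
    filter_upwards [hR, hB, hτL, eventually_ge_atTop 2] with n hR hB hτL hn
    have hL := hB.1
    have hn0 : (0 : ℝ) < n := by positivity
    set A : ℝ := n * (2 * densityBound δ' (u n s)) with hA
    have hA0 : 0 ≤ A := by
      have := densityBound_nonneg δ' (u n s); positivity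
    have hterm : ∀ m ∈ Finset.Ico 1 n, n * (|ρ m n - τ / Real.log n| *
        densityBound (if m < ⌊(n : ℝ) ^ ϖ⌋₊ then δ' else C / Real.log n) (u n s))
        ≤ (if m < ⌊(n : ℝ) ^ ϖ⌋₊ then A else 0) +
          B * (2 / ϖ) / n * (ε n + τ * (Real.log n - Real.log m) / Real.log n) := by
      intro m hm
      rw [Finset.mem_Ico] at hm
      have hm0 : (0 : ℝ) < m := by exact_mod_cast hm.1
      have h7 : Real.log m ≤ Real.log n := Real.log_le_log hm0 (by exact_mod_cast hm.2.le)
      have hnn : 0 ≤ ε n + τ * (Real.log n - Real.log m) / Real.log n :=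
        add_nonneg (hε0 n) (div_nonneg (mul_nonneg hτ.le (by linarith)) hL.le)
      split_ifs with h
      · refine le_add_of_le_of_nonneg ?_ (by positivity)
        rw [hA]
        refine mul_le_mul_of_nonneg_left ?_ hn0.le
        refine mul_le_mul_of_nonneg_right ?_ (densityBound_nonneg _ _)
        have h1 := abs_le.1 ((hρδ m n hm.1 hm.2).trans (hδ1.le.trans hδ3.le))
        have h2 : τ / Real.log n ≤ 1 := hτL.le.trans (min_le_right _ _)
        have h3 : 0 ≤ τ / Real.log n := by positivity
        rw [abs_le]
        constructor <;> linarith [h1.1, h1.2]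
      · rw [zero_add]
        have h1 := (hR m (not_lt.1 h) hm.2).2
        have h2 : |ρ m n - τ / Real.log n| = |ρ m n * Real.log n - τ| / Real.log n := by
          rw [← abs_of_pos hL, ← abs_div, abs_of_pos hL]
          congr 1
          field_simp
        calc _ = |ρ m n * Real.log n - τ| / Real.log n *
              (n * densityBound (C / Real.log n) (u n s)) := by rw [h2]; ring
          _ ≤ (2 / ϖ * (ε n + τ * (Real.log n - Real.log m) / Real.log n)) / Real.log n *
              (B * (Real.log n / n)) := by
              refine mul_le_mul (div_le_div_of_nonneg_right h1 hL.le) hB.2.2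
                (mul_nonneg hn0.le (densityBound_nonneg _ _)) (by positivity)
          _ = _ := by field_simp
    refine (Finset.sum_le_sum hterm).trans ?_
    rw [Finset.sum_add_distrib, ← Finset.mul_sum, Finset.sum_add_distrib]
    refine add_le_add ?_ ?_
    · refine (sum_Ico_ite_le hA0).trans (mul_le_mul_of_nonneg_right ?_ hA0)
      exact Nat.floor_le (by positivity)
    · have h1 : ∑ m ∈ Finset.Ico 1 n, τ * (Real.log n - Real.log m) / Real.log n
          ≤ τ / Real.log n * n := by
        have : ∑ m ∈ Finset.Ico 1 n, τ * (Real.log n - Real.log m) / Real.log n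
            = τ / Real.log n * ∑ m ∈ Finset.Ico 1 n, (Real.log n - Real.log m) := by
          rw [Finset.mul_sum]
          exact Finset.sum_congr rfl fun m _ => by ring
        rw [this]
        exact mul_le_mul_of_nonneg_left (sum_log_sub_log_le hn) (by positivity)
      have h2 : ∑ _m ∈ Finset.Ico 1 n, ε n ≤ n * ε n := by
        rw [Finset.sum_const, nsmul_eq_mul, Nat.card_Ico]
        refine mul_le_mul_of_nonneg_right ?_ (hε0 n)
        exact_mod_cast Nat.sub_le n 1
      calc _ ≤ B * (2 / ϖ) / n * (n * ε n + τ / Real.log n * n) := by gcongr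
        _ = _ := by field_simp

/-! ### Noise correlation and the comparison error inside a vector -/

/-- The scale `√(1 - τ₁₁ / log n) √(1 - τ₂₂ / log n)` of the noise of the comparison model. -/
noncomputable def noiseScale (τ : Fin 2 → Fin 2 → ℝ) (n : ℕ) : ℝ :=
  √(1 - τ 0 0 / Real.log n) * √(1 - τ 1 1 / Real.log n)

/-- The noise correlation for which the comparison model has same-time correlation `ρ₀ n`; it need
not lie in `[-1, 1]`. -/
noncomputable def rawCorr (τ : Fin 2 → Fin 2 → ℝ) (ρ₀ : ℕ → ℝ) (n : ℕ) : ℝ :=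
  (ρ₀ n - τ 0 1 / Real.log n) / noiseScale τ n

/-- `rawCorr` clamped to `[-1, 1]`. -/
noncomputable def noiseCorr (τ : Fin 2 → Fin 2 → ℝ) (ρ₀ : ℕ → ℝ) (n : ℕ) : ℝ :=
  max (-1) (min 1 (rawCorr τ ρ₀ n))

lemma abs_noiseCorr_le (τ : Fin 2 → Fin 2 → ℝ) (ρ₀ : ℕ → ℝ) (n : ℕ) : |noiseCorr τ ρ₀ n| ≤ 1 :=
  abs_le.2 ⟨le_max_left _ _, max_le (by norm_num) (min_le_left _ _)⟩

lemma tendsto_log_mul_one_sub_sqrt (c : ℝ) :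
    Tendsto (fun n : ℕ => Real.log n * (1 - √(1 - c / Real.log n))) atTop (𝓝 (c / 2)) := by
  have h1 := (tendsto_sqrt_one_sub_div_log c).const_add 1
  have h2 := (tendsto_const_nhds (x := c)).div h1 (by norm_num)
  rw [one_add_one_eq_two] at h2
  refine h2.congr' ?_
  filter_upwards [eventually_ge_atTop 2,
    (tendsto_div_log c).eventually_lt_const (by norm_num : (0 : ℝ) < 1)] with n hn hc
  have hL := log_natCast_pos hn
  have hs := Real.sq_sqrt (by linarith : 0 ≤ 1 - c / Real.log n)
  have hs0 := Real.sqrt_nonneg (1 - c / Real.log n)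
  have e : Real.log n * (1 - √(1 - c / Real.log n) ^ 2) = c := by
    rw [hs]; field_simp; ring
  simp only [Pi.div_apply]
  rw [div_eq_iff (by positivity)]
  linear_combination -e

lemma tendsto_noiseScale (τ : Fin 2 → Fin 2 → ℝ) : Tendsto (noiseScale τ) atTop (𝓝 1) := by
  have h := (tendsto_sqrt_one_sub_div_log (τ 0 0)).mul (tendsto_sqrt_one_sub_div_log (τ 1 1))
  rw [one_mul] at h
  exact h

lemma tendsto_log_mul_one_sub_noiseScale (τ : Fin 2 → Fin 2 → ℝ) :
    Tendsto (fun n : ℕ => Real.log n * (1 - noiseScale τ n)) atTop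
      (𝓝 ((τ 0 0 + τ 1 1) / 2)) := by
  have h := (tendsto_log_mul_one_sub_sqrt (τ 0 0)).add ((tendsto_sqrt_one_sub_div_log (τ 0 0)).mul
    (tendsto_log_mul_one_sub_sqrt (τ 1 1)))
  rw [one_mul, ← add_div] at h
  refine h.congr fun n => ?_
  rw [noiseScale]; ring

/-- Origin of `τ̃`: the noise scale tends to `1` with `log n (1 - noiseScale) → (τ 0 0 + τ 1 1) /
2`, so `(1 - ρ₀) log n` is shifted by `τ 0 1 - (τ 0 0 + τ 1 1) / 2` in the limit. -/
lemma eventually_one_sub_rawCorr (τ : Fin 2 → Fin 2 → ℝ) (ρ₀ : ℕ → ℝ) :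
    ∀ᶠ n : ℕ in atTop, ((1 - ρ₀ n) * Real.log n + (τ 0 1 - Real.log n * (1 - noiseScale τ n)))
      / noiseScale τ n = (1 - rawCorr τ ρ₀ n) * Real.log n := by
  filter_upwards [eventually_ge_atTop 2,
    (tendsto_noiseScale τ).eventually_const_lt (by norm_num : (0 : ℝ) < 1)] with n hn hs
  have hL := log_natCast_pos hn
  rw [rawCorr]
  field_simp
  ring

lemma tendsto_rawCorr_atTop (τ : Fin 2 → Fin 2 → ℝ) {ρ₀ : ℕ → ℝ}
    (h : Tendsto (fun n : ℕ => (1 - ρ₀ n) * Real.log n) atTop atTop) :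
    Tendsto (fun n : ℕ => (1 - rawCorr τ ρ₀ n) * Real.log n) atTop atTop := by
  refine Tendsto.congr' (eventually_one_sub_rawCorr τ ρ₀) ?_
  refine Tendsto.congr (fun n => (div_eq_mul_inv _ _).symm) ?_
  exact (h.atTop_add ((tendsto_log_mul_one_sub_noiseScale τ).const_sub _)).atTop_mul_pos
    (by norm_num) ((tendsto_noiseScale τ).inv₀ one_ne_zero)

lemma tendsto_rawCorr (τ : Fin 2 → Fin 2 → ℝ) {ρ₀ : ℕ → ℝ} {l : ℝ}
    (h : Tendsto (fun n : ℕ => (1 - ρ₀ n) * Real.log n) atTop (𝓝 l)) :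
    Tendsto (fun n : ℕ => (1 - rawCorr τ ρ₀ n) * Real.log n) atTop (𝓝 (l + tauTilde τ)) := by
  refine Tendsto.congr' (eventually_one_sub_rawCorr τ ρ₀) ?_
  have := (h.add ((tendsto_log_mul_one_sub_noiseScale τ).const_sub (τ 0 1))).div
    (tendsto_noiseScale τ) one_ne_zero
  rwa [div_one] at this

/-- Clamping does not affect the limit: the clamp at `1` is what `ENNReal.ofReal` does to negative
values anyway, and the clamp at `-1` is a cap at `2 log n`, which tends to infinity. -/
lemma ofReal_one_sub_noiseCorr (τ : Fin 2 → Fin 2 → ℝ) (ρ₀ : ℕ → ℝ) (n : ℕ) :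
    ENNReal.ofReal ((1 - noiseCorr τ ρ₀ n) * Real.log n)
      = min (ENNReal.ofReal (2 * Real.log n))
        (ENNReal.ofReal ((1 - rawCorr τ ρ₀ n) * Real.log n)) := by
  have hL : 0 ≤ Real.log n := Real.log_natCast_nonneg n
  have e : 1 - noiseCorr τ ρ₀ n = min 2 (max (1 - rawCorr τ ρ₀ n) 0) := by
    rw [noiseCorr]
    rcases le_total 1 (rawCorr τ ρ₀ n) with h | h
    · rw [min_eq_left h, max_eq_right (by norm_num), max_eq_right (by linarith),
        min_eq_right (by norm_num)]
      norm_num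
    · rw [min_eq_right h, max_eq_left (by linarith : (0 : ℝ) ≤ 1 - rawCorr τ ρ₀ n)]
      rcases le_total (-1) (rawCorr τ ρ₀ n) with h' | h'
      · rw [max_eq_right h', min_eq_right (by linarith)]
      · rw [max_eq_left h', min_eq_left (by linarith)]; norm_num
  rw [e, min_mul_of_nonneg _ _ hL, max_mul_of_nonneg _ _ hL, zero_mul]
  have : Monotone ENNReal.ofReal := fun _ _ => ENNReal.ofReal_le_ofReal
  rw [this.map_min, this.map_max, ENNReal.ofReal_zero]
  simp

lemma tendsto_of_tendsto_ofReal_sq {ρ₀ : ℕ → ℝ} (h1 : ∀ᶠ n in atTop, |ρ₀ n| ≤ 1) {lam : ℝ≥0∞}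
    (hlam : Tendsto (fun n : ℕ => ENNReal.ofReal ((1 - ρ₀ n) * Real.log n)) atTop (𝓝 (lam ^ 2)))
    (ht : lam ≠ ∞) :
    Tendsto (fun n : ℕ => (1 - ρ₀ n) * Real.log n) atTop (𝓝 (lam.toReal ^ 2)) := by
  rw [← ENNReal.toReal_pow]
  refine tendsto_real_of_tendsto_ofReal ?_ (by simp [ht]) hlam
  filter_upwards [h1] with n hn
  exact mul_nonneg (by linarith [(abs_le.1 hn).2]) (Real.log_natCast_nonneg n)

lemma toReal_sq_add_tauTilde_nonneg {lam : ℝ≥0∞} {τ : Fin 2 → Fin 2 → ℝ}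
    (hlamτ : ENNReal.ofReal (-tauTilde τ) ≤ lam ^ 2) (ht : lam ≠ ∞) :
    0 ≤ lam.toReal ^ 2 + tauTilde τ := by
  have h := (ENNReal.ofReal_le_iff_le_toReal (by simp [ht])).1 hlamτ
  rw [ENNReal.toReal_pow] at h
  linarith

lemma tendsto_ofReal_one_sub_noiseCorr {ρ₀ : ℕ → ℝ} (h1 : ∀ᶠ n in atTop, |ρ₀ n| ≤ 1)
    {lam : ℝ≥0∞}
    (hlam : Tendsto (fun n : ℕ => ENNReal.ofReal ((1 - ρ₀ n) * Real.log n)) atTop (𝓝 (lam ^ 2)))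
    {τ : Fin 2 → Fin 2 → ℝ} (hlamτ : ENNReal.ofReal (-tauTilde τ) ≤ lam ^ 2) :
    Tendsto (fun n : ℕ => ENNReal.ofReal ((1 - noiseCorr τ ρ₀ n) * Real.log n)) atTop
      (𝓝 (lamTilde lam τ ^ 2)) := by
  simp_rw [ofReal_one_sub_noiseCorr]
  have hL : Tendsto (fun n : ℕ => ENNReal.ofReal (2 * Real.log n)) atTop (𝓝 ∞) :=
    ENNReal.tendsto_ofReal_atTop.comp (tendsto_log_natCast.const_mul_atTop two_pos)
  rw [← top_inf_eq (lamTilde lam τ ^ 2)]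
  refine hL.min ?_
  by_cases ht : lam = ∞
  · subst ht
    rw [ENNReal.top_pow two_ne_zero] at hlam
    simp only [lamTilde, if_true, ENNReal.top_pow two_ne_zero]
    exact ENNReal.tendsto_ofReal_atTop.comp
      (tendsto_rawCorr_atTop τ (tendsto_atTop_of_tendsto_ofReal hlam))
  · have h0 := toReal_sq_add_tauTilde_nonneg hlamτ ht
    rw [lamTilde, if_neg ht, ← ENNReal.ofReal_pow (Real.sqrt_nonneg _), Real.sq_sqrt h0]
    exact (ENNReal.continuous_ofReal.tendsto _).comp
      (tendsto_rawCorr τ (tendsto_of_tendsto_ofReal_sq h1 hlam ht))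

/-- The same-time correlation of the comparison model. -/
noncomputable def modelCorr (τ : Fin 2 → Fin 2 → ℝ) (ρ₀ : ℕ → ℝ) (n : ℕ) : ℝ :=
  τ 0 1 / Real.log n + noiseScale τ n * noiseCorr τ ρ₀ n

lemma densityBound_le_of_le_one_sub {R w κ : ℝ} (h0 : 0 ≤ R) (hκ : 0 < κ) (hR : κ ≤ 1 - R) :
    densityBound R w ≤ (√κ)⁻¹ * Real.exp (-w ^ 2 / 2) := by
  rw [densityBound]
  have hs : √κ ≤ √(1 - R ^ 2) := Real.sqrt_le_sqrt (by nlinarith)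
  have hs0 : 0 < √κ := Real.sqrt_pos.2 hκ
  refine mul_le_mul (inv_anti₀ hs0 ?_) (Real.exp_le_exp.2 ?_) (by positivity) (by positivity)
  · nlinarith [Real.pi_gt_three]
  · rw [neg_div, neg_div, neg_le_neg_iff]
    exact div_le_div_of_nonneg_left (sq_nonneg w) (by linarith) (by linarith)

/-- The equality case of the inequality between geometric and arithmetic means. -/
lemma eq_of_tauTilde_nonneg {τ : Fin 2 → Fin 2 → ℝ} (h0 : 0 < τ 0 0) (h1 : 0 < τ 1 1)
    (hτ : τ 0 1 ≤ √(τ 0 0 * τ 1 1)) (h : 0 ≤ tauTilde τ) : τ 1 1 = τ 0 0 ∧ τ 0 1 = τ 0 0 := by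
  rw [tauTilde] at h
  rw [Real.sqrt_mul h0.le] at hτ
  have e0 := Real.sq_sqrt h0.le
  have e1 := Real.sq_sqrt h1.le
  have e : √(τ 0 0) = √(τ 1 1) := by
    have : (√(τ 0 0) - √(τ 1 1)) ^ 2 ≤ 0 := by nlinarith
    linarith [pow_eq_zero_iff (two_ne_zero) |>.1 (le_antisymm this (sq_nonneg _))]
  have e2 : τ 1 1 = τ 0 0 := by rw [← e0, ← e1, e]
  refine ⟨e2, ?_⟩
  rw [← e] at hτ
  nlinarith

/-- Only `0 < λ < ∞` needs an estimate. There `1 - ρ₀` is at least of order `1 / log n`, so the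
density prefactor is `O(√log n)`; with `n exp (-u² / 2) = O(√log n)` the total is `O((rawCorr - 1)
log n)`. Its positive part vanishes because the limit of `(1 - rawCorr) log n` is `λ² + τ̃ ≥ 0`. For
`λ = ∞` and `λ = 0`, `rawCorr > 1` is eventually impossible. -/
lemma exists_bound_of_one_lt_rawCorr {ρ₀ : ℕ → ℝ} (hb : ∀ᶠ n in atTop, |ρ₀ n| ≤ 1)
    {lam : ℝ≥0∞}
    (hlam : Tendsto (fun n : ℕ => ENNReal.ofReal ((1 - ρ₀ n) * Real.log n)) atTop (𝓝 (lam ^ 2)))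
    {τ : Fin 2 → Fin 2 → ℝ} (h0 : 0 < τ 0 0) (h1 : 0 < τ 1 1)
    (hτ : τ 0 1 ≤ √(τ 0 0 * τ 1 1)) (hlamτ : ENNReal.ofReal (-tauTilde τ) ≤ lam ^ 2) (s : ℝ) :
    ∃ T : ℕ → ℝ, Tendsto T atTop (𝓝 0) ∧ (∀ n, 0 ≤ T n) ∧
      ∀ᶠ n in atTop, 1 < rawCorr τ ρ₀ n → ρ₀ n < 1 ∧
        n * ((rawCorr τ ρ₀ n - 1) * densityBound (max 0 (ρ₀ n)) (u n s)) ≤ T n := by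
  by_cases ht : lam = ∞
  · subst ht
    rw [ENNReal.top_pow two_ne_zero] at hlam
    refine ⟨fun _ => 0, tendsto_const_nhds, fun _ => le_rfl, ?_⟩
    filter_upwards [(tendsto_rawCorr_atTop τ
      (tendsto_atTop_of_tendsto_ofReal hlam)).eventually_gt_atTop 0,
      eventually_ge_atTop 2] with n hn hn2 h
    have := pos_of_mul_pos_left hn (log_natCast_pos hn2).le
    linarith
  have hnn := toReal_sq_add_tauTilde_nonneg hlamτ ht
  have hl := tendsto_of_tendsto_ofReal_sq hb hlam ht
  -- For `λ = 0` the density may degenerate, but `τ̃ ≥ 0` forces all `τ` involved to coincide, and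
  -- then `rawCorr = (ρ₀ - c) / (1 - c) ≤ 1` with `c = τ 0 0 / log n`.
  rcases eq_or_ne lam 0 with rfl | hz
  · refine ⟨fun _ => 0, tendsto_const_nhds, fun _ => le_rfl, ?_⟩
    obtain ⟨e1, e2⟩ := eq_of_tauTilde_nonneg h0 h1 hτ (by simpa using hnn)
    filter_upwards [hb, (tendsto_div_log (τ 0 0)).eventually_lt_const
      (by norm_num : (0 : ℝ) < 1)] with n hn hn1 h
    rw [rawCorr, noiseScale, e1, e2, Real.mul_self_sqrt (by linarith),
      lt_div_iff₀ (by linarith)] at h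
    linarith [(abs_le.1 hn).2]
  obtain ⟨C, hC, hCn⟩ := exists_natCast_mul_exp_le s
  have hl0 : 0 < lam.toReal := ENNReal.toReal_pos hz ht
  set κ := lam.toReal ^ 2 / 2 with hκ
  have hκ0 : 0 < κ := by positivity
  refine ⟨fun n => C / √κ * max 0 (-((1 - rawCorr τ ρ₀ n) * Real.log n)), ?_,
    fun n => by positivity, ?_⟩
  · have := ((tendsto_const_nhds (x := (0 : ℝ))).max (tendsto_rawCorr τ hl).neg).const_mul (C / √κ)
    rwa [max_eq_left (by linarith), mul_zero] at this
  · filter_upwards [hCn, hl.eventually_const_lt (by rw [hκ]; linarith : κ < lam.toReal ^ 2),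
      (tendsto_div_log κ).eventually_lt_const (by norm_num : (0 : ℝ) < 1),
      eventually_ge_atTop 2] with n hn hk hk1 hn2 h
    have hL := log_natCast_pos hn2
    have hk2 : κ / Real.log n < 1 - ρ₀ n := (div_lt_iff₀ hL).2 hk
    have hk0 : 0 < κ / Real.log n := by positivity
    refine ⟨by linarith, ?_⟩
    have hd := densityBound_le_of_le_one_sub (R := max 0 (ρ₀ n)) (w := u n s) (le_max_left _ _) hk0
      (by rcases max_cases 0 (ρ₀ n) with ⟨e, _⟩ | ⟨e, _⟩ <;> rw [e] <;> linarith)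
    have e : (√(κ / Real.log n))⁻¹ = √(Real.log n) / √κ := by
      rw [Real.sqrt_div hκ0.le, inv_div]
    rw [e] at hd
    have hs := Real.mul_self_sqrt hL.le
    have hκs : 0 < √κ := Real.sqrt_pos.2 hκ0
    refine le_trans ?_ (mul_le_mul_of_nonneg_left (le_max_right _ _) (by positivity))
    calc n * ((rawCorr τ ρ₀ n - 1) * densityBound (max 0 (ρ₀ n)) (u n s))
        ≤ n * ((rawCorr τ ρ₀ n - 1) * (√(Real.log n) / √κ * Real.exp (-u n s ^ 2 / 2))) := by
          have : 0 ≤ rawCorr τ ρ₀ n - 1 := by linarith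
          gcongr
      _ = (rawCorr τ ρ₀ n - 1) * (√(Real.log n) / √κ) * (n * Real.exp (-u n s ^ 2 / 2)) := by ring
      _ ≤ (rawCorr τ ρ₀ n - 1) * (√(Real.log n) / √κ) * (C * √(Real.log n)) := by
          have : 0 ≤ rawCorr τ ρ₀ n - 1 := by linarith
          gcongr
      _ = C / √κ * ((rawCorr τ ρ₀ n - 1) * (√(Real.log n) * √(Real.log n))) := by ring
      _ = C / √κ * -((1 - rawCorr τ ρ₀ n) * Real.log n) := by rw [hs]; ring

/-- Three regimes. For `rawCorr` in `[-1, 1]` the model correlation is exactly `ρ₀`. Above `1` it is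
smaller than `ρ₀`, and `exists_bound_of_one_lt_rawCorr` applies. Below `-1` both correlations are
negative, so the density bound at correlation `0` gives an error `O(log n / n)`. -/
lemma tendsto_diagonal_bound {ρ₀ : ℕ → ℝ} (hb : ∀ᶠ n in atTop, |ρ₀ n| ≤ 1)
    {lam : ℝ≥0∞}
    (hlam : Tendsto (fun n : ℕ => ENNReal.ofReal ((1 - ρ₀ n) * Real.log n)) atTop (𝓝 (lam ^ 2)))
    {τ : Fin 2 → Fin 2 → ℝ} (h0 : 0 < τ 0 0) (h1 : 0 < τ 1 1)
    (hτ : τ 0 1 ≤ √(τ 0 0 * τ 1 1)) (hlamτ : ENNReal.ofReal (-tauTilde τ) ≤ lam ^ 2) (s : ℝ) :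
    (∀ᶠ n in atTop, ρ₀ n ≠ modelCorr τ ρ₀ n → max 0 (ρ₀ n) < 1 ∧
      modelCorr τ ρ₀ n ≤ max 0 (ρ₀ n)) ∧
    Tendsto (fun n : ℕ => n * (|ρ₀ n - modelCorr τ ρ₀ n| *
      densityBound (max 0 (ρ₀ n)) (u n s))) atTop (𝓝 0) := by
  obtain ⟨T, hT, hT0, hev⟩ := exists_bound_of_one_lt_rawCorr hb hlam h0 h1 hτ hlamτ s
  obtain ⟨B, hB, hBev⟩ := eventually_far_densityBound_le le_rfl s
  have hlog : Tendsto (fun n : ℕ => Real.log n / n) atTop (𝓝 0) := by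
    have h := Real.isLittleO_log_id_atTop.tendsto_div_nhds_zero.comp
      (tendsto_natCast_atTop_atTop (R := ℝ))
    exact h
  have key : ∀ᶠ n in atTop, (ρ₀ n ≠ modelCorr τ ρ₀ n → max 0 (ρ₀ n) < 1 ∧
      modelCorr τ ρ₀ n ≤ max 0 (ρ₀ n)) ∧ n * (|ρ₀ n - modelCorr τ ρ₀ n| *
      densityBound (max 0 (ρ₀ n)) (u n s)) ≤ T n + 2 * (B * (Real.log n / n)) := by
    filter_upwards [hev, hBev, hb, (tendsto_noiseScale τ).eventually_const_lt
      (by norm_num : (2⁻¹ : ℝ) < 1), (tendsto_noiseScale τ).eventually_lt_const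
      (by norm_num : (1 : ℝ) < 5 / 4), (tendsto_div_log (τ 0 1)).eventually_lt_const
      (by norm_num : (0 : ℝ) < 1 / 4), (tendsto_div_log (τ 0 1)).eventually_const_lt
      (by norm_num : (-(1 / 4) : ℝ) < 0), (tendsto_div_log (τ 0 0)).eventually_lt_const
      (by norm_num : (0 : ℝ) < 1), (tendsto_div_log (τ 1 1)).eventually_lt_const
      (by norm_num : (0 : ℝ) < 1), eventually_ge_atTop 2]
      with n hn hBn hbn hs hs' hc hc' hc0 hc1 hn2
    have hL := log_natCast_pos hn2
    have hs1 : noiseScale τ n ≤ 1 := by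
      rw [noiseScale]
      have p0 : 0 < τ 0 0 / Real.log n := by positivity
      have p1 : 0 < τ 1 1 / Real.log n := by positivity
      exact mul_le_one₀ (Real.sqrt_le_one.2 (by linarith)) (Real.sqrt_nonneg _)
        (Real.sqrt_le_one.2 (by linarith))
    have hraw : ρ₀ n = τ 0 1 / Real.log n + noiseScale τ n * rawCorr τ ρ₀ n := by
      rw [rawCorr]; field_simp; ring
    obtain ⟨_, _, hBn⟩ := hBn
    have hB0 : 0 ≤ 2 * (B * (Real.log n / n)) := by positivity
    rcases lt_or_ge 1 (rawCorr τ ρ₀ n) with h | h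
    · obtain ⟨hlt, hle⟩ := hn h
      have e : noiseCorr τ ρ₀ n = 1 := by
        rw [noiseCorr, min_eq_left h.le]; norm_num
      have e2 : ρ₀ n - modelCorr τ ρ₀ n = noiseScale τ n * (rawCorr τ ρ₀ n - 1) := by
        rw [modelCorr, e]; linarith
      have hd := densityBound_nonneg (max 0 (ρ₀ n)) (u n s)
      have hp : 0 ≤ rawCorr τ ρ₀ n - 1 := by linarith
      have hp2 : 0 ≤ noiseScale τ n * (rawCorr τ ρ₀ n - 1) := by positivity
      refine ⟨fun _ => ⟨max_lt one_pos hlt, le_max_of_le_right (by linarith)⟩, ?_⟩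
      rw [e2, abs_of_nonneg hp2]
      refine le_trans ?_ (hle.trans (by linarith))
      gcongr
      exact mul_le_of_le_one_left hp hs1
    rcases le_or_gt (-1) (rawCorr τ ρ₀ n) with h' | h'
    · have e : modelCorr τ ρ₀ n = ρ₀ n := by
        rw [modelCorr, noiseCorr, min_eq_right h, max_eq_right h', ← hraw]
      refine ⟨fun hne => absurd e.symm hne, ?_⟩
      rw [e]
      simpa using add_nonneg (hT0 n) hB0
    · have e : noiseCorr τ ρ₀ n = -1 := by
        rw [noiseCorr, min_eq_right h, max_eq_left h'.le]
      have hm : modelCorr τ ρ₀ n < 0 := by rw [modelCorr, e]; linarith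
      have hρ : ρ₀ n < 0 := by rw [hraw]; nlinarith
      rw [max_eq_left hρ.le]
      refine ⟨fun _ => ⟨one_pos, hm.le⟩, ?_⟩
      have hΔ : |ρ₀ n - modelCorr τ ρ₀ n| ≤ 2 := by
        have h3 : -(5 / 4) - 1 / 4 < modelCorr τ ρ₀ n := by rw [modelCorr, e]; linarith
        have := (abs_le.1 hbn).1
        rw [abs_le]; constructor <;> linarith
      rw [zero_div] at hBn
      have hd := densityBound_nonneg 0 (u n s)
      calc n * (|ρ₀ n - modelCorr τ ρ₀ n| * densityBound 0 (u n s))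
          ≤ n * (2 * densityBound 0 (u n s)) := by gcongr
        _ = 2 * (n * densityBound 0 (u n s)) := by ring
        _ ≤ 2 * (B * (Real.log n / n)) := by gcongr
        _ ≤ _ := by linarith [hT0 n]
  refine ⟨key.mono fun n h => h.1, ?_⟩
  have hlim : Tendsto (fun n : ℕ => T n + 2 * (B * (Real.log n / n))) atTop (𝓝 0) := by
    simpa using hT.add ((hlog.const_mul B).const_mul 2)
  refine squeeze_zero' (Eventually.of_forall fun n => ?_) (key.mono fun n h => h.2) hlim
  have hd := densityBound_nonneg (max 0 (ρ₀ n)) (u n s)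
  positivity

/-! ### Summation over all pairs and comparison of the array with the model -/

/-- Each lag occurs at most twice, once on either side of `k`. -/
lemma sum_natAbs_sub_le {f : ℕ → ℝ} (hf : ∀ m, 0 ≤ f m) {n k : ℕ} (hk1 : 1 ≤ k) (hkn : k ≤ n) :
    ∑ l ∈ Finset.Icc 1 n, (if k = l then 0 else f ((k : ℤ) - l).natAbs)
      ≤ 2 * ∑ m ∈ Finset.Ico 1 n, f m := by
  have h1 : ∑ l ∈ Finset.Ico 1 k, f (k - l) ≤ ∑ m ∈ Finset.Ico 1 n, f m := by
    rw [← Finset.sum_image (f := f) (g := fun l => k - l)]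
    · refine Finset.sum_le_sum_of_subset_of_nonneg ?_ fun _ _ _ => hf _
      intro m hm
      simp only [Finset.mem_image, Finset.mem_Ico] at hm ⊢
      omega
    · intro x hx y hy h
      simp only [Finset.coe_Ico, Set.mem_Ico] at hx hy h
      omega
  have h2 : ∑ l ∈ Finset.Ioc k n, f (l - k) ≤ ∑ m ∈ Finset.Ico 1 n, f m := by
    rw [← Finset.sum_image (f := f) (g := fun l => l - k)]
    · refine Finset.sum_le_sum_of_subset_of_nonneg ?_ fun _ _ _ => hf _
      intro m hm
      simp only [Finset.mem_image, Finset.mem_Ioc, Finset.mem_Ico] at hm ⊢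
      omega
    · intro x hx y hy h
      simp only [Finset.coe_Ioc, Set.mem_Ioc] at hx hy h
      omega
  have hsplit : Finset.Icc 1 n = insert k (Finset.Ico 1 k ∪ Finset.Ioc k n) := by
    ext l
    simp only [Finset.mem_Icc, Finset.mem_insert, Finset.mem_union, Finset.mem_Ico, Finset.mem_Ioc]
    omega
  have hdisj : Disjoint (Finset.Ico 1 k) (Finset.Ioc k n) := by
    rw [Finset.disjoint_left]
    intro l
    simp only [Finset.mem_Ico, Finset.mem_Ioc]
    omega
  rw [hsplit, Finset.sum_insert (by simp), if_pos rfl, zero_add, Finset.sum_union hdisj]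
  have e1 : ∑ l ∈ Finset.Ico 1 k, (if k = l then 0 else f ((k : ℤ) - l).natAbs)
      = ∑ l ∈ Finset.Ico 1 k, f (k - l) := by
    refine Finset.sum_congr rfl fun l hl => ?_
    rw [Finset.mem_Ico] at hl
    rw [if_neg (by omega)]
    congr 1
    omega
  have e2 : ∑ l ∈ Finset.Ioc k n, (if k = l then 0 else f ((k : ℤ) - l).natAbs)
      = ∑ l ∈ Finset.Ioc k n, f (l - k) := by
    refine Finset.sum_congr rfl fun l hl => ?_
    rw [Finset.mem_Ioc] at hl
    rw [if_neg (by omega)]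
    congr 1
    omega
  rw [e1, e2]
  linarith

lemma sum_sum_natAbs_sub_le {f : ℕ → ℝ} (hf : ∀ m, 0 ≤ f m) (n : ℕ) {d : ℝ} :
    ∑ k : Set.Icc 1 n, ∑ l : Set.Icc 1 n,
      (if k = l then d else f (((k : ℕ) : ℤ) - ((l : ℕ) : ℤ)).natAbs)
      ≤ n * d + 2 * ∑ m ∈ Finset.Ico 1 n, n * f m := by
  have hmem : ∀ m : ℕ, m ∈ Finset.Icc 1 n ↔ m ∈ Set.Icc 1 n := by simp
  have hcard : Fintype.card (Set.Icc 1 n) = n := by simp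
  have h : ∀ k : Set.Icc 1 n, ∑ l : Set.Icc 1 n,
      (if k = l then d else f (((k : ℕ) : ℤ) - ((l : ℕ) : ℤ)).natAbs)
      ≤ d + 2 * ∑ m ∈ Finset.Ico 1 n, f m := by
    intro k
    have e : ∀ l : Set.Icc 1 n,
        (if k = l then d else f (((k : ℕ) : ℤ) - ((l : ℕ) : ℤ)).natAbs)
        = (if k = l then d else 0) +
          (fun l : ℕ => if (k : ℕ) = l then 0 else f (((k : ℕ) : ℤ) - l).natAbs) l := by
      intro l
      by_cases hkl : k = l
      · simp [hkl]
      · have : (k : ℕ) ≠ l := fun h => hkl (Subtype.ext h)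
        simp [hkl, this]
    rw [Finset.sum_congr rfl fun l _ => e l, Finset.sum_add_distrib,
      ← Finset.sum_subtype (Finset.Icc 1 n) hmem
        (fun l : ℕ => if (k : ℕ) = l then 0 else f (((k : ℕ) : ℤ) - l).natAbs)]
    rw [Finset.sum_ite_eq, if_pos (Finset.mem_univ _)]
    gcongr
    exact sum_natAbs_sub_le hf k.2.1 k.2.2
  refine (Finset.sum_le_sum fun k _ => h k).trans_eq ?_
  rw [Finset.sum_const, Finset.card_univ, hcard, nsmul_eq_mul, ← Finset.mul_sum]
  ring

section Array

variable {Ω : Type*} [MeasurableSpace Ω] {P : Measure Ω}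
  {X : ℕ → ℕ → Fin 2 → Ω → ℝ} {ρ₀ : ℕ → ℝ} {ρ : Fin 2 → Fin 2 → ℕ → ℕ → ℝ}

lemma IsGaussianArray.hasGaussianLaw (hX : IsGaussianArray P X ρ₀ ρ) {n k : ℕ} (hk1 : 1 ≤ k)
    (hkn : k ≤ n) (i : Fin 2) : HasGaussianLaw (X n k i) P :=
  HasGaussianLaw.eval (X := fun (p : Set.Icc 1 n × Fin 2) ω => X n p.1 p.2 ω)
    (hX.gaussian n (hk1.trans hkn)) (⟨k, hk1, hkn⟩, i)

lemma IsGaussianArray.abs_le_one [IsProbabilityMeasure P] (hX : IsGaussianArray P X ρ₀ ρ) {n : ℕ} (hn : 1 ≤ n) :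
    |ρ₀ n| ≤ 1 := by
  have h0 := (hX.hasGaussianLaw le_rfl hn 0).memLp_two
  have h1 := (hX.hasGaussianLaw le_rfl hn 1).memLp_two
  have ha := variance_nonneg (X n 1 0 + X n 1 1) P
  have hs := variance_nonneg (X n 1 0 - X n 1 1) P
  rw [variance_add h0 h1, hX.var n 1 0 le_rfl hn, hX.var n 1 1 le_rfl hn,
    hX.corr_same n 1 le_rfl hn] at ha
  rw [variance_sub h0 h1, hX.var n 1 0 le_rfl hn, hX.var n 1 1 le_rfl hn,
    hX.corr_same n 1 le_rfl hn] at hs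
  rw [_root_.abs_le]
  constructor <;> linarith

/-- The covariance matrix of a row, with the correlations of different components read off from
`ρ 0 1`. -/
noncomputable def arrayCov (ρ₀ : ℕ → ℝ) (ρ : Fin 2 → Fin 2 → ℕ → ℕ → ℝ) (n : ℕ)
    (p q : Set.Icc 1 n × Fin 2) : ℝ :=
  if p.1 = q.1 then (if p.2 = q.2 then 1 else ρ₀ n)
  else ρ (min p.2 q.2) (max p.2 q.2) (((p.1 : ℕ) : ℤ) - ((q.1 : ℕ) : ℤ)).natAbs n

lemma IsGaussianArray.covariance_eq (hX : IsGaussianArray P X ρ₀ ρ) (n : ℕ)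
    (p q : Set.Icc 1 n × Fin 2) :
    cov[X n p.1 p.2, X n q.1 q.2; P] = arrayCov ρ₀ ρ n p q := by
  obtain ⟨⟨k, hk1, hkn⟩, i⟩ := p
  obtain ⟨⟨l, hl1, hln⟩, j⟩ := q
  simp only [arrayCov]
  split_ifs with hkl hij
  · obtain rfl : k = l := congrArg Subtype.val hkl
    subst hij
    rw [covariance_self (hX.hasGaussianLaw hk1 hkn i).aemeasurable, hX.var n k i hk1 hkn]
  · obtain rfl : k = l := congrArg Subtype.val hkl
    have h := hX.corr_same n k hk1 hkn
    fin_cases i <;> fin_cases j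
    · exact absurd rfl hij
    · exact h
    · rw [covariance_comm]; exact h
    · exact absurd rfl hij
  · have hne : k ≠ l := fun h => hkl (Subtype.ext h)
    rcases le_total i j with hij | hij
    · rw [min_eq_left hij, max_eq_right hij]
      exact hX.corr_diff n k l i j hk1 hkn hl1 hln hne
    · rw [min_eq_right hij, max_eq_left hij, covariance_comm,
        hX.corr_diff n l k j i hl1 hln hk1 hkn (Ne.symm hne), ← Int.natAbs_neg, neg_sub]

end Array

lemma sum_prod_natAbs_sub_le {f : Fin 2 → Fin 2 → ℕ → ℝ} (hf : ∀ i j m, 0 ≤ f i j m) (n : ℕ)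
    (d : ℝ) :
    ∑ p : Set.Icc 1 n × Fin 2, ∑ q : Set.Icc 1 n × Fin 2,
      (if p.1 = q.1 then d else f p.2 q.2 (((p.1 : ℕ) : ℤ) - ((q.1 : ℕ) : ℤ)).natAbs)
      ≤ ∑ i : Fin 2, ∑ j : Fin 2, (n * d + 2 * ∑ m ∈ Finset.Ico 1 n, n * f i j m) := by
  rw [Fintype.sum_prod_type_right]
  refine Finset.sum_le_sum fun i _ => ?_
  simp_rw [Fintype.sum_prod_type_right]
  rw [Finset.sum_comm]
  exact Finset.sum_le_sum fun j _ => sum_sum_natAbs_sub_le (hf i j) n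

lemma sum_arrayCov_sub_le (ρ₀ σ₀ : ℕ → ℝ) (ρ σ R : Fin 2 → Fin 2 → ℕ → ℕ → ℝ) (R₀ w : ℝ) (n : ℕ) :
    ∑ p : Set.Icc 1 n × Fin 2, ∑ q ∈ Finset.univ.erase p,
      |arrayCov ρ₀ ρ n p q - arrayCov σ₀ σ n p q| * densityBound
        (if p.1 = q.1 then R₀ else R (min p.2 q.2) (max p.2 q.2)
          (((p.1 : ℕ) : ℤ) - ((q.1 : ℕ) : ℤ)).natAbs n) w
      ≤ ∑ i : Fin 2, ∑ j : Fin 2, (n * (|ρ₀ n - σ₀ n| * densityBound R₀ w) +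
        2 * ∑ m ∈ Finset.Ico 1 n, n * (|ρ (min i j) (max i j) m n - σ (min i j) (max i j) m n| *
          densityBound (R (min i j) (max i j) m n) w)) := by
  refine le_trans (Finset.sum_le_sum fun p _ => ?_) (sum_prod_natAbs_sub_le (f := fun i j m =>
    |ρ (min i j) (max i j) m n - σ (min i j) (max i j) m n| *
      densityBound (R (min i j) (max i j) m n) w)
    (fun i j m => mul_nonneg (abs_nonneg _) (densityBound_nonneg _ _)) n
    (|ρ₀ n - σ₀ n| * densityBound R₀ w))
  refine (Finset.sum_le_sum_of_subset_of_nonneg (Finset.erase_subset _ _)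
    fun q _ _ => mul_nonneg (abs_nonneg _) (densityBound_nonneg _ _)).trans ?_
  refine Finset.sum_le_sum fun q _ => ?_
  have hd := mul_nonneg (abs_nonneg (ρ₀ n - σ₀ n)) (densityBound_nonneg R₀ w)
  rw [arrayCov, arrayCov]
  by_cases h : p.1 = q.1
  · rw [if_pos h, if_pos h, if_pos h, if_pos h]
    by_cases h' : p.2 = q.2
    · rw [if_pos h', if_pos h', sub_self, abs_zero, zero_mul]
      exact hd
    · rw [if_neg h', if_neg h']
  · rw [if_neg h, if_neg h, if_neg h, if_neg h]

section Array

variable {Ω Ω' : Type*} [MeasurableSpace Ω] [MeasurableSpace Ω'] {P : Measure Ω}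
  {Q : Measure Ω'}
  {X : ℕ → ℕ → Fin 2 → Ω → ℝ} {ρ₀ : ℕ → ℝ} {ρ : Fin 2 → Fin 2 → ℕ → ℕ → ℝ}
  {τ : Fin 2 → Fin 2 → ℝ} {lam : ℝ≥0∞} {Z W : Ω' → ℝ}

lemma sqrt_div_mul_sqrt_div {x y c L : ℝ} (hx : 0 < x) (hy : 0 < y) (hL : 0 < L) :
    √(x / L) * √(y / L) * (c / √(x * y)) = c / L := by
  rw [← Real.sqrt_mul (by positivity), div_mul_div_comm, Real.sqrt_div (by positivity),
    Real.sqrt_mul_self hL.le]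
  have : 0 < √(x * y) := by positivity
  field_simp

/-- The comparison model: a common factor distributed as `(Z, W)` with strength
`τ i i / log n`. -/
lemma covariance_comparisonModel
    (hZW : IsStdBivariateGaussian Q Z W (τ 0 1 / √(τ 0 0 * τ 1 1))) (h0 : 0 < τ 0 0)
    (h1 : 0 < τ 1 1) {n : ℕ} (hL : 0 < Real.log n) (h0' : τ 0 0 / Real.log n ≤ 1)
    (h1' : τ 1 1 / Real.log n ≤ 1) (p q : Set.Icc 1 n × Fin 2) :
    cov[fun z => factorModel (fun i => τ i i / Real.log n) (noiseCorr τ ρ₀ n) z.1 (z.2 p.1) p.2,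
      fun z => factorModel (fun i => τ i i / Real.log n) (noiseCorr τ ρ₀ n) z.1 (z.2 q.1) q.2;
      factorLaw (Set.Icc 1 n) (Q.map fun ω => (Z ω, W ω))]
      = arrayCov (modelCorr τ ρ₀) (fun i j _ n => τ i j / Real.log n) n p q := by
  have : IsGaussian (Q.map fun ω => (Z ω, W ω)) := hZW.gaussian.isGaussian_map
  have hm := hZW.gaussian.aemeasurable
  have v0 : Var[fun z : ℝ × ℝ => z.1; Q.map fun ω => (Z ω, W ω)] = 1 := by
    rw [variance_map measurable_fst.aemeasurable hm]; exact hZW.var_fst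
  have v1 : Var[fun z : ℝ × ℝ => z.2; Q.map fun ω => (Z ω, W ω)] = 1 := by
    rw [variance_map measurable_snd.aemeasurable hm]; exact hZW.var_snd
  have hc : cov[fun z : ℝ × ℝ => z.1, fun z : ℝ × ℝ => z.2; Q.map fun ω => (Z ω, W ω)]
      = τ 0 1 / √(τ 0 0 * τ 1 1) := by
    rw [covariance_map measurable_fst.aestronglyMeasurable measurable_snd.aestronglyMeasurable hm]
    exact hZW.corr
  rw [covariance_factorModel v0 v1 hc (by positivity) (by positivity) h0' h1'
    (abs_noiseCorr_le τ ρ₀ n), sqrt_div_mul_sqrt_div h0 h1 hL]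
  obtain ⟨k, i⟩ := p
  obtain ⟨l, j⟩ := q
  simp only [arrayCov, modelCorr, noiseScale]
  by_cases hkl : k = l
  · by_cases hij : i = j <;> simp [hkl, hij]
  · by_cases hij : i = j
    · simp [hkl, hij]
    · fin_cases i <;> fin_cases j
      · exact absurd rfl hij
      · simp [hkl]
      · simp [hkl]
      · exact absurd rfl hij

/-- Pointwise convergence: the model has the stated limit, and the comparison inequality bounds its
distance to the array by the sum of the two kinds of errors, both of which vanish. -/
theorem IsGaussianArray.tendsto_measureReal [IsProbabilityMeasure P] [IsProbabilityMeasure Q]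
    (hX : IsGaussianArray P X ρ₀ ρ)
    (hlam : Tendsto (fun n : ℕ => ENNReal.ofReal ((1 - ρ₀ n) * Real.log n)) atTop (𝓝 (lam ^ 2)))
    (hρ : StrongDependence ρ τ) (hτ : τ 0 1 ≤ √(τ 0 0 * τ 1 1))
    (hlamτ : ENNReal.ofReal (-tauTilde τ) ≤ lam ^ 2)
    (hZW : IsStdBivariateGaussian Q Z W (τ 0 1 / √(τ 0 0 * τ 1 1))) (v : Fin 2 → ℝ) :
    Tendsto (fun n => P.real {ω | ∀ p : Set.Icc 1 n × Fin 2, X n p.1 p.2 ω ≤ u n (v p.2)}) atTop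
      (𝓝 (mixedH Q Z W (lamTilde lam τ) τ (v 0) (v 1))) := by
  have h0 := (hρ 0 0).1
  have h1 := (hρ 1 1).1
  have hb : ∀ᶠ n in atTop, |ρ₀ n| ≤ 1 :=
    (eventually_ge_atTop 1).mono fun n hn => hX.abs_le_one hn
  have hG : IsGaussian (Q.map fun ω => (Z ω, W ω)) := hZW.gaussian.isGaussian_map
  have hm := hZW.gaussian.aemeasurable
  -- The comparison inequality takes one common lower bound for all levels; `u n s` serves for both
  -- components.
  set s := min (v 0) (v 1) with hs
  have hbound : ∀ i j, ∃ R : ℕ → ℕ → ℝ,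
      (∀ᶠ n : ℕ in atTop, ∀ m, 1 ≤ m → m < n →
        0 ≤ R m n ∧ R m n < 1 ∧ ρ i j m n ≤ R m n ∧ τ i j / Real.log n ≤ R m n) ∧
      Tendsto (fun n : ℕ => ∑ m ∈ Finset.Ico 1 n,
        n * (|ρ i j m n - τ i j / Real.log n| * densityBound (R m n) (u n s))) atTop (𝓝 0) := by
    intro i j
    obtain ⟨hpos, δ, ϖ, hδ, -, hϖ, hϖδ, hlim⟩ := hρ i j
    exact exists_bound_tendsto_zero hpos hδ hϖ hϖδ hlim s
  choose R hRev hRlim using hbound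
  obtain ⟨hDev, hDlim⟩ := tendsto_diagonal_bound hb hlam h0 h1 hτ hlamτ s
  have hmodel : Tendsto (fun n : ℕ =>
      (factorLaw (Set.Icc 1 n) (Q.map fun ω => (Z ω, W ω))).real
        {z | ∀ p : Set.Icc 1 n × Fin 2, factorModel (fun i => τ i i / Real.log n)
          (noiseCorr τ ρ₀ n) z.1 (z.2 p.1) p.2 ≤ u n (v p.2)}) atTop
      (𝓝 (mixedH Q Z W (lamTilde lam τ) τ (v 0) (v 1))) := by
    have h := tendsto_integral_factorModel (ν := Q.map fun ω => (Z ω, W ω))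
      (fun i => τ i i) (abs_noiseCorr_le τ ρ₀)
      (tendsto_ofReal_one_sub_noiseCorr hb hlam hlamτ) (v 0) (v 1)
    rw [integral_map hm] at h
    · refine h.congr fun n => ?_
      rw [measureReal_factorModel_le (fun i => u n (v i))]
      simp
    · exact ((continuous_H _).comp (f := fun z : ℝ × ℝ => (v 0 + τ 0 0 - √(2 * τ 0 0) * z.1,
        v 1 + τ 1 1 - √(2 * τ 1 1) * z.2)) (by fun_prop)).aestronglyMeasurable
  have hsum : Tendsto (fun n : ℕ => ∑ i : Fin 2, ∑ j : Fin 2,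
      (n * (|ρ₀ n - modelCorr τ ρ₀ n| * densityBound (max 0 (ρ₀ n)) (u n s)) +
        2 * ∑ m ∈ Finset.Ico 1 n, n * (|ρ (min i j) (max i j) m n -
          τ (min i j) (max i j) / Real.log n| *
          densityBound (R (min i j) (max i j) m n) (u n s)))) atTop (𝓝 0) := by
    have h := tendsto_finsetSum (Finset.univ : Finset (Fin 2)) fun i _ =>
      tendsto_finsetSum (Finset.univ : Finset (Fin 2)) fun j _ =>
        hDlim.add ((hRlim (min i j) (max i j)).const_mul 2)
    rw [mul_zero, add_zero, Finset.sum_const_zero, Finset.sum_const_zero] at h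
    exact h
  have hRall : ∀ᶠ n : ℕ in atTop, ∀ i j m, 1 ≤ m → m < n →
        0 ≤ R i j m n ∧ R i j m n < 1 ∧ ρ i j m n ≤ R i j m n ∧ τ i j / Real.log n ≤ R i j m n := by
    simp only [eventually_all]
    exact hRev
  refine (tendsto_iff_of_dist ?_).2 hmodel
  refine squeeze_zero' (Eventually.of_forall fun _ => dist_nonneg) ?_ hsum
  filter_upwards [hRall, hDev, (tendsto_u_atTop s).eventually_ge_atTop 1, eventually_ge_atTop 2,
    (tendsto_div_log (τ 0 0)).eventually_le_const (by norm_num : (0 : ℝ) < 1),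
    (tendsto_div_log (τ 1 1)).eventually_le_const (by norm_num : (0 : ℝ) < 1)]
    with n hR hD hw hn h0' h1'
  have hL := log_natCast_pos hn
  rw [Real.dist_eq]
  refine le_trans (abs_measureReal_sub_le_of_gaussian (w := u n s)
    (u := fun p : Set.Icc 1 n × Fin 2 => u n (v p.2)) (hX.gaussian n (by omega))
    hasGaussianLaw_factorModel (fun p => hX.mean n _ _ p.1.2.1 p.1.2.2)
    (fun p => integral_factorModel ?_ ?_ p.1 p.2) (hX.covariance_eq n)
    (covariance_comparisonModel hZW h0 h1 hL h0' h1') (by simp [arrayCov]) (by simp [arrayCov])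
    hw ?_ (R := fun p q => if p.1 = q.1 then max 0 (ρ₀ n) else R (min p.2 q.2) (max p.2 q.2)
          (((p.1 : ℕ) : ℤ) - ((q.1 : ℕ) : ℤ)).natAbs n) ?_) (sum_arrayCov_sub_le _ _ _ _ _ _ _ _)
  · rw [integral_map hm measurable_fst.aestronglyMeasurable]; exact hZW.mean_fst
  · rw [integral_map hm measurable_snd.aestronglyMeasurable]; exact hZW.mean_snd
  · rintro ⟨k, i⟩
    refine u_mono n ?_
    fin_cases i
    · exact min_le_left _ _
    · exact min_le_right _ _
  · rintro ⟨k, i⟩ ⟨l, j⟩ hne hcne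
    by_cases hkl : k = l
    · have hij : i ≠ j := fun h => hne (by rw [hkl, h])
      simp only [arrayCov, hkl, hij, if_true, if_false] at hcne ⊢
      obtain ⟨hlt, hle⟩ := hD hcne
      exact ⟨le_max_left _ _, hlt, le_max_right _ _, hle⟩
    · simp only [arrayCov, hkl, if_false]
      have hk := k.2
      have hl := l.2
      have hkl' : (k : ℕ) ≠ l := fun h => hkl (Subtype.ext h)
      simp only [Set.mem_Icc] at hk hl
      exact hR _ _ _ (by omega) (by omega)

end Array

/-! ### Maxima and uniform convergence -/

section Maxima

variable {Ω Ω' : Type*} [MeasurableSpace Ω] [MeasurableSpace Ω'] {P : Measure Ω}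
  {X : ℕ → ℕ → Fin 2 → Ω → ℝ} {ρ₀ : ℕ → ℝ} {ρ : Fin 2 → Fin 2 → ℕ → ℕ → ℝ}

lemma M_le_iff {Ω : Type*} {X : ℕ → ℕ → Fin 2 → Ω → ℝ} {n : ℕ} (hn : 1 ≤ n) (i : Fin 2) (ω : Ω)
    (c : ℝ) : M X n i ω ≤ c ↔ ∀ k : Set.Icc 1 n, X n k i ω ≤ c := by
  have : Nonempty (Set.Icc 1 n) := ⟨⟨1, le_rfl, hn⟩⟩
  exact ciSup_le_iff (Set.finite_range _).bddAbove

lemma IsGaussianArray.aemeasurable_M (hX : IsGaussianArray P X ρ₀ ρ) (n : ℕ) (i : Fin 2) :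
    AEMeasurable (M X n i) P :=
  AEMeasurable.iSup fun k : Set.Icc 1 n => (hX.hasGaussianLaw k.2.1 k.2.2 i).aemeasurable

/-- The distribution function of the normalized maxima of row `n`. -/
noncomputable def maxCDF (P : Measure Ω) (X : ℕ → ℕ → Fin 2 → Ω → ℝ) (n : ℕ) (x y : ℝ) : ℝ :=
  P.real {ω | M X n 0 ω ≤ u n x ∧ M X n 1 ω ≤ u n y}

lemma maxCDF_mono [IsProbabilityMeasure P] (n : ℕ) {x x' y y' : ℝ} (hx : x ≤ x') (hy : y ≤ y') :
    maxCDF P X n x y ≤ maxCDF P X n x' y' :=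
  measureReal_mono fun _ h => ⟨h.1.trans (u_mono n hx), h.2.trans (u_mono n hy)⟩

/-- When both maxima are below `u n K`, clamping `x` and `y` at `K` does not change the event; the
last term is the probability of the contrary. This is the clamping hypothesis of
`eventually_abs_sub_le_of_monotone`. -/
lemma IsGaussianArray.maxCDF_le_min_add [IsProbabilityMeasure P] (hX : IsGaussianArray P X ρ₀ ρ)
    (n : ℕ) (K x y : ℝ) :
    maxCDF P X n x y ≤ maxCDF P X n (min x K) (min y K) + (1 - maxCDF P X n K K) := by
  have hnull : NullMeasurableSet {ω | M X n 0 ω ≤ u n K ∧ M X n 1 ω ≤ u n K} P :=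
    (nullMeasurableSet_le (hX.aemeasurable_M n 0) aemeasurable_const).inter
      (nullMeasurableSet_le (hX.aemeasurable_M n 1) aemeasurable_const)
  unfold maxCDF
  rw [← probReal_compl_eq_one_sub₀ hnull]
  refine (measureReal_mono ?_).trans (measureReal_union_le _ _)
  rintro ω ⟨h0, h1⟩
  by_cases h : M X n 0 ω ≤ u n K ∧ M X n 1 ω ≤ u n K
  · refine Or.inl ⟨?_, ?_⟩
    · rw [(u_mono n).map_min]; exact le_min h0 h.1
    · rw [(u_mono n).map_min]; exact le_min h1 h.2
  · exact Or.inr h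

lemma maxCDF_eq {n : ℕ} (hn : 1 ≤ n) (x y : ℝ) :
    maxCDF P X n x y
      = P.real {ω | ∀ p : Set.Icc 1 n × Fin 2, X n p.1 p.2 ω ≤ u n (![x, y] p.2)} := by
  unfold maxCDF
  congr 1
  ext ω
  simp only [Set.mem_ofPred_eq, M_le_iff hn, Prod.forall, Fin.forall_fin_two]
  exact forall_and.symm

theorem IsGaussianArray.eventually_abs_maxCDF_sub_le [IsProbabilityMeasure P] {Q : Measure Ω'}
    [IsProbabilityMeasure Q] (hX : IsGaussianArray P X ρ₀ ρ) {lam : ℝ≥0∞}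
    (hlam : Tendsto (fun n : ℕ => ENNReal.ofReal ((1 - ρ₀ n) * Real.log n)) atTop (𝓝 (lam ^ 2)))
    {τ : Fin 2 → Fin 2 → ℝ} (hρ : StrongDependence ρ τ) (hτ : τ 0 1 ≤ √(τ 0 0 * τ 1 1))
    (hlamτ : ENNReal.ofReal (-tauTilde τ) ≤ lam ^ 2) {Z W : Ω' → ℝ}
    (hZW : IsStdBivariateGaussian Q Z W (τ 0 1 / √(τ 0 0 * τ 1 1))) {ε : ℝ} (hε : 0 < ε) :
    ∀ᶠ n in atTop, ∀ x y,
      |maxCDF P X n x y - mixedH Q Z W (lamTilde lam τ) τ x y| ≤ ε := by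
  have hZ := hZW.gaussian.fst.aemeasurable
  have hW := hZW.gaussian.snd.aemeasurable
  have hlim : ∀ x y, Tendsto (fun n => maxCDF P X n x y) atTop
      (𝓝 (mixedH Q Z W (lamTilde lam τ) τ x y)) := fun x y =>
    (hX.tendsto_measureReal hlam hρ hτ hlamτ hZW ![x, y]).congr'
      ((eventually_ge_atTop 1).mono fun n hn => (maxCDF_eq hn x y).symm)
  exact eventually_abs_sub_le_of_monotone (F := maxCDF P X)
    (fun n _ _ _ _ hx hy => maxCDF_mono n hx hy) (fun _ _ _ => measureReal_nonneg)
    (Eventually.of_forall fun n => hX.maxCDF_le_min_add n) hlim (continuous_mixedH hZ hW _ τ)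
    (tendsto_mixedH (x := fun K => K) (y := fun K => K) hZ hW _ τ (tendsto_H_atTop _))
    (tendsto_mixedH (x := fun K => -K) (y := fun K => K) hZ hW _ τ (tendsto_H_left _))
    (tendsto_mixedH (x := fun K => K) (y := fun K => -K) hZ hW _ τ (tendsto_H_right _)) hε

end Maxima

end HuslerReiss

theorem theorem1p2 {Ω Ω' : Type*} [MeasurableSpace Ω] [MeasurableSpace Ω']
    (P : Measure Ω) [IsProbabilityMeasure P] (Q : Measure Ω') [IsProbabilityMeasure Q]
    (X : ℕ → ℕ → Fin 2 → Ω → ℝ) (ρ₀ : ℕ → ℝ) (ρ : Fin 2 → Fin 2 → ℕ → ℕ → ℝ)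
    (hX : HuslerReiss.IsGaussianArray P X ρ₀ ρ)
    (lam : ℝ≥0∞)
    (hlam : Tendsto (fun n : ℕ => ENNReal.ofReal ((1 - ρ₀ n) * Real.log n)) atTop (𝓝 (lam ^ 2)))
    (τ : Fin 2 → Fin 2 → ℝ)
    (hρ : HuslerReiss.StrongDependence ρ τ)
    (hτ : τ 0 1 ≤ √(τ 0 0 * τ 1 1))
    (hlamτ : ENNReal.ofReal (-HuslerReiss.tauTilde τ) ≤ lam ^ 2)
    (Z W : Ω' → ℝ)
    (hZW : HuslerReiss.IsStdBivariateGaussian Q Z W (τ 0 1 / √(τ 0 0 * τ 1 1))) :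
    Tendsto (fun n : ℕ => ⨆ p : ℝ × ℝ,
      |P.real {ω | HuslerReiss.M X n 0 ω ≤ HuslerReiss.u n p.1 ∧
          HuslerReiss.M X n 1 ω ≤ HuslerReiss.u n p.2}
        - ∫ ω, HuslerReiss.H (HuslerReiss.lamTilde lam τ)
            (p.1 + τ 0 0 - √(2 * τ 0 0) * Z ω)
            (p.2 + τ 1 1 - √(2 * τ 1 1) * W ω) ∂Q|)
      atTop (𝓝 0) := by
  rw [Metric.tendsto_nhds]
  intro ε hε
  filter_upwards [hX.eventually_abs_maxCDF_sub_le hlam hρ hτ hlamτ hZW (half_pos hε)] with n hn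
  rw [Real.dist_eq, sub_zero, abs_of_nonneg (Real.iSup_nonneg fun _ => abs_nonneg _)]
  refine lt_of_le_of_lt (Real.iSup_le (fun p => ?_) (half_pos hε).le) (half_lt_self hε)
  exact hn p.1 p.2
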